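/- **Setting.** Work over $\mathbb R$; let $n\ge 0$ and $d=n+1$. *Graph complex.* $\mathrm{Gra}_d(N)$ is the vector space spanned by directed multigraphs (tadpoles allowed) with vertices $1,\dots,N$ and totally ordered edges, modulo the relations: reversing an edge costs $(-1)^d$, permuting the edges by $\sigma$ costs $\mathrm{sgn}(\sigma)^{d+1}$. The partial composition $x\circ_1y$ inserts $y$ in the first vertex of $x$, summing over all ways of reconnecting the edge ends at that vertex to the vertices of $y$. The full graph complex is $\mathsf{fGC}_d=\prod_{N\ge1}\big(\mathrm{Gra}_d(N)\otimes\mathrm{sgn}_N^{\otimes d}\big)^{\mathbb S_N}$, a graph with $N$ vertices and $k$ edges having degree $d(N-1)+k(1-d)$, with differential $\delta=[\,\bullet\!\!-\!\!\bullet\,,\cdot\,]$, the graded commutator with the one-edge graph for the pre-Lie product obtained by summing $x\circ_1y$ over unshuffles of the vertex labels (with signature if $d$ is odd). *Geometry.* Let $\mathcal V$ be an NP-manifold of degree $n$ in Darboux coordinates: finitely many coordinates $z_a$ of degrees $|a|\ge0$, those of degree $0$ ranging over an open set (the base), and a constant nondegenerate Poisson tensor $\omega^{ab}$ of degree $-n$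 (i.e. $\omega^{ab}=0$ unless $|a|+|b|=n$) with $\omega^{ab}=(-1)^{d+|a||b|}\omega^{ba}$. The graded commutative algebra $C^\infty(\mathcal V)$ consists of the functions that are smooth in the coordinates of degree $0$, polynomial in those of positive even degree and exterior in those of odd degree, with the bracket $\{f,g\}=\sum_{a,b}(-1)^{|b||f|}\,\partial_af\;\omega^{ab}\,\partial_bg$. For a graph $\gamma\in\mathrm{Gra}_d(N)$ put $$\mathrm{Rep}^{(d)}_N(\gamma)(f_1\otimes\dots\otimes f_N)=\mu_N\Big(\prod_{(i,j)}\Delta_{ij}\,(f_1\otimes\dots\otimes f_N)\Big),\qquad \Delta_{ij}=\sum_{a,b}\omega^{ab}\,\partial^{(i)}_a\partial^{(j)}_b ,$$ where the product runs over the edges in their order, $\partial_a^{(i)}$ differentiates the $i$-th factor (with Koszul signs) and $\mu_N$ is multiplication. *Flows.* A Hamiltonian function is an $\mathscr H\in C^\infty(\mathcal V)$ of degree $d$ with $\{\mathscr H,\mathscr H\}=0$; $H^\bullet(C^\infty(\mathcal V)|\mathsf Q)$ is the cohomology of $\mathsf Q=\{\mathscr H,\cdot\}$. A (universal) Hamiltonian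 flow is a map assigning to every Hamiltonian function $\mathscr H$ a class $[\dot{\mathscr H}]\in H^d(C^\infty(\mathcal V)|\mathsf Q)$ for which there are finitely many $c_N\in\mathrm{Gra}_d(N)$, independent of $\mathscr H$, such that $\sum_N\mathrm{Rep}^{(d)}_N(c_N)(\mathscr H^{\otimes N})$ represents $[\dot{\mathscr H}]$ for all $\mathscr H$ and is a $\mathsf Q$-cocycle of degree $d$ for all Hamiltonian functions on all NP-manifolds of degree $n$ in Darboux coordinates; these flows form the vector space $\mathsf{Hflow}$. The flow is conformal if for every $\mathscr H$ there is a function $\Omega(\mathscr H)$ of degree $0$ (a function on the base) with $\{\mathscr H,\Omega(\mathscr H)\}=0$ and $[\dot{\mathscr H}]=[\Omega(\mathscr H)\cdot\mathscr H]$; these flows form $\mathsf{cHflow}\subset\mathsf{Hflow}$. Below, $H^\bullet_{\rm fin}(\mathsf{fGC}_d)\subset H^\bullet(\mathsf{fGC}_d)$ is the subspace of the classes represented by cocycles with finitely many nonzero components (for instance cocycles with a fixed number $N$ of vertices). **Proposition.** Let $n\ge0$, $d=n+1$, and let $\mathcal V$ be an NP-manifold of degree $n$ in Darboux coordinates. 1.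 For every cocycle $\gamma=(\gamma_N)_N\in\mathsf{fGC}_d$ of degree $-d$, every $N$ and every Hamiltonian function $\mathscr H$, the function $\mathrm{Rep}^{(d)}_N(\gamma_N)(\mathscr H^{\otimes N})$ is of degree $0$ and $\{\mathscr H,\mathrm{Rep}^{(d)}_N(\gamma_N)(\mathscr H^{\otimes N})\}=0$ (also for the summand of $\gamma_N$ with any given number of edges). Hence, if $\gamma$ has finitely many components, the same holds for $\Omega_\gamma(\mathscr H)=\sum_N\mathrm{Rep}^{(d)}_N(\gamma_N)(\mathscr H^{\otimes N})$. 2. There is a unique linear map $\Phi:H^{-d}_{\rm fin}(\mathsf{fGC}_d)\to\mathsf{cHflow}$ sending the class of every cocycle $\gamma$ with finitely many components to the flow $\dot{\mathscr H}=\Omega_\gamma(\mathscr H)\cdot\mathscr H$; in particular this flow is universal and its class depends only on the cohomology class of $\gamma$. 3. Likewise there is a unique linear map $\Phi_0:H^{0}_{\rm fin}(\mathsf{fGC}_d)\to\mathsf{Hflow}$ sending the class of every cocycle $\gamma$ of degree $0$ with finitely many components to the flow $\dot{\mathscr H}=\sum_N\mathrm{Rep}^{(d)}_N(\gamma_N)(\mathscr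 H^{\otimes N})$. 4. The map $\Phi_0$ is not surjective in general: for some $n$ and some $\mathcal V$ there is a conformal flow in the image of $\Phi$ that is not in the image of $\Phi_0$. -/

import Mathlib

open scoped TensorProduct ContDiff

noncomputable section

namespace GraphFlow

/-! ## Graphs and the graph operad -/

/-- Multidigraphs with vertex set `{0, …, N-1}` and `k` edges, the edges being ordered and directed:
edge number `e` goes from `(g e).1` to `(g e).2`.  Multiple edges and tadpoles are allowed. -/
abbrev LGraph (N k : ℕ) : Type := Fin k → Fin N × Fin N

namespace LGraph

/-- Reverse the direction of the edge `e`. -/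
def flip {N k : ℕ} (g : LGraph N k) (e : Fin k) : LGraph N k :=
  Function.update g e (g e).swap

/-- Permute the order of the edges. -/
def permEdges {N k : ℕ} (g : LGraph N k) (σ : Equiv.Perm (Fin k)) : LGraph N k :=
  fun e => g (σ e)

/-- Push the endpoints of all the edges forward along a map of vertex sets. -/
def mapVertices {N N' k : ℕ} (φ : Fin N → Fin N') (g : LGraph N k) : LGraph N' k :=
  fun e => (φ (g e).1, φ (g e).2)

end LGraph

/-- The relations of the graph operad: reversing an edge costs `(-1)^d`, permuting the edges by `σ`
costs `sgn(σ)^(d+1)`. -/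
def graRel (d N k : ℕ) : Submodule ℝ (LGraph N k →₀ ℝ) :=
  Submodule.span ℝ
    ({x | ∃ (g : LGraph N k) (e : Fin k),
        x = Finsupp.single (g.flip e) (1 : ℝ) - (-1 : ℝ) ^ d • Finsupp.single g (1 : ℝ)} ∪
     {x | ∃ (g : LGraph N k) (σ : Equiv.Perm (Fin k)),
        x = Finsupp.single (g.permEdges σ) (1 : ℝ)
          - ((Equiv.Perm.sign σ : ℤ) : ℝ) ^ (d + 1) • Finsupp.single g (1 : ℝ)})

/-- The summand with `k` edges of the arity `N` component of the graph operad `Gra_d`: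
linear combinations of graphs modulo the relations `graRel`. -/
abbrev Gra (d N k : ℕ) : Type := (LGraph N k →₀ ℝ) ⧸ graRel d N k

namespace Gra

/-- The class of a graph. -/
def mk (d : ℕ) {N k : ℕ} (g : LGraph N k) : Gra d N k :=
  (graRel d N k).mkQ (Finsupp.single g 1)

theorem mk_flip (d : ℕ) {N k : ℕ} (g : LGraph N k) (e : Fin k) :
    mk d (g.flip e) = (-1 : ℝ) ^ d • mk d g := by
  unfold mk
  rw [← map_smul, ← sub_eq_zero, ← map_sub, Submodule.mkQ_apply, Submodule.Quotient.mk_eq_zero]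
  exact Submodule.subset_span (Or.inl ⟨g, e, rfl⟩)

theorem mk_permEdges (d : ℕ) {N k : ℕ} (g : LGraph N k) (σ : Equiv.Perm (Fin k)) :
    mk d (g.permEdges σ) = ((Equiv.Perm.sign σ : ℤ) : ℝ) ^ (d + 1) • mk d g := by
  unfold mk
  rw [← map_smul, ← sub_eq_zero, ← map_sub, Submodule.mkQ_apply, Submodule.Quotient.mk_eq_zero]
  exact Submodule.subset_span (Or.inr ⟨g, σ, rfl⟩)

/-- A function on graphs with the symmetries of `Gra d` extends to a linear map on `Gra d`. -/
def lift {d N k : ℕ} {W : Type*} [AddCommGroup W] [Module ℝ W] (F : LGraph N k → W)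
    (hflip : ∀ g e, F (g.flip e) = (-1 : ℝ) ^ d • F g)
    (hperm : ∀ g σ, F (g.permEdges σ) = ((Equiv.Perm.sign σ : ℤ) : ℝ) ^ (d + 1) • F g) :
    Gra d N k →ₗ[ℝ] W :=
  (graRel d N k).liftQ (Finsupp.linearCombination ℝ F) (by
    rw [graRel, Submodule.span_le]
    rintro x (⟨g, e, rfl⟩ | ⟨g, σ, rfl⟩)
    · simp [hflip]
    · simp [hperm])

theorem lift_mk {d N k : ℕ} {W : Type*} [AddCommGroup W] [Module ℝ W] (F : LGraph N k → W)
    (hflip : ∀ g e, F (g.flip e) = (-1 : ℝ) ^ d • F g)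
    (hperm : ∀ g σ, F (g.permEdges σ) = ((Equiv.Perm.sign σ : ℤ) : ℝ) ^ (d + 1) • F g)
    (g : LGraph N k) : lift F hflip hperm (mk d g) = F g := by
  simp [lift, mk]

/-- Identification of the components along equalities of the numbers of vertices and edges. -/
def cast (d : ℕ) {N N' k k' : ℕ} (hN : N = N') (hk : k = k') : Gra d N k →ₗ[ℝ] Gra d N' k' := by
  subst hN hk
  exact LinearMap.id

theorem ext_mk {d N k : ℕ} {W : Type*} [AddCommGroup W] [Module ℝ W] {A B : Gra d N k →ₗ[ℝ] W}
    (h : ∀ g, A (mk d g) = B (mk d g)) : A = B := by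
  refine Submodule.linearMap_qext _ (Finsupp.lhom_ext' fun g => LinearMap.ext_ring ?_)
  exact h g

theorem mapVertices_flip {N N' k : ℕ} (φ : Fin N → Fin N') (g : LGraph N k) (e : Fin k) :
    (g.flip e).mapVertices φ = (g.mapVertices φ).flip e := by
  funext e'
  by_cases h : e' = e
  · subst h; simp [LGraph.flip, LGraph.mapVertices]
  · simp [LGraph.flip, LGraph.mapVertices, h]

/-- The right action of the symmetric group: the vertex label `i` becomes `σ⁻¹ i`. -/
def permVertices (d : ℕ) {N k : ℕ} (σ : Equiv.Perm (Fin N)) : Gra d N k →ₗ[ℝ] Gra d N k :=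
  lift (fun g => mk d (g.mapVertices ⇑(σ⁻¹)))
    (fun g e => by rw [mapVertices_flip, mk_flip])
    (fun g τ => by rw [← mk_permEdges]; rfl)

/-- The map of vertex sets collapsing the first `N` vertices to the first vertex. -/
def collapse (M N : ℕ) : Fin (N + M) → Fin (M + 1) :=
  Fin.addCases (fun _ => 0) (fun v => v.succ)

open Classical in
/-- Insertion of the graph `h` in place of the first vertex of the graph `g`: sum over all the ways of
reconnecting the edge ends at the first vertex of `g` to the vertices of `h`, that is, over all
graphs `g'` that become `g` when the vertices of `h` are collapsed to the first vertex.  The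
vertices of `h` come first, then the remaining vertices of `g`; the edges of `g` come first, then
those of `h`. -/
def insertGraph (d : ℕ) {M N j k : ℕ} (g : LGraph (M + 1) j) (h : LGraph N k) :
    Gra d (N + M) (j + k) :=
  ∑ g' : LGraph (N + M) j with g'.mapVertices (collapse M N) = g,
    mk d (Fin.append g' (h.mapVertices (Fin.castAdd M)))

theorem flip_flip {N k : ℕ} (g : LGraph N k) (e : Fin k) : (g.flip e).flip e = g := by
  simp [LGraph.flip]

theorem append_flip_left {N j k : ℕ} (g : LGraph N j) (h : LGraph N k) (e : Fin j) :
    (Fin.append (g.flip e) h : LGraph N (j + k)) =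
      LGraph.flip (Fin.append g h) (Fin.castAdd k e) := by
  funext e'
  refine Fin.addCases (fun i => ?_) (fun i => ?_) e'
  · by_cases hi : i = e
    · subst hi; simp [LGraph.flip]
    · simp [LGraph.flip, Function.update_of_ne, hi]
  · have : Fin.natAdd j i ≠ Fin.castAdd k e := by
      intro h; have := congrArg Fin.val h; simp at this; omega
    simp [LGraph.flip, Function.update_of_ne, this]

theorem append_flip_right {N j k : ℕ} (g : LGraph N j) (h : LGraph N k) (e : Fin k) :
    (Fin.append g (h.flip e) : LGraph N (j + k)) =
      LGraph.flip (Fin.append g h) (Fin.natAdd j e) := by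
  funext e'
  refine Fin.addCases (fun i => ?_) (fun i => ?_) e'
  · have : Fin.castAdd k i ≠ Fin.natAdd j e := by
      intro h; have := congrArg Fin.val h; simp at this; omega
    simp [LGraph.flip, Function.update_of_ne, this]
  · by_cases hi : i = e
    · subst hi; simp [LGraph.flip]
    · simp [LGraph.flip, Function.update_of_ne, hi]

theorem append_permEdges {N j k : ℕ} (g : LGraph N j) (h : LGraph N k)
    (σ : Equiv.Perm (Fin j)) (τ : Equiv.Perm (Fin k)) :
    (Fin.append (g.permEdges σ) (h.permEdges τ) : LGraph N (j + k)) =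
      LGraph.permEdges (Fin.append g h)
        (finSumFinEquiv.permCongr (Equiv.Perm.sumCongr σ τ)) := by
  funext e'
  refine Fin.addCases (fun i => ?_) (fun i => ?_) e' <;>
    simp [LGraph.permEdges, Equiv.permCongr_apply]

theorem insertGraph_flip_left (d : ℕ) {M N j k : ℕ} (g : LGraph (M + 1) j) (h : LGraph N k)
    (e : Fin j) : insertGraph d (g.flip e) h = (-1 : ℝ) ^ d • insertGraph d g h := by
  classical
  unfold insertGraph
  rw [Finset.smul_sum]
  refine Finset.sum_bij' (fun g' _ => g'.flip e) (fun g' _ => g'.flip e) ?_ ?_ ?_ ?_ ?_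
  · intro a ha
    simp only [Finset.mem_filter, Finset.mem_univ, true_and] at ha ⊢
    rw [mapVertices_flip, ha, flip_flip]
  · intro a ha
    simp only [Finset.mem_filter, Finset.mem_univ, true_and] at ha ⊢
    rw [mapVertices_flip, ha]
  · intro a _; exact flip_flip a e
  · intro a _; exact flip_flip a e
  · intro a _
    rw [append_flip_left, mk_flip, smul_smul, ← mul_pow]
    simp

theorem insertGraph_flip_right (d : ℕ) {M N j k : ℕ} (g : LGraph (M + 1) j) (h : LGraph N k)
    (e : Fin k) : insertGraph d g (h.flip e) = (-1 : ℝ) ^ d • insertGraph d g h := by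
  classical
  unfold insertGraph
  rw [Finset.smul_sum]
  refine Finset.sum_congr rfl fun a _ => ?_
  rw [mapVertices_flip, append_flip_right, mk_flip]

theorem insertGraph_permEdges_left (d : ℕ) {M N j k : ℕ} (g : LGraph (M + 1) j) (h : LGraph N k)
    (σ : Equiv.Perm (Fin j)) : insertGraph d (g.permEdges σ) h =
      ((Equiv.Perm.sign σ : ℤ) : ℝ) ^ (d + 1) • insertGraph d g h := by
  classical
  unfold insertGraph
  rw [Finset.smul_sum]
  symm
  refine Finset.sum_bij' (fun g' _ => LGraph.permEdges g' σ)
    (fun g' _ => LGraph.permEdges g' σ⁻¹) ?_ ?_ ?_ ?_ ?_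
  · intro a ha
    simp only [Finset.mem_filter, Finset.mem_univ, true_and] at ha ⊢
    rw [← ha]; rfl
  · intro a ha
    simp only [Finset.mem_filter, Finset.mem_univ, true_and] at ha ⊢
    have : (LGraph.permEdges a σ⁻¹).mapVertices (collapse M N) =
        (a.mapVertices (collapse M N)).permEdges σ⁻¹ := rfl
    rw [this, ha]; funext i; simp [LGraph.permEdges]
  · intro a _; funext i; simp [LGraph.permEdges]
  · intro a _; funext i; simp [LGraph.permEdges]
  · intro a _
    have := append_permEdges a (h.mapVertices (Fin.castAdd M)) σ 1
    have h1 : LGraph.permEdges (h.mapVertices (Fin.castAdd M)) (1 : Equiv.Perm (Fin k)) =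
      h.mapVertices (Fin.castAdd M) := rfl
    rw [h1] at this
    rw [this, mk_permEdges]
    simp

theorem insertGraph_permEdges_right (d : ℕ) {M N j k : ℕ} (g : LGraph (M + 1) j)
    (h : LGraph N k) (σ : Equiv.Perm (Fin k)) : insertGraph d g (h.permEdges σ) =
      ((Equiv.Perm.sign σ : ℤ) : ℝ) ^ (d + 1) • insertGraph d g h := by
  classical
  unfold insertGraph
  rw [Finset.smul_sum]
  refine Finset.sum_congr rfl fun a _ => ?_
  have := append_permEdges a (h.mapVertices (Fin.castAdd M)) 1 σ
  have h1 : LGraph.permEdges a (1 : Equiv.Perm (Fin j)) = a := rfl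
  rw [h1] at this
  have h2 : (h.permEdges σ).mapVertices (Fin.castAdd M) =
    (h.mapVertices (Fin.castAdd M)).permEdges σ := rfl
  rw [h2, this, mk_permEdges]
  simp

/-- The partial composition `x ∘₁ y` (insertion in the first vertex) of the graph operad. -/
def comp₁ (d : ℕ) {M N j k : ℕ} :
    Gra d (M + 1) j →ₗ[ℝ] Gra d N k →ₗ[ℝ] Gra d (N + M) (j + k) :=
  lift (fun g => lift (fun h => insertGraph d g h) (insertGraph_flip_right d g)
      (insertGraph_permEdges_right d g))
    (fun g e => ext_mk fun h => by
      rw [lift_mk, LinearMap.smul_apply, lift_mk, insertGraph_flip_left])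
    (fun g σ => ext_mk fun h => by
      rw [lift_mk, LinearMap.smul_apply, lift_mk, insertGraph_permEdges_left])

/-- `σ` is an unshuffle of type `(p, q)`: its inverse is increasing on the first `p` and on the last `q`
labels. -/
def IsUnshuffle {p q : ℕ} (σ : Equiv.Perm (Fin (p + q))) : Prop :=
  (StrictMono fun i : Fin p => σ⁻¹ (Fin.castAdd q i)) ∧
    StrictMono fun i : Fin q => σ⁻¹ (Fin.natAdd p i)

open Classical in
/-- The pre-Lie product of the full graph complex (`x` has `M + 1` vertices, `y` has `N`). -/
def preLie (d : ℕ) {M N j k : ℕ} :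
    Gra d (M + 1) j →ₗ[ℝ] Gra d N k →ₗ[ℝ] Gra d (N + M) (j + k) :=
  ∑ σ : Equiv.Perm (Fin (N + M)) with IsUnshuffle σ,
    ((Equiv.Perm.sign σ : ℤ) : ℝ) ^ d • (comp₁ d).compr₂ (permVertices d σ)

end Gra

/-! ## The full graph complex -/

/-- The degree in `fGC_d` of a graph with `N + 1` vertices and `k` edges. -/
def fgcDegree (d N k : ℕ) : ℤ := (d : ℤ) * N + k * (1 - (d : ℤ))

/-- The graded commutator of the pre-Lie product. -/
def Gra.bracket (d : ℕ) {M N j k : ℕ} (x : Gra d (M + 1) j) :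
    Gra d (N + 1) k →ₗ[ℝ] Gra d (M + N + 1) (j + k) :=
  Gra.cast d (by omega) rfl ∘ₗ Gra.preLie d x
    - ((-1 : ℝ) ^ (fgcDegree d M j * fgcDegree d N k)) •
      (Gra.cast d (by omega) (by omega) ∘ₗ (Gra.preLie d).flip x)

/-- The graph with two vertices and one edge, the Maurer-Cartan element of `fGC_d`. -/
def Gra.edge (d : ℕ) : Gra d (1 + 1) 1 := Gra.mk d fun _ => (0, 1)

/-- Families `(c N k)` of elements of `Gra_d`, the member `c N k` having `N + 1 ≥ 1` vertices and `k`
edges. -/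
def GraFamily (d : ℕ) : Type := (N k : ℕ) → Gra d (N + 1) k

instance (d : ℕ) : AddCommGroup (GraFamily d) :=
  inferInstanceAs (AddCommGroup ((N k : ℕ) → Gra d (N + 1) k))

instance (d : ℕ) : Module ℝ (GraFamily d) :=
  inferInstanceAs (Module ℝ ((N k : ℕ) → Gra d (N + 1) k))

/-- The differential `δ = [edge, ·]`, which adds one vertex and one edge. -/
def diff (d : ℕ) : GraFamily d →ₗ[ℝ] GraFamily d where
  toFun c
    | 0, _ => 0
    | _ + 1, 0 => 0
    | N + 1, k + 1 => Gra.cast d (by omega) (by omega) (Gra.bracket d (Gra.edge d) (c N k))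
  map_add' c c' := by
    funext N k
    rcases N with _ | N
    · exact (add_zero (0 : Gra d (0 + 1) k)).symm
    rcases k with _ | k
    · exact (add_zero (0 : Gra d (N + 1 + 1) 0)).symm
    change Gra.cast d _ _ (Gra.bracket d (Gra.edge d) (c N k + c' N k)) = _
    rw [map_add, map_add]
    rfl
  map_smul' r c := by
    funext N k
    rcases N with _ | N
    · exact (smul_zero r : r • (0 : Gra d (0 + 1) k) = 0).symm
    rcases k with _ | k
    · exact (smul_zero r : r • (0 : Gra d (N + 1 + 1) 0) = 0).symm
    change Gra.cast d _ _ (Gra.bracket d (Gra.edge d) (r • c N k)) = _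
    rw [map_smul, map_smul]
    rfl

/-- The full graph complex `fGC_d`: families of elements that are invariant under permutations of the
vertices, twisted by the signature if `d` is odd. -/
def fGC (d : ℕ) : Submodule ℝ (GraFamily d) where
  carrier := {c | ∀ N k (σ : Equiv.Perm (Fin (N + 1))),
    Gra.permVertices d σ (c N k) = ((Equiv.Perm.sign σ : ℤ) : ℝ) ^ d • c N k}
  add_mem' {a b} ha hb N k σ := by
    change Gra.permVertices d σ (a N k + b N k) = _ • (a N k + b N k)
    rw [map_add, ha N k σ, hb N k σ, smul_add]
  zero_mem' N k σ := by
    change Gra.permVertices d σ 0 = _ • (0 : Gra d (N + 1) k)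
    rw [map_zero, smul_zero]
  smul_mem' r c hc N k σ := by
    change Gra.permVertices d σ (r • c N k) = _ • r • c N k
    rw [map_smul, hc N k σ, smul_comm]

/-- The cochains of degree `j` of the full graph complex. -/
def fgcCochains (d : ℕ) (j : ℤ) : Submodule ℝ (GraFamily d) where
  carrier := {c | c ∈ fGC d ∧ ∀ N k, fgcDegree d N k ≠ j → c N k = 0}
  add_mem' {a b} ha hb := ⟨add_mem ha.1 hb.1, fun N k h => by
    change a N k + b N k = 0
    rw [ha.2 N k h, hb.2 N k h, add_zero]⟩
  zero_mem' := ⟨zero_mem _, fun _ _ _ => rfl⟩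
  smul_mem' r c hc := ⟨Submodule.smul_mem _ r hc.1, fun N k h => by
    change r • c N k = 0
    rw [hc.2 N k h, smul_zero]⟩

/-- The cocycles of degree `j` of the full graph complex. -/
def fgcCocycles (d : ℕ) (j : ℤ) : Submodule ℝ (GraFamily d) :=
  fgcCochains d j ⊓ LinearMap.ker (diff d)

/-- The coboundaries of degree `j` of the full graph complex. -/
def fgcCoboundaries (d : ℕ) (j : ℤ) : Submodule ℝ (GraFamily d) :=
  (fgcCochains d (j - 1)).map (diff d)

/-- The cohomology `H^j(fGC_d)`. -/
abbrev fgcCohomology (d : ℕ) (j : ℤ) : Type :=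
  fgcCocycles d j ⧸ (fgcCoboundaries d j).comap (fgcCocycles d j).subtype

/-- The families with only finitely many nonzero members. -/
def finiteFamilies (d : ℕ) : Submodule ℝ (GraFamily d) where
  carrier := {c | {p : ℕ × ℕ | c p.1 p.2 ≠ 0}.Finite}
  add_mem' {a b} ha hb := (ha.union hb).subset fun p hp => by
    by_contra h
    rw [Set.mem_union, not_or] at h
    have h1 : a p.1 p.2 = 0 := not_not.1 h.1
    have h2 : b p.1 p.2 = 0 := not_not.1 h.2
    apply hp
    change a p.1 p.2 + b p.1 p.2 = 0
    rw [h1, h2, add_zero]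
  zero_mem' := Set.finite_empty.subset fun p hp => hp rfl
  smul_mem' r c hc := hc.subset fun p hp h => by
    apply hp
    change r • c p.1 p.2 = 0
    rw [h, smul_zero]

/-- The classes in `H^j(fGC_d)` that are represented by a cocycle with finitely many components, e.g. by a
cocycle all of whose graphs have `N` vertices, for some `N`. -/
def finiteCohomology (d : ℕ) (j : ℤ) : Submodule ℝ (fgcCohomology d j) :=
  ((finiteFamilies d).comap (fgcCocycles d j).subtype).map (Submodule.mkQ _)

/-- The class of a cocycle with finitely many components. -/
def cocycleClass {d : ℕ} {j : ℤ} (γ : fgcCocycles d j)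
    (hγ : (γ : GraFamily d) ∈ finiteFamilies d) : finiteCohomology d j :=
  ⟨Submodule.mkQ _ γ, Submodule.mem_map_of_mem hγ⟩

/-! ## Graded symplectic manifolds in Darboux coordinates -/

/-- An NP-manifold of degree `n` in Darboux coordinates: finitely many coordinates `z_a` of degrees
`deg a ≥ 0`; the coordinates of degree zero range over the open set `dom`, the other ones are
formal; the matrix `pairing` consists of the (constant) coefficients of the Poisson bracket, see
`DarbouxChart.bracket` below.  For Darboux coordinates `x, p, ψ, χ, ξ` the nonzero coefficients are
`±1` on the pairs `(x, p)`, `(p, x)`, `(ψ, χ)`, `(χ, ψ)` and `κ^{ab}` on the pairs `(ξ_a, ξ_b)`. -/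
structure DarbouxChart (n : ℕ) where
  /-- the number of coordinates -/
  r : ℕ
  /-- the degrees of the coordinates -/
  deg : Fin r → ℕ
  /-- the domain of the coordinates of degree zero, which is the base manifold -/
  dom : TopologicalSpace.Opens ({a : Fin r // deg a = 0} → ℝ)
  /-- the constant Poisson tensor -/
  pairing : Fin r → Fin r → ℝ
  /-- the Poisson tensor has degree `-n` -/
  pairing_degree : ∀ a b, pairing a b ≠ 0 → deg a + deg b = n
  /-- the Poisson tensor is graded (skew)symmetric -/
  pairing_symm : ∀ a b, pairing a b = (-1) ^ (n + 1 + deg a * deg b) * pairing b a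
  /-- the Poisson tensor is nondegenerate -/
  pairing_nondeg : IsUnit (Matrix.of pairing).det

/-- Extension by zero of a function on an open set. -/
def extendZero {ι : Type} (U : TopologicalSpace.Opens (ι → ℝ)) (f : U → ℝ) : (ι → ℝ) → ℝ :=
  Function.extend Subtype.val f 0

theorem extendZero_apply {ι : Type} (U : TopologicalSpace.Opens (ι → ℝ)) (f : U → ℝ) (x : U) :
    extendZero U f x = f x := Subtype.val_injective.extend_apply f 0 x

theorem extendZero_eqOn {ι : Type} (U : TopologicalSpace.Opens (ι → ℝ)) (f : U → ℝ)
    (F : (ι → ℝ) → ℝ) (h : ∀ x : U, f x = F x) : Set.EqOn (extendZero U f) F U := fun x hx => by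
  have := extendZero_apply U f ⟨x, hx⟩
  rw [h] at this
  exact this

/-- The algebra of smooth functions on an open subset of `ℝ^ι`. -/
def SmoothFun {ι : Type} [Fintype ι] (U : TopologicalSpace.Opens (ι → ℝ)) :
    Subalgebra ℝ (U → ℝ) where
  carrier := {f | ContDiffOn ℝ ∞ (extendZero U f) U}
  mul_mem' {f g} hf hg := (ContDiffOn.mul hf hg).congr
    (extendZero_eqOn U _ _ fun x => by simp [extendZero_apply])
  add_mem' {f g} hf hg := (ContDiffOn.add hf hg).congr
    (extendZero_eqOn U _ _ fun x => by simp [extendZero_apply])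
  algebraMap_mem' r := (contDiffOn_const (c := r)).congr
    (extendZero_eqOn U _ _ fun x => by simp)

theorem extendZero_add {ι : Type} (U : TopologicalSpace.Opens (ι → ℝ)) (f g : U → ℝ) :
    extendZero U (f + g) = extendZero U f + extendZero U g := by
  simp only [extendZero]
  rw [← Function.extend_add, add_zero]

theorem extendZero_smul {ι : Type} (U : TopologicalSpace.Opens (ι → ℝ)) (c : ℝ) (f : U → ℝ) :
    extendZero U (c • f) = c • extendZero U f := by
  simp only [extendZero]
  rw [← Function.extend_smul, smul_zero]

theorem smoothFun_differentiableAt {ι : Type} [Fintype ι] {U : TopologicalSpace.Opens (ι → ℝ)}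
    (f : SmoothFun U) (x : U) : DifferentiableAt ℝ (extendZero U f) x :=
  (ContDiffOn.contDiffAt f.2 (U.isOpen.mem_nhds x.2)).differentiableAt (by simp)

/-- The partial derivative of a smooth function in the direction of the coordinate `i`. -/
def SmoothFun.partialDeriv {ι : Type} [Fintype ι] [DecidableEq ι]
    (U : TopologicalSpace.Opens (ι → ℝ)) (i : ι) : SmoothFun U →ₗ[ℝ] SmoothFun U where
  toFun f := ⟨fun x => fderiv ℝ (extendZero U f) x (Pi.single i 1),
    ((ContDiffOn.fderiv_of_isOpen f.2 U.isOpen (m := ∞) (by simp)).clm_apply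
      contDiffOn_const).congr (extendZero_eqOn U _ _ fun _ => rfl)⟩
  map_add' f g := by
    ext x
    change fderiv ℝ (extendZero U (f + g : U → ℝ)) x _ = _
    rw [extendZero_add,
      fderiv_add (smoothFun_differentiableAt f x) (smoothFun_differentiableAt g x)]
    rfl
  map_smul' c f := by
    ext x
    change fderiv ℝ (extendZero U (c • f : U → ℝ)) x _ = _
    rw [extendZero_smul, fderiv_const_smul (smoothFun_differentiableAt f x)]
    rfl

namespace DarbouxChart

variable {n : ℕ} (V : DarbouxChart n)

/-- The coordinates of degree zero. -/
abbrev BaseIdx : Type := {a : Fin V.r // V.deg a = 0}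

/-- The coordinates of positive even degree. -/
abbrev EvenIdx : Type := {a : Fin V.r // V.deg a ≠ 0 ∧ Even (V.deg a)}

/-- The coordinates of odd degree. -/
abbrev OddIdx : Type := {a : Fin V.r // Odd (V.deg a)}

/-- The graded commutative algebra of functions: smooth in the coordinates of degree zero, polynomial in
those of positive even degree, and exterior in those of odd degree. -/
def Fun : Type :=
  SmoothFun V.dom ⊗[ℝ] (MvPolynomial V.EvenIdx ℝ ⊗[ℝ] ExteriorAlgebra ℝ (V.OddIdx → ℝ))

instance : Ring V.Fun := inferInstanceAs (Ring (SmoothFun V.dom ⊗[ℝ]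
  (MvPolynomial V.EvenIdx ℝ ⊗[ℝ] ExteriorAlgebra ℝ (V.OddIdx → ℝ))))

instance : Algebra ℝ V.Fun := inferInstanceAs (Algebra ℝ (SmoothFun V.dom ⊗[ℝ]
  (MvPolynomial V.EvenIdx ℝ ⊗[ℝ] ExteriorAlgebra ℝ (V.OddIdx → ℝ))))

/-- The product of a function on the base, a polynomial in the coordinates of positive even degree and an
element of the exterior algebra on the coordinates of odd degree. -/
def monom (f : SmoothFun V.dom) (p : MvPolynomial V.EvenIdx ℝ)
    (q : ExteriorAlgebra ℝ (V.OddIdx → ℝ)) : V.Fun :=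
  f ⊗ₜ[ℝ] (p ⊗ₜ[ℝ] q)

/-- The linear map on functions given by linear maps on the three tensor factors. -/
def mapFun (A : SmoothFun V.dom →ₗ[ℝ] SmoothFun V.dom)
    (B : MvPolynomial V.EvenIdx ℝ →ₗ[ℝ] MvPolynomial V.EvenIdx ℝ)
    (C : ExteriorAlgebra ℝ (V.OddIdx → ℝ) →ₗ[ℝ] ExteriorAlgebra ℝ (V.OddIdx → ℝ)) :
    Module.End ℝ V.Fun :=
  (TensorProduct.map A (TensorProduct.map B C) :
    SmoothFun V.dom ⊗[ℝ] (MvPolynomial V.EvenIdx ℝ ⊗[ℝ] ExteriorAlgebra ℝ (V.OddIdx → ℝ)) →ₗ[ℝ]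
      SmoothFun V.dom ⊗[ℝ] (MvPolynomial V.EvenIdx ℝ ⊗[ℝ] ExteriorAlgebra ℝ (V.OddIdx → ℝ)))

theorem mapFun_monom (A : SmoothFun V.dom →ₗ[ℝ] SmoothFun V.dom)
    (B : MvPolynomial V.EvenIdx ℝ →ₗ[ℝ] MvPolynomial V.EvenIdx ℝ)
    (C : ExteriorAlgebra ℝ (V.OddIdx → ℝ) →ₗ[ℝ] ExteriorAlgebra ℝ (V.OddIdx → ℝ))
    (f : SmoothFun V.dom) (p : MvPolynomial V.EvenIdx ℝ) (q : ExteriorAlgebra ℝ (V.OddIdx → ℝ)) :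
    V.mapFun A B C (V.monom f p q) = V.monom (A f) (B p) (C q) := rfl

/-- The homogeneous functions of degree `k`, spanned by the products of a function on the base with
monomials of degree `k` in the other coordinates. -/
def homogeneous (k : ℤ) : Submodule ℝ V.Fun :=
  Submodule.span ℝ {x | ∃ (f : SmoothFun V.dom) (m : V.EvenIdx →₀ ℕ) (l : List V.OddIdx),
    ((m.sum fun i e => e * V.deg i : ℕ) : ℤ) + ((l.map fun i => V.deg i).sum : ℕ) = k ∧
    x = V.monom f (MvPolynomial.monomial m 1)
      (l.map fun i => ExteriorAlgebra.ι ℝ (Pi.single i (1 : ℝ) : V.OddIdx → ℝ)).prod}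

/-- The parity operator `f ↦ (-1)^{|f|} f`. -/
def parity : Module.End ℝ V.Fun :=
  V.mapFun LinearMap.id LinearMap.id
    (CliffordAlgebra.involute (Q := (0 : QuadraticForm ℝ (V.OddIdx → ℝ)))).toLinearMap

/-- The (left) partial derivative with respect to the coordinate `z_a`. -/
def pd (a : Fin V.r) : Module.End ℝ V.Fun :=
  if h0 : V.deg a = 0 then
    V.mapFun (SmoothFun.partialDeriv V.dom ⟨a, h0⟩) LinearMap.id LinearMap.id
  else if he : Even (V.deg a) then
    V.mapFun LinearMap.id (MvPolynomial.pderiv (⟨a, h0, he⟩ : V.EvenIdx)).toLinearMap LinearMap.id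
  else
    V.mapFun LinearMap.id LinearMap.id
      (CliffordAlgebra.contractLeft (Q := (0 : QuadraticForm ℝ (V.OddIdx → ℝ)))
        (LinearMap.proj (⟨a, Nat.not_even_iff_odd.mp he⟩ : V.OddIdx)))

/-- The Poisson bracket
`{f, g} = ∑_{a, b} (-1)^{|z_b| |f|} (∂f/∂z_a) ω^{ab} (∂g/∂z_b)`. -/
def bracket : V.Fun →ₗ[ℝ] V.Fun →ₗ[ℝ] V.Fun :=
  ∑ a, ∑ b, V.pairing a b •
    (LinearMap.mul ℝ V.Fun).compl₁₂ (V.pd a * V.parity ^ V.deg b) (V.pd b)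

/-! ### The representation of the graph operad on functions -/

/-- The operator on the `N`-th tensor power of the functions that differentiates the `i`-th factor with respect to
`z_a`, with the Koszul sign rule. -/
def pdAt {N : ℕ} (i : Fin N) (a : Fin V.r) : Module.End ℝ (⨂[ℝ] _ : Fin N, V.Fun) :=
  PiTensorProduct.map fun j =>
    if j < i then V.parity ^ V.deg a else if j = i then V.pd a else 1

/-- The operator `Δ_{ij}` attached to an edge from the vertex `i` to the vertex `j`. -/
def edgeOp {N : ℕ} (i j : Fin N) : Module.End ℝ (⨂[ℝ] _ : Fin N, V.Fun) :=
  ∑ a, ∑ b, V.pairing a b • (V.pdAt i a * V.pdAt j b)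

/-- The ordered product of the operators of the edges of a graph. -/
def graphOp {N k : ℕ} (g : LGraph N k) : Module.End ℝ (⨂[ℝ] _ : Fin N, V.Fun) :=
  (List.ofFn fun e => V.edgeOp (g e).1 (g e).2).prod

/-- The multidifferential operator `f₁ ⊗ ⋯ ⊗ f_N ↦ μ_N (∏_{(i,j)} Δ_{ij} (f₁ ⊗ ⋯ ⊗ f_N))` of a graph. -/
def repGraph {N k : ℕ} (g : LGraph N k) : MultilinearMap ℝ (fun _ : Fin N => V.Fun) V.Fun :=
  (PiTensorProduct.lift (MultilinearMap.mkPiAlgebraFin ℝ N V.Fun) ∘ₗ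
    V.graphOp g).compMultilinearMap (PiTensorProduct.tprod ℝ)

theorem partialDeriv_comm {ι : Type} [Fintype ι] [DecidableEq ι]
    (U : TopologicalSpace.Opens (ι → ℝ)) (i j : ι) :
    SmoothFun.partialDeriv U i ∘ₗ SmoothFun.partialDeriv U j =
      SmoothFun.partialDeriv U j ∘ₗ SmoothFun.partialDeriv U i := by
  have key : ∀ (i j : ι) (f : SmoothFun U) (x : U),
      (SmoothFun.partialDeriv U i (SmoothFun.partialDeriv U j f)).1 x =
        fderiv ℝ (fderiv ℝ (extendZero U f)) x (Pi.single i 1) (Pi.single j 1) := by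
    intro i j f x
    have hnhds := U.isOpen.mem_nhds x.2
    have hd : DifferentiableAt ℝ (fderiv ℝ (extendZero U f)) x :=
      ((ContDiffOn.fderiv_of_isOpen f.2 U.isOpen (m := ∞) (by simp)).contDiffAt
        hnhds).differentiableAt (by simp)
    change fderiv ℝ (extendZero U (SmoothFun.partialDeriv U j f : U → ℝ)) x (Pi.single i 1) = _
    have heq : extendZero U (SmoothFun.partialDeriv U j f : U → ℝ) =ᶠ[nhds (x : ι → ℝ)]
        fun y => fderiv ℝ (extendZero U f) y (Pi.single j 1) :=
      Filter.eventuallyEq_of_mem hnhds (extendZero_eqOn U _ _ fun _ => rfl)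
    rw [heq.fderiv_eq, fderiv_clm_apply hd (differentiableAt_const _)]
    simp
  ext f x
  have hs : IsSymmSndFDerivAt ℝ (extendZero U f) x :=
    (ContDiffOn.contDiffAt f.2 (U.isOpen.mem_nhds x.2)).isSymmSndFDerivAt
      (by simp only [minSmoothness_of_isRCLikeNormedField]; exact WithTop.coe_le_coe.2 le_top)
  change (SmoothFun.partialDeriv U i (SmoothFun.partialDeriv U j f)).1 x =
    (SmoothFun.partialDeriv U j (SmoothFun.partialDeriv U i f)).1 x
  rw [key, key]
  exact hs _ _

theorem pderiv_comm {σ : Type} (i j : σ) :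
    (MvPolynomial.pderiv (R := ℝ) i).toLinearMap ∘ₗ (MvPolynomial.pderiv (R := ℝ) j).toLinearMap =
      (MvPolynomial.pderiv (R := ℝ) j).toLinearMap ∘ₗ
        (MvPolynomial.pderiv (R := ℝ) i).toLinearMap := by
  classical
  have : ⁅MvPolynomial.pderiv (R := ℝ) i, MvPolynomial.pderiv (R := ℝ) j⁆ = 0 := by
    apply MvPolynomial.derivation_ext
    intro k
    rw [Derivation.commutator_apply]
    simp only [MvPolynomial.pderiv_X, Derivation.zero_apply, Pi.single_apply]
    split_ifs <;> simp
  refine LinearMap.ext fun p => ?_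
  have h := DFunLike.congr_fun this p
  rw [Derivation.commutator_apply, Derivation.zero_apply, sub_eq_zero] at h
  exact h

theorem involute_contractLeft {M : Type} [AddCommGroup M] [Module ℝ M] (φ : Module.Dual ℝ M) :
    (CliffordAlgebra.involute (Q := (0 : QuadraticForm ℝ M))).toLinearMap ∘ₗ
        CliffordAlgebra.contractLeft φ =
      -(CliffordAlgebra.contractLeft φ ∘ₗ
        (CliffordAlgebra.involute (Q := (0 : QuadraticForm ℝ M))).toLinearMap) := by
  refine LinearMap.ext fun x => ?_
  simp only [LinearMap.comp_apply, LinearMap.neg_apply, AlgHom.toLinearMap_apply]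
  induction x using CliffordAlgebra.left_induction with
  | algebraMap r => simp [CliffordAlgebra.contractLeft_algebraMap]
  | add x y hx hy => simp [hx, hy, add_comm]
  | ι_mul x a hx =>
    rw [CliffordAlgebra.contractLeft_ι_mul]
    simp only [map_sub, map_smul, map_mul, CliffordAlgebra.involute_ι, hx, neg_mul, map_neg,
      CliffordAlgebra.contractLeft_ι_mul, mul_neg]
    abel

theorem fun_ext {A B : Module.End ℝ V.Fun}
    (h : ∀ f p q, A (V.monom f p q) = B (V.monom f p q)) : A = B := by
  refine LinearMap.ext fun x => ?_
  refine TensorProduct.induction_on (motive := fun x : V.Fun => A x = B x) x ?_ ?_ ?_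
  · exact (map_zero A).trans (map_zero B).symm
  · intro f y
    refine TensorProduct.induction_on (motive := fun y => A (f ⊗ₜ[ℝ] y : SmoothFun V.dom ⊗[ℝ] _) =
      B (f ⊗ₜ[ℝ] y : SmoothFun V.dom ⊗[ℝ] _)) y ?_ (fun p q => h f p q) ?_
    · rw [TensorProduct.tmul_zero]
      exact (map_zero A).trans (map_zero B).symm
    · intro y z hy hz
      rw [TensorProduct.tmul_add]
      exact ((map_add A _ _).trans (congrArg₂ _ hy hz)).trans (map_add B _ _).symm
  · intro y z hy hz
    exact ((map_add A _ _).trans (congrArg₂ _ hy hz)).trans (map_add B _ _).symm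

theorem mapFun_mul (A A' : SmoothFun V.dom →ₗ[ℝ] SmoothFun V.dom)
    (B B' : MvPolynomial V.EvenIdx ℝ →ₗ[ℝ] MvPolynomial V.EvenIdx ℝ)
    (C C' : ExteriorAlgebra ℝ (V.OddIdx → ℝ) →ₗ[ℝ] ExteriorAlgebra ℝ (V.OddIdx → ℝ)) :
    V.mapFun A B C * V.mapFun A' B' C' = V.mapFun (A ∘ₗ A') (B ∘ₗ B') (C ∘ₗ C') :=
  V.fun_ext fun _ _ _ => rfl

theorem mapFun_neg (A : SmoothFun V.dom →ₗ[ℝ] SmoothFun V.dom)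
    (B : MvPolynomial V.EvenIdx ℝ →ₗ[ℝ] MvPolynomial V.EvenIdx ℝ)
    (C : ExteriorAlgebra ℝ (V.OddIdx → ℝ) →ₗ[ℝ] ExteriorAlgebra ℝ (V.OddIdx → ℝ)) :
    V.mapFun A B (-C) = (-1 : ℝ) • V.mapFun A B C :=
  V.fun_ext fun f p q => by
    have h : ∀ (f : SmoothFun V.dom) (p : MvPolynomial V.EvenIdx ℝ)
        (q : ExteriorAlgebra ℝ (V.OddIdx → ℝ)), V.monom f p (-q) = (-1 : ℝ) • V.monom f p q := by
      intro f p q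
      rw [← neg_one_smul ℝ q]
      unfold monom
      rw [TensorProduct.tmul_smul, TensorProduct.tmul_smul]
      rfl
    exact h _ _ _

theorem parity_mul_pd (a : Fin V.r) :
    V.parity * V.pd a = (-1 : ℝ) ^ V.deg a • (V.pd a * V.parity) := by
  unfold pd parity
  split_ifs with h0 he
  · rw [h0, mapFun_mul, mapFun_mul, pow_zero, one_smul]
    rfl
  · rw [he.neg_one_pow, mapFun_mul, mapFun_mul, one_smul]
    rfl
  · rw [(Nat.not_even_iff_odd.mp he).neg_one_pow, mapFun_mul, mapFun_mul,
      involute_contractLeft, mapFun_neg]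

theorem contractLeft_contractLeft_neg {M : Type} [AddCommGroup M] [Module ℝ M]
    (φ ψ : Module.Dual ℝ M) :
    CliffordAlgebra.contractLeft (Q := (0 : QuadraticForm ℝ M)) φ ∘ₗ
        CliffordAlgebra.contractLeft ψ =
      -(CliffordAlgebra.contractLeft ψ ∘ₗ CliffordAlgebra.contractLeft φ) :=
  LinearMap.ext fun x => CliffordAlgebra.contractLeft_comm φ ψ x

theorem pd_comm (a b : Fin V.r) :
    V.pd a * V.pd b = (-1 : ℝ) ^ (V.deg a * V.deg b) • (V.pd b * V.pd a) := by
  have hsign : ((-1 : ℝ) ^ (V.deg a * V.deg b) = if Even (V.deg a) ∨ Even (V.deg b) then 1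
      else -1) := by
    rw [neg_one_pow_eq_ite]
    simp [Nat.even_mul]
  rw [hsign]
  unfold pd
  by_cases ha0 : V.deg a = 0 <;> by_cases hb0 : V.deg b = 0 <;>
  by_cases hae : Even (V.deg a) <;> by_cases hbe : Even (V.deg b) <;>
  simp only [ha0, hb0, hae, hbe, dif_pos, dif_neg, not_false_eq_true, mapFun_mul, true_or,
    or_true, if_true, or_self, if_false, one_smul, LinearMap.comp_id, LinearMap.id_comp, Even.zero]
  all_goals first
    | rw [partialDeriv_comm]
    | rw [pderiv_comm]
    | (rw [contractLeft_contractLeft_neg, mapFun_neg])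


theorem parity_pow_mul_pd (k : ℕ) (a : Fin V.r) :
    V.parity ^ k * V.pd a = (-1 : ℝ) ^ (V.deg a * k) • (V.pd a * V.parity ^ k) := by
  induction k with
  | zero => simp
  | succ k ih =>
    rw [pow_succ, mul_assoc, parity_mul_pd, mul_smul_comm, ← mul_assoc, ih, smul_mul_assoc,
      smul_smul, mul_assoc, ← pow_add]
    congr 2
    ring

theorem pairing_eq_zero {a b : Fin V.r} (h : V.deg a + V.deg b ≠ n) : V.pairing a b = 0 := by
  by_contra h'
  exact h (V.pairing_degree a b h')

theorem pdAt_comm_of_lt {N : ℕ} {i j : Fin N} (hij : i < j) (a b : Fin V.r) :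
    V.pdAt i a * V.pdAt j b = (-1 : ℝ) ^ (V.deg a * V.deg b) • (V.pdAt j b * V.pdAt i a) := by
  unfold pdAt
  rw [← PiTensorProduct.map_mul, ← PiTensorProduct.map_mul]
  set F : Fin N → Module.End ℝ V.Fun := fun k =>
    (if k < j then V.parity ^ V.deg b else if k = j then V.pd b else 1) *
      (if k < i then V.parity ^ V.deg a else if k = i then V.pd a else 1) with hF
  have key : (fun k => (if k < i then V.parity ^ V.deg a else if k = i then V.pd a else 1) *
      (if k < j then V.parity ^ V.deg b else if k = j then V.pd b else 1)) =
      Function.update F i ((-1 : ℝ) ^ (V.deg a * V.deg b) • F i) := by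
    funext k
    rcases lt_trichotomy k i with h | h | h
    · rw [Function.update_of_ne h.ne]
      simp only [hF, h, h.trans hij, if_true]
      exact ((Commute.refl V.parity).pow_pow _ _).eq
    · subst h
      rw [Function.update_self]
      simp only [hF, lt_irrefl, hij, if_true, if_false]
      rw [parity_pow_mul_pd, smul_smul, ← pow_add, (Even.add_self _).neg_one_pow, one_smul]
    · rw [Function.update_of_ne h.ne']
      simp only [hF, h.not_gt, h.ne', if_false, one_mul, mul_one]
  rw [key]
  have := PiTensorProduct.map_update_smul (R := ℝ) F i ((-1 : ℝ) ^ (V.deg a * V.deg b)) (F i)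
  rw [Function.update_eq_self] at this
  exact this

theorem pdAt_comm_self {N : ℕ} (i : Fin N) (a b : Fin V.r) :
    V.pdAt i a * V.pdAt i b = (-1 : ℝ) ^ (V.deg a * V.deg b) • (V.pdAt i b * V.pdAt i a) := by
  unfold pdAt
  rw [← PiTensorProduct.map_mul, ← PiTensorProduct.map_mul]
  set F : Fin N → Module.End ℝ V.Fun := fun k =>
    (if k < i then V.parity ^ V.deg b else if k = i then V.pd b else 1) *
      (if k < i then V.parity ^ V.deg a else if k = i then V.pd a else 1) with hF
  have key : (fun k => (if k < i then V.parity ^ V.deg a else if k = i then V.pd a else 1) *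
      (if k < i then V.parity ^ V.deg b else if k = i then V.pd b else 1)) =
      Function.update F i ((-1 : ℝ) ^ (V.deg a * V.deg b) • F i) := by
    funext k
    rcases lt_trichotomy k i with h | h | h
    · rw [Function.update_of_ne h.ne]
      simp only [hF, h, if_true]
      exact ((Commute.refl V.parity).pow_pow _ _).eq
    · subst h
      rw [Function.update_self]
      simp only [hF, lt_irrefl, if_true, if_false]
      exact V.pd_comm a b
    · rw [Function.update_of_ne h.ne']
      simp only [hF, h.not_gt, h.ne', if_false, one_mul]
  rw [key]
  have := PiTensorProduct.map_update_smul (R := ℝ) F i ((-1 : ℝ) ^ (V.deg a * V.deg b)) (F i)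
  rw [Function.update_eq_self] at this
  exact this

theorem pdAt_comm {N : ℕ} (i j : Fin N) (a b : Fin V.r) :
    V.pdAt i a * V.pdAt j b = (-1 : ℝ) ^ (V.deg a * V.deg b) • (V.pdAt j b * V.pdAt i a) := by
  rcases lt_trichotomy i j with h | h | h
  · exact V.pdAt_comm_of_lt h a b
  · subst h
    exact V.pdAt_comm_self i a b
  · rw [V.pdAt_comm_of_lt h b a, smul_smul, mul_comm (V.deg b), ← pow_add,
      (Even.add_self _).neg_one_pow, one_smul]

section EdgeSigns

variable {R : Type*} [Ring R] [Algebra ℝ R]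

theorem swap_relation {r n : ℕ} (deg : Fin r → ℕ) (w : Fin r → Fin r → ℝ)
    (hw : ∀ a b, w a b = (-1) ^ (n + 1 + deg a * deg b) * w b a) (X Y : Fin r → R)
    (h : ∀ a b, Y a * X b = (-1 : ℝ) ^ (deg a * deg b) • (X b * Y a)) :
    ∑ a, ∑ b, w a b • (Y a * X b) = (-1 : ℝ) ^ (n + 1) • ∑ a, ∑ b, w a b • (X a * Y b) := by
  rw [Finset.sum_comm, Finset.smul_sum]
  refine Finset.sum_congr rfl fun b _ => ?_
  rw [Finset.smul_sum]
  refine Finset.sum_congr rfl fun a _ => ?_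
  rw [h, hw, smul_smul, smul_smul, mul_right_comm, ← pow_add, add_assoc, pow_add,
    (Even.add_self (deg a * deg b)).neg_one_pow, mul_one]

theorem comm_relation {r n : ℕ} (deg : Fin r → ℕ) (w : Fin r → Fin r → ℝ)
    (hw : ∀ a b, w a b ≠ 0 → deg a + deg b = n) (X Y Z W : Fin r → R)
    (hXZ : ∀ a b, X a * Z b = (-1 : ℝ) ^ (deg a * deg b) • (Z b * X a))
    (hXW : ∀ a b, X a * W b = (-1 : ℝ) ^ (deg a * deg b) • (W b * X a))
    (hYZ : ∀ a b, Y a * Z b = (-1 : ℝ) ^ (deg a * deg b) • (Z b * Y a))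
    (hYW : ∀ a b, Y a * W b = (-1 : ℝ) ^ (deg a * deg b) • (W b * Y a)) :
    (∑ a, ∑ b, w a b • (X a * Y b)) * (∑ a, ∑ b, w a b • (Z a * W b)) =
      (-1 : ℝ) ^ n • ((∑ a, ∑ b, w a b • (Z a * W b)) * (∑ a, ∑ b, w a b • (X a * Y b))) := by
  have key : ∀ a b c e, (w a b • (X a * Y b)) * (w c e • (Z c * W e)) =
      (-1 : ℝ) ^ n • ((w c e • (Z c * W e)) * (w a b • (X a * Y b))) := by
    intro a b c e
    by_cases h1 : w a b = 0
    · simp [h1]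
    by_cases h2 : w c e = 0
    · simp [h2]
    have e1 : X a * Y b * (Z c * W e) =
        (-1 : ℝ) ^ ((deg a + deg b) * (deg c + deg e)) • (Z c * W e * (X a * Y b)) := by
      calc X a * Y b * (Z c * W e) = X a * (Y b * Z c) * W e := by simp only [mul_assoc]
        _ = (-1 : ℝ) ^ (deg b * deg c) • ((X a * Z c) * (Y b * W e)) := by
          rw [hYZ]; simp only [mul_smul_comm, smul_mul_assoc, mul_assoc]
        _ = (-1 : ℝ) ^ (deg b * deg c + deg a * deg c + deg b * deg e) •
            (Z c * (X a * W e) * Y b) := by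
          rw [hXZ, hYW]
          simp only [mul_smul_comm, smul_mul_assoc, mul_assoc, smul_smul, pow_add]
          congr 1
          ring
        _ = _ := by
          rw [hXW]
          simp only [mul_smul_comm, smul_mul_assoc, mul_assoc, smul_smul, ← pow_add]
          congr 2
          ring
    rw [hw a b h1, hw c e h2] at e1
    have e2 : (-1 : ℝ) ^ (n * n) = (-1) ^ n := by
      rcases Nat.even_or_odd n with h | h
      · rw [(h.mul_left n).neg_one_pow, h.neg_one_pow]
      · rw [(h.mul h).neg_one_pow, h.neg_one_pow]
    rw [e2] at e1
    rw [smul_mul_smul_comm, e1, smul_mul_smul_comm, smul_comm, mul_comm (w a b)]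
  simp only [← Fintype.sum_prod_type']
  rw [Finset.sum_mul_sum, Finset.sum_mul_sum, Finset.sum_comm, Finset.smul_sum]
  refine Finset.sum_congr rfl fun p _ => ?_
  rw [Finset.smul_sum]
  exact Finset.sum_congr rfl fun q _ => key _ _ _ _

theorem prod_ofFn_swap (ε : ℝ) : ∀ {k : ℕ} (X : Fin (k + 1) → R)
    (_ : ∀ e f, X e * X f = ε • (X f * X e)) (i : Fin k),
    (List.ofFn fun e => X (Equiv.swap i.castSucc i.succ e)).prod = ε • (List.ofFn X).prod
  | 0, _, _, i => i.elim0
  | k + 1, X, h, i => by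
    refine Fin.cases ?_ (fun i => ?_) i
    · rw [List.ofFn_succ, List.ofFn_succ, List.ofFn_succ (f := X), List.ofFn_succ]
      simp only [List.prod_cons, ← mul_assoc]
      have h1 : Equiv.swap (Fin.castSucc (0 : Fin (k + 1))) (Fin.succ 0) 0 = Fin.succ 0 :=
        Equiv.swap_apply_left _ _
      have h2 : Equiv.swap (Fin.castSucc (0 : Fin (k + 1))) (Fin.succ 0) (Fin.succ 0) = 0 :=
        Equiv.swap_apply_right _ _
      have h3 : ∀ j : Fin k, Equiv.swap (Fin.castSucc (0 : Fin (k + 1))) (Fin.succ 0)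
          (Fin.succ (Fin.succ j)) = Fin.succ (Fin.succ j) := fun j =>
        Equiv.swap_apply_of_ne_of_ne (Fin.succ_ne_zero _)
          (fun hh => Fin.succ_ne_zero _ (Fin.succ_injective _ hh))
      simp only [h1, h2, h3]
      rw [h, smul_mul_assoc]
    · rw [List.ofFn_succ, List.ofFn_succ (f := X)]
      simp only [List.prod_cons]
      have h1 : Equiv.swap (Fin.castSucc (Fin.succ i)) (Fin.succ (Fin.succ i)) 0 = 0 :=
        Equiv.swap_apply_of_ne_of_ne (Fin.castSucc_ne_zero_iff.mpr (Fin.succ_ne_zero _)).symm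
          (Fin.succ_ne_zero _).symm
      have h2 : ∀ j : Fin (k + 1), Equiv.swap (Fin.castSucc (Fin.succ i))
          (Fin.succ (Fin.succ i)) (Fin.succ j) =
            Fin.succ (Equiv.swap (Fin.castSucc i) (Fin.succ i) j) := fun j => by
        rw [← Fin.succ_castSucc]
        exact (Fin.succ_injective _).swap_apply _ _ _
      simp only [h1, h2]
      rw [prod_ofFn_swap ε (fun j => X (Fin.succ j)) (fun _ _ => h _ _) i, mul_smul_comm]

theorem prod_ofFn_perm (n : ℕ) {k : ℕ} (X : Fin k → R)
    (h : ∀ e f, X e * X f = (-1 : ℝ) ^ n • (X f * X e)) (σ : Equiv.Perm (Fin k)) :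
    (List.ofFn fun e => X (σ e)).prod =
      ((Equiv.Perm.sign σ : ℤ) : ℝ) ^ (n + 1 + 1) • (List.ofFn X).prod := by
  rcases k with _ | k
  · have : σ = 1 := Subsingleton.elim _ _
    subst this
    simp
  have hσ : σ ∈ Submonoid.closure
      (Set.range fun i : Fin k => Equiv.swap i.castSucc i.succ) := by
    rw [Equiv.Perm.mclosure_swap_castSucc_succ]
    trivial
  induction hσ using Submonoid.closure_induction generalizing X with
  | mem x hx =>
    obtain ⟨i, rfl⟩ := hx
    have hne : i.castSucc ≠ i.succ := (Fin.castSucc_lt_succ).ne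
    rw [prod_ofFn_swap _ X h i, Equiv.Perm.sign_swap hne]
    simp [pow_succ]
  | one => simp
  | mul x y _ _ hx hy =>
    have := hy (fun e => X (x e)) (fun _ _ => h _ _)
    simp only [Equiv.Perm.mul_apply]
    rw [this, hx X h, smul_smul, ← mul_pow, map_mul, mul_comm]
    push_cast
    rfl

end EdgeSigns

theorem edgeOp_swap {N : ℕ} (i j : Fin N) :
    V.edgeOp j i = (-1 : ℝ) ^ (n + 1) • V.edgeOp i j :=
  swap_relation V.deg V.pairing V.pairing_symm (V.pdAt i) (V.pdAt j) (V.pdAt_comm j i)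

theorem edgeOp_comm {N : ℕ} (i j k l : Fin N) :
    V.edgeOp i j * V.edgeOp k l = (-1 : ℝ) ^ n • (V.edgeOp k l * V.edgeOp i j) :=
  comm_relation V.deg V.pairing V.pairing_degree (V.pdAt i) (V.pdAt j) (V.pdAt k) (V.pdAt l)
    (V.pdAt_comm i k) (V.pdAt_comm i l) (V.pdAt_comm j k) (V.pdAt_comm j l)

theorem prod_ofFn_smul {R : Type*} [Ring R] [Algebra ℝ R] (c : ℝ) : ∀ {k : ℕ} (X Y : Fin k → R)
    (e : Fin k) (_ : Y e = c • X e) (_ : ∀ e', e' ≠ e → Y e' = X e'),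
    (List.ofFn Y).prod = c • (List.ofFn X).prod
  | 0, _, _, e, _, _ => e.elim0
  | k + 1, X, Y, e, h1, h2 => by
    rw [List.ofFn_succ, List.ofFn_succ (f := X), List.prod_cons, List.prod_cons]
    revert h1 h2
    refine Fin.cases (fun h1 h2 => ?_) (fun e h1 h2 => ?_) e
    · rw [h1, smul_mul_assoc]
      congr 4
      funext i
      exact h2 _ (Fin.succ_ne_zero i)
    · rw [h2 0 (Fin.succ_ne_zero e).symm, prod_ofFn_smul c (fun i => X i.succ)
        (fun i => Y i.succ) e h1 fun e' he => h2 _ fun h => he (Fin.succ_injective _ h),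
        mul_smul_comm]

theorem graphOp_flip {N k : ℕ} (g : LGraph N k) (e : Fin k) :
    V.graphOp (g.flip e) = (-1 : ℝ) ^ (n + 1) • V.graphOp g := by
  refine prod_ofFn_smul _ _ _ e ?_ fun e' he => ?_
  · simp only [LGraph.flip, Function.update_self, Prod.fst_swap, Prod.snd_swap]
    exact V.edgeOp_swap _ _
  · simp only [LGraph.flip, Function.update_of_ne he]

theorem graphOp_permEdges {N k : ℕ} (g : LGraph N k) (σ : Equiv.Perm (Fin k)) :
    V.graphOp (g.permEdges σ) =
      ((Equiv.Perm.sign σ : ℤ) : ℝ) ^ (n + 1 + 1) • V.graphOp g :=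
  prod_ofFn_perm n (fun e => V.edgeOp (g e).1 (g e).2) (fun _ _ => V.edgeOp_comm _ _ _ _) σ

theorem repGraph_congr {N k k' : ℕ} (g : LGraph N k) (g' : LGraph N k') (c : ℝ)
    (h : V.graphOp g' = c • V.graphOp g) : V.repGraph g' = c • V.repGraph g := by
  ext f
  exact (congrArg (PiTensorProduct.lift (MultilinearMap.mkPiAlgebraFin ℝ N V.Fun))
    (LinearMap.congr_fun h (PiTensorProduct.tprod ℝ f))).trans
    ((PiTensorProduct.lift (MultilinearMap.mkPiAlgebraFin ℝ N V.Fun)).map_smul c _)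

/-- The representation `Rep_N` of `Gra_d`, `d = n + 1`, on the functions of an NP-manifold of degree `n`. -/
def rep {N k : ℕ} :
    Gra (n + 1) N k →ₗ[ℝ] MultilinearMap ℝ (fun _ : Fin N => V.Fun) V.Fun :=
  Gra.lift V.repGraph (fun g e => V.repGraph_congr _ _ _ (V.graphOp_flip g e))
    (fun g σ => V.repGraph_congr _ _ _ (V.graphOp_permEdges g σ))

/-! ### Hamiltonian functions and Hamiltonian flows -/

/-- Evaluation of a family of graphs on a function:
`∑ Rep_N(c_N)(H ⊗ ⋯ ⊗ H)` for a family with finitely many nonzero members. -/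
def evalAt (c : GraFamily (n + 1)) (H : V.Fun) : V.Fun :=
  ∑ᶠ p : ℕ × ℕ, V.rep (c p.1 p.2) fun _ => H

/-- The Hamiltonian functions: the functions `H` of degree `n + 1` with `{H, H} = 0`. -/
def Ham : Type := {H : V.Fun // H ∈ V.homogeneous (n + 1) ∧ V.bracket H H = 0}

/-- The cocycles of degree `k` of the differential `Q = {H, ·}`. -/
def qCocycles (H : V.Ham) (k : ℤ) : Submodule ℝ V.Fun :=
  V.homogeneous k ⊓ LinearMap.ker (V.bracket H.1)

/-- The coboundaries of degree `k` of the differential `Q = {H, ·}`. -/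
def qCoboundaries (H : V.Ham) (k : ℤ) : Submodule ℝ V.Fun :=
  (V.homogeneous (k - 1)).map (V.bracket H.1)

/-- The cohomology `H^k(C^∞(V) | Q)` of the functions with differential `Q = {H, ·}`. -/
abbrev QCohomology (H : V.Ham) (k : ℤ) : Type :=
  V.qCocycles H k ⧸ (V.qCoboundaries H k).comap (V.qCocycles H k).subtype

/-- The function `f` is a cocycle of degree `k` and represents the class `c`. -/
def IsClassOf {H : V.Ham} {k : ℤ} (f : V.Fun) (c : V.QCohomology H k) : Prop :=
  ∃ hf : f ∈ V.qCocycles H k, c = Submodule.Quotient.mk ⟨f, hf⟩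

variable {V} in
theorem IsClassOf.add {H : V.Ham} {k : ℤ} {f f' : V.Fun} {c c' : V.QCohomology H k}
    (h : V.IsClassOf f c) (h' : V.IsClassOf f' c') : V.IsClassOf (f + f') (c + c') := by
  obtain ⟨hf, rfl⟩ := h
  obtain ⟨hf', rfl⟩ := h'
  exact ⟨add_mem hf hf', rfl⟩

variable {V} in
theorem IsClassOf.smul {H : V.Ham} {k : ℤ} {f : V.Fun} {c : V.QCohomology H k} (r : ℝ)
    (h : V.IsClassOf f c) : V.IsClassOf (r • f) (r • c) := by
  obtain ⟨hf, rfl⟩ := h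
  exact ⟨Submodule.smul_mem _ r hf, rfl⟩

variable {V} in
theorem isClassOf_zero {H : V.Ham} {k : ℤ} : V.IsClassOf (0 : V.Fun) (0 : V.QCohomology H k) :=
  ⟨zero_mem _, rfl⟩

theorem evalAt_support (c : GraFamily (n + 1)) (hc : c ∈ finiteFamilies (n + 1)) (H : V.Fun) :
    (Function.support fun p : ℕ × ℕ => V.rep (c p.1 p.2) fun _ => H).Finite := by
  refine Set.Finite.subset hc fun p hp h => hp ?_
  change V.rep (c p.1 p.2) (fun _ => H) = 0
  rw [h, map_zero]
  rfl

theorem evalAt_add (c c' : GraFamily (n + 1)) (hc : c ∈ finiteFamilies (n + 1))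
    (hc' : c' ∈ finiteFamilies (n + 1)) (H : V.Fun) :
    V.evalAt (c + c') H = V.evalAt c H + V.evalAt c' H := by
  unfold evalAt
  rw [← finsum_add_distrib (V.evalAt_support c hc H) (V.evalAt_support c' hc' H)]
  refine finsum_congr fun p => ?_
  change V.rep (c p.1 p.2 + c' p.1 p.2) _ = _
  rw [map_add]
  rfl

theorem evalAt_zero (H : V.Fun) : V.evalAt 0 H = 0 := by
  refine finsum_eq_zero_of_forall_eq_zero fun p => ?_
  change V.rep 0 _ = _
  rw [map_zero]
  rfl

theorem evalAt_smul (r : ℝ) (c : GraFamily (n + 1)) (hc : c ∈ finiteFamilies (n + 1))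
    (H : V.Fun) : V.evalAt (r • c) H = r • V.evalAt c H := by
  unfold evalAt
  rw [smul_finsum' r (V.evalAt_support c hc H)]
  refine finsum_congr fun p => ?_
  change V.rep (r • c p.1 p.2) _ = _
  rw [map_smul]
  rfl

/-- The universal Hamiltonian flows: the maps assigning to every Hamiltonian function `H` a class in
`H^{n+1}(C^∞(V) | {H, ·})` that is represented by a universal formula in `H`, that is, by the
evaluation at `H` of a fixed finite linear combination of graphs which yields cocycles on all
NP-manifolds of degree `n`. -/
def HFlow : Submodule ℝ (∀ H : V.Ham, V.QCohomology H (n + 1)) where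
  carrier := {F | ∃ c ∈ finiteFamilies (n + 1),
    (∀ (W : DarbouxChart n) (H : W.Ham), W.evalAt c H.1 ∈ W.qCocycles H (n + 1)) ∧
      ∀ H : V.Ham, V.IsClassOf (V.evalAt c H.1) (F H)}
  add_mem' := by
    rintro F F' ⟨c, hc, hW, h⟩ ⟨c', hc', hW', h'⟩
    refine ⟨c + c', add_mem hc hc', fun W H => ?_, fun H => ?_⟩
    · rw [W.evalAt_add c c' hc hc']
      exact add_mem (hW W H) (hW' W H)
    · rw [V.evalAt_add c c' hc hc']
      exact (h H).add (h' H)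
  zero_mem' := ⟨0, zero_mem _, fun W H => by
    rw [W.evalAt_zero]
    exact zero_mem _, fun H => by
    rw [V.evalAt_zero]
    exact isClassOf_zero⟩
  smul_mem' := by
    rintro r F ⟨c, hc, hW, h⟩
    refine ⟨r • c, Submodule.smul_mem _ r hc, fun W H => ?_, fun H => ?_⟩
    · rw [W.evalAt_smul r c hc]
      exact Submodule.smul_mem _ r (hW W H)
    · rw [V.evalAt_smul r c hc]
      exact (h H).smul r

/-- The conformal Hamiltonian flows: the universal Hamiltonian flows of the form `H ↦ Ω(H) · H` for a
function `Ω(H)` on the base (the functions of degree zero) with `{H, Ω(H)} = 0`. -/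
def cHFlow : Submodule ℝ V.HFlow where
  carrier := {F | ∃ Ω : V.Ham → V.Fun, ∀ H : V.Ham,
    Ω H ∈ V.homogeneous 0 ∧ V.bracket H.1 (Ω H) = 0 ∧ V.IsClassOf (Ω H * H.1) (F.1 H)}
  add_mem' := by
    rintro F F' ⟨Ω, h⟩ ⟨Ω', h'⟩
    refine ⟨fun H => Ω H + Ω' H, fun H => ⟨add_mem (h H).1 (h' H).1, ?_, ?_⟩⟩
    · rw [map_add, (h H).2.1, (h' H).2.1, add_zero]
    · rw [add_mul]
      exact (h H).2.2.add (h' H).2.2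
  zero_mem' := ⟨fun _ => 0, fun H => ⟨zero_mem _, map_zero _, by
    rw [zero_mul]
    exact isClassOf_zero⟩⟩
  smul_mem' := by
    rintro r F ⟨Ω, h⟩
    refine ⟨fun H => r • Ω H, fun H => ⟨Submodule.smul_mem _ r (h H).1, ?_, ?_⟩⟩
    · rw [map_smul, (h H).2.1, smul_zero]
    · rw [smul_mul_assoc]
      exact (h H).2.2.smul r

/-- `Φ` sends the class of a cocycle `γ` of degree zero to the flow `H ↦ [∑ Rep_N(γ_N)(H ⊗ ⋯ ⊗ H)]`. -/
def IsHamiltonianFlowMap (Φ : finiteCohomology (n + 1) 0 →ₗ[ℝ] V.HFlow) : Prop :=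
  ∀ (γ : fgcCocycles (n + 1) 0) (hγ : (γ : GraFamily (n + 1)) ∈ finiteFamilies (n + 1))
    (H : V.Ham), V.IsClassOf (V.evalAt γ H.1) ((Φ (cocycleClass γ hγ)).1 H)

/-- `Φ` sends the class of a cocycle `γ` of degree `-d`, `d = n + 1`, to the flow `H ↦ [Ω(H) · H]` with
conformal factor `Ω(H) = ∑ Rep_N(γ_N)(H ⊗ ⋯ ⊗ H)`. -/
def IsConformalFlowMap (Φ : finiteCohomology (n + 1) (-((n : ℤ) + 1)) →ₗ[ℝ] V.cHFlow) : Prop :=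
  ∀ (γ : fgcCocycles (n + 1) (-((n : ℤ) + 1)))
    (hγ : (γ : GraFamily (n + 1)) ∈ finiteFamilies (n + 1)) (H : V.Ham),
    V.IsClassOf (V.evalAt γ H.1 * H.1) ((Φ (cocycleClass γ hγ)).1.1 H)

end DarbouxChart

end GraphFlow

end

noncomputable section

namespace GraphFlow

/-! ### Signs in the exterior algebra -/

section Exterior

variable {M : Type} [AddCommGroup M] [Module ℝ M]

local notation "inv'" => (CliffordAlgebra.involute (Q := (0 : QuadraticForm ℝ M)))

/-! Put copies of a Hamiltonian function H at all the vertices of a graph. Two properties of `rep`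
carry the first three claims. Inserting a graph in a vertex amounts to substituting its value for
that argument (`rep_comp₁`): by the graded Leibniz rule a derivative of a product is a sum over the
factors, and this is the sum over the reconnections of an edge end. Renumbering the vertices costs
`sgn ^ d` when all arguments equal H (`rep_permVertices`), because neighbouring factors of parity d
are exchanged with the Koszul sign `(-1) ^ d`. Hence all unshuffles in a pre-Lie product contribute
equally. In δγ, the commutator of the edge with γ, the terms that insert the edge into γ contain an
argument {H, H} = 0, and the remaining ones add up to a nonzero multiple of {H, γ(H, …, H)}
(`rep_diff`). So cocycles give Q-closed functions and coboundaries give Q-exact ones, component by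
component.

A component of degree j yields a function of degree j + d. For j = 0 this is a Q-cocycle of degree
d, whose class depends only on the class of γ. For j = -d it is a function Ω of degree 0 with {H, Ω}
= 0, so Ω · H is closed by the Leibniz rule; coboundaries give Ω = 0, since they come from functions
of degree -1 and there are none. The flow Ω · H is universal because it is given by γ with an
isolated vertex added (`addVertex`).

The counterexample has n = 2 and d = 3. The theta graph (two vertices, three parallel edges) is a
cocycle of degree -3 (`bracket_edge_theta`). Take six orthonormal odd coordinates over a point and H
= s ξ₀ξ₁ξ₂ + t ξ₃ξ₄ξ₅; then Ω = 6(s² + t²) (`rep_theta_cubic`), and the coefficient of ξ₀ξ₁ξ₂ in Ω ·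
H is 6(s² + t²)s. This coefficient vanishes on coboundaries (`tripleDeriv_bracket`), so it is an
invariant of the class. Suppose that a cocycle of degree 0 gives the same flow. Rescaling H isolates
its part with three vertices, hence three edges, and this part must produce the cubic 6(s² + t²)s by
itself. Expand it in the two summands of H. In a mixed term two vertices carry one summand and the
third vertex carries the other; no edge joins different summands and tadpoles vanish, so only the
graph with three parallel edges and an isolated vertex could contribute. The cocycle condition on
four vertices forces its coefficient to be zero (`weight_eq_zero_of_mem_cocycles`). The value is
therefore additive in the two summands (`rep_cubic_add`), whereas 6(s² + t²)s is not: at (1,1),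
(1,0) and (0,1) it equals 12, 6 and 0. -/

theorem ι_mul_eq_involute_mul (v : M) (y : ExteriorAlgebra ℝ M) :
    ExteriorAlgebra.ι ℝ v * y = inv' y * ExteriorAlgebra.ι ℝ v := by
  induction y using CliffordAlgebra.left_induction with
  | algebraMap r => rw [AlgHom.commutes]; exact (Algebra.commutes r _).symm
  | add x y hx hy => rw [mul_add, hx, hy, map_add, add_mul]
  | ι_mul y w hy =>
    have h : ExteriorAlgebra.ι ℝ v * ExteriorAlgebra.ι ℝ w =
        -(ExteriorAlgebra.ι ℝ w * ExteriorAlgebra.ι ℝ v) :=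
      eq_neg_of_add_eq_zero_left (ExteriorAlgebra.ι_add_mul_swap v w)
    change ExteriorAlgebra.ι ℝ v * (ExteriorAlgebra.ι ℝ w * y) = _
    rw [← mul_assoc, h, neg_mul, mul_assoc, hy, map_mul, CliffordAlgebra.involute_ι, neg_mul,
      neg_mul, mul_assoc]

/-- The Koszul sign of elements of parities ε, δ = ±1 is (1 + ε + δ - εδ)/2. With the signs replaced
by the parity involution, graded commutativity becomes an identity for arbitrary elements, without
decomposition into homogeneous parts; it is stated doubled to avoid the division. -/
theorem exterior_comm (x y : ExteriorAlgebra ℝ M) :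
    x * y + x * y = y * x + inv' y * x + y * inv' x - inv' y * inv' x := by
  induction x using CliffordAlgebra.left_induction with
  | algebraMap r =>
    rw [AlgHom.commutes, Algebra.commutes r y]
    abel
  | add x z hx hz =>
    have : (x + z) * y + (x + z) * y = (x * y + x * y) + (z * y + z * y) := by noncomm_ring
    rw [this, hx, hz]
    simp only [map_add]
    noncomm_ring
  | ι_mul x v hx =>
    have h1 : ∀ z : ExteriorAlgebra ℝ M, inv' z * ExteriorAlgebra.ι ℝ v =
      ExteriorAlgebra.ι ℝ v * z := fun z => (ι_mul_eq_involute_mul v z).symm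
    have h2 : ∀ z : ExteriorAlgebra ℝ M, z * ExteriorAlgebra.ι ℝ v =
      ExteriorAlgebra.ι ℝ v * inv' z := fun z => by
        rw [ι_mul_eq_involute_mul, CliffordAlgebra.involute_involute]
    change ExteriorAlgebra.ι ℝ v * x * y + ExteriorAlgebra.ι ℝ v * x * y =
      y * (ExteriorAlgebra.ι ℝ v * x) + inv' y * (ExteriorAlgebra.ι ℝ v * x) +
      y * inv' (ExteriorAlgebra.ι ℝ v * x) - inv' y * inv' (ExteriorAlgebra.ι ℝ v * x)
    rw [map_mul, show inv' (ExteriorAlgebra.ι ℝ v) = -ExteriorAlgebra.ι ℝ v from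
      CliffordAlgebra.involute_ι v]
    simp only [neg_mul, mul_neg, ← mul_assoc, h1, h2]
    simp only [mul_assoc, ← mul_add, ← mul_sub, ← mul_neg]
    rw [mul_add, hx]
    congr 1
    simp only [mul_neg]
    abel

theorem contractLeft_mul (φ : Module.Dual ℝ M) (x y : ExteriorAlgebra ℝ M) :
    CliffordAlgebra.contractLeft (Q := (0 : QuadraticForm ℝ M)) φ (x * y) =
      CliffordAlgebra.contractLeft φ x * y + inv' x * CliffordAlgebra.contractLeft φ y := by
  induction x using CliffordAlgebra.left_induction with
  | algebraMap r =>
    rw [CliffordAlgebra.contractLeft_algebraMap_mul, CliffordAlgebra.contractLeft_algebraMap,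
      AlgHom.commutes, zero_mul, zero_add]
  | add x z hx hz =>
    rw [add_mul, map_add, hx, hz, map_add, map_add, add_mul, add_mul]
    abel
  | ι_mul x v hx =>
    rw [mul_assoc, CliffordAlgebra.contractLeft_ι_mul, hx, CliffordAlgebra.contractLeft_ι_mul,
      map_mul, CliffordAlgebra.involute_ι, sub_mul, mul_add, smul_mul_assoc, neg_mul, neg_mul,
      ← mul_assoc, ← mul_assoc]
    abel

end Exterior

/-! ### The graded algebra of functions -/

namespace DarbouxChart

variable {n : ℕ} (V : DarbouxChart n)

@[elab_as_elim]
theorem monom_induction {p : V.Fun → Prop} (x : V.Fun) (zero : p 0)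
    (monom : ∀ f q r, p (V.monom f q r)) (add : ∀ x y, p x → p y → p (x + y)) : p x := by
  refine TensorProduct.induction_on (motive := p) x zero (fun f y => ?_) add
  refine TensorProduct.induction_on
    (motive := fun y => p (f ⊗ₜ[ℝ] y : SmoothFun V.dom ⊗[ℝ] _)) y ?_ (fun p q => monom f p q) ?_
  · rw [TensorProduct.tmul_zero]
    exact zero
  · intro y z hy hz
    rw [TensorProduct.tmul_add]
    exact add _ _ hy hz

theorem monom_mul_monom (f f' p p' q q') :
    V.monom f p q * V.monom f' p' q' = V.monom (f * f') (p * p') (q * q') := by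
  refine (Algebra.TensorProduct.tmul_mul_tmul f f' (p ⊗ₜ[ℝ] q) (p' ⊗ₜ[ℝ] q')).trans ?_
  rw [Algebra.TensorProduct.tmul_mul_tmul]
  rfl

theorem one_eq_monom : (1 : V.Fun) = V.monom 1 1 1 := rfl

theorem monom_add_left (f f' p q) : V.monom (f + f') p q = V.monom f p q + V.monom f' p q :=
  TensorProduct.add_tmul _ _ _

theorem monom_add_mid (f p p' q) : V.monom f (p + p') q = V.monom f p q + V.monom f p' q := by
  unfold monom
  rw [TensorProduct.add_tmul, TensorProduct.tmul_add]
  rfl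

theorem monom_add_right (f p q q') : V.monom f p (q + q') = V.monom f p q + V.monom f p q' := by
  unfold monom
  rw [TensorProduct.tmul_add, TensorProduct.tmul_add]
  rfl

/-- Multiplication of a base function, a polynomial and an exterior element, linear in the last. -/
def monomRight (f : SmoothFun V.dom) (p : MvPolynomial V.EvenIdx ℝ) :
    ExteriorAlgebra ℝ (V.OddIdx → ℝ) →ₗ[ℝ] V.Fun where
  toFun := V.monom f p
  map_add' := V.monom_add_right f p
  map_smul' c q := by
    unfold monom
    rw [TensorProduct.tmul_smul, TensorProduct.tmul_smul]
    rfl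

theorem monomRight_apply (f p q) : V.monomRight f p q = V.monom f p q := rfl

theorem monom_zero_right (f p) : V.monom f p 0 = 0 := (V.monomRight f p).map_zero

theorem monom_smul_right (f p) (c : ℝ) (q) : V.monom f p (c • q) = c • V.monom f p q :=
  (V.monomRight f p).map_smul c q

theorem monom_smul_mid (f p) (c : ℝ) (q) : V.monom f (c • p) q = c • V.monom f p q := by
  unfold monom
  rw [← TensorProduct.smul_tmul', TensorProduct.tmul_smul]
  rfl

theorem parity_monom (f p q) : V.parity (V.monom f p q) =
    V.monom f p (CliffordAlgebra.involute (Q := (0 : QuadraticForm ℝ (V.OddIdx → ℝ))) q) := rfl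

theorem parity_mul (x y : V.Fun) : V.parity (x * y) = V.parity x * V.parity y := by
  induction x using V.monom_induction with
  | zero => simp
  | add x x' h h' => rw [add_mul, map_add, h, h', map_add, add_mul]
  | monom f p q =>
    induction y using V.monom_induction with
    | zero => simp
    | add y y' h h' => rw [mul_add, map_add, h, h', map_add, mul_add]
    | monom f' p' q' => 
      rw [monom_mul_monom, parity_monom, map_mul, parity_monom, parity_monom, monom_mul_monom]

theorem parity_one : V.parity 1 = 1 := by
  rw [one_eq_monom, parity_monom, map_one]

theorem parity_parity (x : V.Fun) : V.parity (V.parity x) = x := by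
  induction x using V.monom_induction with
  | zero => simp
  | add x x' h h' => rw [map_add, map_add, h, h']
  | monom f p q => rw [parity_monom, parity_monom, CliffordAlgebra.involute_involute]

theorem parity_pow_mul (k : ℕ) (x y : V.Fun) :
    (V.parity ^ k) (x * y) = (V.parity ^ k) x * (V.parity ^ k) y := by
  induction k with
  | zero => rfl
  | succ k ih => rw [pow_succ', Module.End.mul_apply, ih, parity_mul]; rfl

theorem parity_pow_one (k : ℕ) : (V.parity ^ k) 1 = 1 := by
  induction k with
  | zero => rfl
  | succ k ih => rw [pow_succ', Module.End.mul_apply, ih, parity_one]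

theorem parity_pow_of_even {k : ℕ} (hk : Even k) : V.parity ^ k = 1 := by
  obtain ⟨m, rfl⟩ := hk
  rw [← two_mul, pow_mul, show V.parity ^ 2 = 1 from LinearMap.ext fun x => V.parity_parity x,
    one_pow]

theorem parity_pow_of_odd {k : ℕ} (hk : Odd k) : V.parity ^ k = V.parity := by
  obtain ⟨m, rfl⟩ := hk
  rw [pow_succ, V.parity_pow_of_even (even_two_mul m), one_mul]

/-- Graded commutativity. -/
theorem mul_add_mul_eq (x y : V.Fun) :
    x * y + x * y = y * x + V.parity y * x + y * V.parity x - V.parity y * V.parity x := by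
  induction x using V.monom_induction with
  | zero => simp
  | add x x' h h' =>
    have : (x + x') * y + (x + x') * y = (x * y + x * y) + (x' * y + x' * y) := by noncomm_ring
    rw [this, h, h']
    simp only [map_add]
    noncomm_ring
  | monom f p q =>
    induction y using V.monom_induction with
    | zero => simp
    | add y y' h h' =>
      have : ∀ z : V.Fun, z * (y + y') + z * (y + y') = (z * y + z * y) + (z * y' + z * y') := by
        intro z; noncomm_ring
      rw [this, h, h']
      simp only [map_add]
      noncomm_ring
    | monom f' p' q' =>
      simp only [parity_monom, monom_mul_monom]
      rw [mul_comm f' f, mul_comm p' p]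
      simp only [← monomRight_apply, ← map_add, ← map_sub]
      rw [exterior_comm]

theorem partialDeriv_mul {ι : Type} [Fintype ι] [DecidableEq ι]
    (U : TopologicalSpace.Opens (ι → ℝ)) (i : ι) (f g : SmoothFun U) :
    SmoothFun.partialDeriv U i (f * g) =
      SmoothFun.partialDeriv U i f * g + f * SmoothFun.partialDeriv U i g := by
  ext x
  have heq : extendZero U (f * g : SmoothFun U) =ᶠ[nhds (x : ι → ℝ)]
      extendZero U f * extendZero U g :=
    Filter.eventuallyEq_of_mem (U.isOpen.mem_nhds x.2)
      (extendZero_eqOn U _ _ fun x => by simp [extendZero_apply])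
  change fderiv ℝ (extendZero U (f * g : SmoothFun U)) x (Pi.single i 1) =
    fderiv ℝ (extendZero U f) x (Pi.single i 1) * g.1 x +
      f.1 x * fderiv ℝ (extendZero U g) x (Pi.single i 1)
  rw [heq.fderiv_eq, fderiv_mul (smoothFun_differentiableAt f x) (smoothFun_differentiableAt g x)]
  simp only [_root_.add_apply, _root_.smul_apply, extendZero_apply,
    smul_eq_mul]
  ring

/-- The graded Leibniz rule. -/
theorem pd_mul (a : Fin V.r) (x y : V.Fun) :
    V.pd a (x * y) = V.pd a x * y + (V.parity ^ V.deg a) x * V.pd a y := by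
  induction x using V.monom_induction with
  | zero => simp
  | add x x' h h' => rw [add_mul, map_add, h, h']; simp only [map_add, add_mul]; abel
  | monom f p q =>
    induction y using V.monom_induction with
    | zero => simp
    | add y y' h h' => rw [mul_add, map_add, h, h']; simp only [map_add, mul_add]; abel
    | monom f' p' q' =>
      unfold pd
      split_ifs with h0 he
      · rw [h0, pow_zero, Module.End.one_apply]
        simp only [monom_mul_monom, mapFun_monom, partialDeriv_mul, monom_add_left,
          LinearMap.id_apply]
      · rw [V.parity_pow_of_even he, Module.End.one_apply]
        simp only [monom_mul_monom, mapFun_monom, LinearMap.id_apply, Derivation.coeFn_coe,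
          Derivation.leibniz, smul_eq_mul, monom_add_mid]
        rw [add_comm, mul_comm p']
      · rw [V.parity_pow_of_odd (Nat.not_even_iff_odd.mp he), parity_monom]
        simp only [monom_mul_monom, mapFun_monom, LinearMap.id_apply, contractLeft_mul,
          monom_add_right]

/-! ### Degrees -/

/-- The product of odd coordinates. -/
def oddProd (l : List V.OddIdx) : ExteriorAlgebra ℝ (V.OddIdx → ℝ) :=
  (l.map fun i => ExteriorAlgebra.ι ℝ (Pi.single i (1 : ℝ) : V.OddIdx → ℝ)).prod

theorem oddProd_cons (i : V.OddIdx) (l : List V.OddIdx) : V.oddProd (i :: l) =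
    ExteriorAlgebra.ι ℝ (Pi.single i (1 : ℝ) : V.OddIdx → ℝ) * V.oddProd l := rfl

theorem oddProd_append (l l' : List V.OddIdx) :
    V.oddProd (l ++ l') = V.oddProd l * V.oddProd l' := by
  simp [oddProd]

/-- The degree of a product of odd coordinates. -/
def oddDeg (l : List V.OddIdx) : ℕ := (l.map fun i => V.deg i).sum

theorem oddDeg_cons (i : V.OddIdx) (l : List V.OddIdx) :
    V.oddDeg (i :: l) = V.deg i + V.oddDeg l := by
  simp [oddDeg]

theorem oddDeg_append (l l' : List V.OddIdx) :
    V.oddDeg (l ++ l') = V.oddDeg l + V.oddDeg l' := by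
  simp [oddDeg]

/-- The elements of degree `s` of the exterior algebra on the odd coordinates. -/
def oddHomogeneous (s : ℤ) : Submodule ℝ (ExteriorAlgebra ℝ (V.OddIdx → ℝ)) :=
  Submodule.span ℝ {x | ∃ l : List V.OddIdx, (V.oddDeg l : ℤ) = s ∧
    x = V.oddProd l}

theorem oddProd_mem (l : List V.OddIdx) :
    V.oddProd l ∈ V.oddHomogeneous (V.oddDeg l : ℕ) :=
  Submodule.subset_span ⟨l, rfl, rfl⟩

theorem ι_mul_mem_oddHomogeneous (i : V.OddIdx) {s : ℤ} {x : ExteriorAlgebra ℝ (V.OddIdx → ℝ)}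
    (hx : x ∈ V.oddHomogeneous s) :
    ExteriorAlgebra.ι ℝ (Pi.single i (1 : ℝ) : V.OddIdx → ℝ) * x ∈
      V.oddHomogeneous (V.deg i + s) := by
  induction hx using Submodule.span_induction with
  | mem x h =>
    obtain ⟨l, rfl, rfl⟩ := h
    refine Submodule.subset_span ⟨i :: l, ?_, rfl⟩
    rw [oddDeg_cons, Nat.cast_add]
  | zero => rw [mul_zero]; exact zero_mem _
  | add x y _ _ hx hy => rw [mul_add]; exact add_mem hx hy
  | smul c x _ hx => rw [mul_smul_comm]; exact Submodule.smul_mem _ c hx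

theorem contractLeft_oddProd_mem (a : V.OddIdx) (l : List V.OddIdx) :
    CliffordAlgebra.contractLeft (Q := (0 : QuadraticForm ℝ (V.OddIdx → ℝ)))
      (LinearMap.proj a) (V.oddProd l) ∈
        V.oddHomogeneous ((V.oddDeg l : ℕ) - V.deg a) := by
  induction l with
  | nil =>
    rw [oddProd, List.map_nil, List.prod_nil, CliffordAlgebra.contractLeft_one]
    exact zero_mem _
  | cons i l ih =>
    rw [oddProd_cons, ExteriorAlgebra.ι, CliffordAlgebra.contractLeft_ι_mul]
    refine sub_mem ?_ ?_
    · by_cases h : i = a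
      · subst h
        refine Submodule.smul_mem _ _ ?_
        convert V.oddProd_mem l using 2
        rw [oddDeg_cons]
        push_cast
        ring
      · rw [LinearMap.proj_apply, Pi.single_eq_of_ne (Ne.symm h), zero_smul]
        exact zero_mem _
    · have := V.ι_mul_mem_oddHomogeneous i ih
      convert this using 2
      rw [oddDeg_cons]
      push_cast
      ring

theorem monom_mem (f : SmoothFun V.dom) (m : V.EvenIdx →₀ ℕ) {s k : ℤ}
    {q : ExteriorAlgebra ℝ (V.OddIdx → ℝ)} (hq : q ∈ V.oddHomogeneous s)
    (hk : ((m.sum fun i e => e * V.deg i : ℕ) : ℤ) + s = k) :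
    V.monom f (MvPolynomial.monomial m 1) q ∈ V.homogeneous k := by
  induction hq using Submodule.span_induction with
  | mem x h =>
    obtain ⟨l, rfl, rfl⟩ := h
    refine Submodule.subset_span ⟨f, m, l, ?_, rfl⟩
    exact hk
  | zero => rw [V.monom_zero_right]; exact zero_mem _
  | add x y _ _ hx hy => rw [V.monom_add_right]; exact add_mem hx hy
  | smul c x _ hx => rw [V.monom_smul_right]; exact Submodule.smul_mem _ c hx

theorem pd_mem (a : Fin V.r) {k : ℤ} {x : V.Fun} (hx : x ∈ V.homogeneous k) :
    V.pd a x ∈ V.homogeneous (k - V.deg a) := by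
  induction hx using Submodule.span_induction with
  | zero => rw [map_zero]; exact zero_mem _
  | add x y _ _ hx hy => rw [map_add]; exact add_mem hx hy
  | smul c x _ hx => rw [map_smul]; exact Submodule.smul_mem _ c hx
  | mem x h =>
    obtain ⟨f, m, l, hk, rfl⟩ := h
    replace hk : ((m.sum fun i e => e * V.deg i : ℕ) : ℤ) + (V.oddDeg l : ℤ) = k := hk
    change V.pd a (V.monom f _ (V.oddProd l)) ∈ _
    unfold pd
    split_ifs with h0 he
    · rw [mapFun_monom]
      refine V.monom_mem _ m (V.oddProd_mem l) ?_
      rw [h0, ← hk]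
      simp
    · rw [mapFun_monom, Derivation.coeFn_coe, MvPolynomial.pderiv_monomial]
      -- If the exponent is zero the derivative vanishes; this case is separate because truncated
      -- subtraction would leave the exponent, and so the degree, unchanged.
      by_cases hm : m ⟨a, h0, he⟩ = 0
      · rw [hm, Nat.cast_zero, mul_zero, MvPolynomial.monomial_zero,
          ← zero_smul ℝ (0 : MvPolynomial V.EvenIdx ℝ), V.monom_smul_mid, zero_smul]
        exact zero_mem _
      · rw [one_mul, ← mul_one ((m ⟨a, h0, he⟩ : ℕ) : ℝ), ← smul_eq_mul,
          ← MvPolynomial.smul_monomial, V.monom_smul_mid]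
        refine Submodule.smul_mem _ _ (V.monom_mem _ _ (V.oddProd_mem l) ?_)
        have hle : Finsupp.single (⟨a, h0, he⟩ : V.EvenIdx) 1 ≤ m := by
          rw [Finsupp.single_le_iff]
          omega
        have hsum := Finsupp.sum_add_index' (f := m - Finsupp.single ⟨a, h0, he⟩ 1)
          (g := Finsupp.single (⟨a, h0, he⟩ : V.EvenIdx) 1) (h := fun i e => e * V.deg i)
          (by simp) (by intros; ring)
        rw [tsub_add_cancel_of_le hle, Finsupp.sum_single_index (by simp)] at hsum
        rw [← hk, hsum]
        push_cast
        ring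
    · rw [mapFun_monom]
      refine V.monom_mem _ m (V.contractLeft_oddProd_mem _ l) ?_
      rw [← hk]
      ring

theorem mul_mem_homogeneous {k j : ℤ} {x y : V.Fun} (hx : x ∈ V.homogeneous k)
    (hy : y ∈ V.homogeneous j) : x * y ∈ V.homogeneous (k + j) := by
  induction hx using Submodule.span_induction with
  | zero => rw [zero_mul]; exact zero_mem _
  | add x y _ _ hx hy => rw [add_mul]; exact add_mem hx hy
  | smul c x _ hx => rw [smul_mul_assoc]; exact Submodule.smul_mem _ c hx
  | mem x h =>
    obtain ⟨f, m, l, hk, rfl⟩ := h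
    replace hk : ((m.sum fun i e => e * V.deg i : ℕ) : ℤ) + (V.oddDeg l : ℤ) = k := hk
    induction hy using Submodule.span_induction with
    | zero => rw [mul_zero]; exact zero_mem _
    | add x y _ _ hx hy => rw [mul_add]; exact add_mem hx hy
    | smul c x _ hx => rw [mul_smul_comm]; exact Submodule.smul_mem _ c hx
    | mem y h =>
      obtain ⟨f', m', l', hk', rfl⟩ := h
      replace hk' : ((m'.sum fun i e => e * V.deg i : ℕ) : ℤ) + (V.oddDeg l' : ℤ) = j := hk'
      change V.monom f _ (V.oddProd l) * V.monom f' _ (V.oddProd l') ∈ _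
      rw [monom_mul_monom, MvPolynomial.monomial_mul, one_mul, ← oddProd_append]
      refine V.monom_mem _ _ (V.oddProd_mem _) ?_
      rw [Finsupp.sum_add_index' (by simp) (by intros; ring), ← hk, ← hk', oddDeg_append]
      push_cast
      ring

theorem one_mem_homogeneous : (1 : V.Fun) ∈ V.homogeneous 0 :=
  V.monom_mem 1 0 (V.oddProd_mem []) (by simp [oddDeg])

/-- The parity operator counts odd coordinates only; this agrees with the degree modulo 2 because
all the other coordinates have even degree. -/
theorem parity_of_mem {k : ℤ} {x : V.Fun} (hx : x ∈ V.homogeneous k) :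
    V.parity x = (-1 : ℝ) ^ k • x := by
  induction hx using Submodule.span_induction with
  | zero => simp
  | add x y _ _ hx hy => rw [map_add, hx, hy, smul_add]
  | smul c x _ hx => rw [map_smul, hx, smul_comm]
  | mem x h =>
    obtain ⟨f, m, l, hk, rfl⟩ := h
    replace hk : ((m.sum fun i e => e * V.deg i : ℕ) : ℤ) + (V.oddDeg l : ℤ) = k := hk
    change V.parity (V.monom f _ (V.oddProd l)) = _ • V.monom f _ (V.oddProd l)
    have h1 : Even (m.sum fun i e => e * V.deg i) :=
      Finset.even_sum _ fun i _ => i.2.2.mul_left _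
    have h2 : ∀ l : List V.OddIdx,
        CliffordAlgebra.involute (Q := (0 : QuadraticForm ℝ (V.OddIdx → ℝ))) (V.oddProd l) =
          (-1 : ℝ) ^ V.oddDeg l • V.oddProd l := by
      intro l
      induction l with
      | nil => simp [oddProd, oddDeg]
      | cons i l ih =>
        rw [oddProd_cons, map_mul, ih, ExteriorAlgebra.ι, CliffordAlgebra.involute_ι,
          oddDeg_cons, pow_add, i.2.neg_one_pow]
        simp
    rw [parity_monom, h2, V.monom_smul_right, ← hk, zpow_add₀ (by norm_num), zpow_natCast,
      zpow_natCast, h1.neg_one_pow, one_mul]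

/-- All coordinates have nonnegative degree. This is what makes coboundaries of degree -d act by
zero. -/
theorem homogeneous_of_neg {k : ℤ} (hk : k < 0) : V.homogeneous k = ⊥ := by
  rw [eq_bot_iff]
  refine Submodule.span_le.2 ?_
  rintro x ⟨f, m, l, h, -⟩
  omega

theorem parity_pow_mem (j : ℕ) {k : ℤ} {x : V.Fun} (hx : x ∈ V.homogeneous k) :
    (V.parity ^ j) x ∈ V.homogeneous k := by
  induction j with
  | zero => exact hx
  | succ j ih =>
    rw [pow_succ', Module.End.mul_apply, V.parity_of_mem ih]
    exact Submodule.smul_mem _ _ ih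

end DarbouxChart
end GraphFlow
end

/-! ### Insertion of graphs becomes substitution of functions -/

noncomputable section

namespace GraphFlow

namespace Gra

@[elab_as_elim]
theorem mk_induction {d N k : ℕ} {p : Gra d N k → Prop} (x : Gra d N k) (zero : p 0)
    (add : ∀ x y, p x → p y → p (x + y)) (smul : ∀ (c : ℝ) x, p x → p (c • x))
    (mk : ∀ g, p (mk d g)) : p x := by
  obtain ⟨x, rfl⟩ := Submodule.mkQ_surjective _ x
  induction x using Finsupp.induction_linear with
  | zero => rw [map_zero]; exact zero
  | add x y hx hy => rw [map_add]; exact add _ _ hx hy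
  | single g c =>
    rw [← mul_one c, ← smul_eq_mul, ← Finsupp.smul_single, map_smul]
    exact smul c _ (mk g)

open Classical in
/-- The pairs of vertices over a pair of vertices. -/
def fiber {N N' : ℕ} (φ : Fin N → Fin N') (p : Fin N' × Fin N') : Finset (Fin N × Fin N) :=
  Finset.univ.filter fun q => (φ q.1, φ q.2) = p

/-- A reconnection is chosen independently for each edge. In this product form the sum over
reconnections can be exchanged with the ordered product of the edge operators. -/
theorem insertGraph_eq_sum_piFinset (d : ℕ) {M N j k : ℕ} (g : LGraph (M + 1) j)
    (h : LGraph N k) : insertGraph d g h =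
      ∑ g' ∈ Fintype.piFinset fun e => fiber (collapse M N) (g e),
        mk d (Fin.append g' (h.mapVertices (Fin.castAdd M))) := by
  classical
  refine Finset.sum_congr ?_ fun _ _ => rfl
  ext g'
  simp [fiber, LGraph.mapVertices, funext_iff]

end Gra

namespace DarbouxChart

variable {n : ℕ} (V : DarbouxChart n)

theorem rep_mk {N k : ℕ} (g : LGraph N k) : V.rep (Gra.mk (n + 1) g) = V.repGraph g :=
  Gra.lift_mk _ _ _ _

/-- Multiplication of all the tensor factors. -/
def mulAll (N : ℕ) : (⨂[ℝ] _ : Fin N, V.Fun) →ₗ[ℝ] V.Fun :=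
  PiTensorProduct.lift (MultilinearMap.mkPiAlgebraFin ℝ N V.Fun)

theorem mulAll_tprod {N : ℕ} (f : Fin N → V.Fun) :
    V.mulAll N (PiTensorProduct.tprod ℝ f) = (List.ofFn f).prod := by
  rw [mulAll, PiTensorProduct.lift.tprod, MultilinearMap.mkPiAlgebraFin_apply]

theorem repGraph_apply {N k : ℕ} (g : LGraph N k) (f : Fin N → V.Fun) :
    V.repGraph g f = V.mulAll N (V.graphOp g (PiTensorProduct.tprod ℝ f)) := rfl

theorem pdAt_tprod {N : ℕ} (i : Fin N) (a : Fin V.r) (f : Fin N → V.Fun) :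
    V.pdAt i a (PiTensorProduct.tprod ℝ f) = PiTensorProduct.tprod ℝ fun j =>
      if j < i then (V.parity ^ V.deg a) (f j) else if j = i then V.pd a (f j) else f j := by
  rw [pdAt, PiTensorProduct.map_tprod]
  congr 1
  funext j
  split_ifs <;> rfl

theorem parity_pow_prod (k : ℕ) {N : ℕ} (f : Fin N → V.Fun) :
    (V.parity ^ k) (List.ofFn f).prod = (List.ofFn fun j => (V.parity ^ k) (f j)).prod := by
  induction N with
  | zero => simp [parity_pow_one]
  | succ N ih =>
    rw [List.ofFn_succ, List.prod_cons, parity_pow_mul, ih, List.ofFn_succ, List.prod_cons]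

theorem pd_one (a : Fin V.r) : V.pd a 1 = 0 := by
  have h := V.pd_mul a 1 1
  rw [mul_one, mul_one, V.parity_pow_one, one_mul] at h
  exact left_eq_add.1 h

/-- Iterating the Leibniz rule puts the parity operator on exactly the factors to the left of the
differentiated one, which is the sign convention of `pdAt`. -/
theorem pd_prod (a : Fin V.r) {N : ℕ} (f : Fin N → V.Fun) :
    V.pd a (List.ofFn f).prod = ∑ i, (List.ofFn fun j => if j < i then
      (V.parity ^ V.deg a) (f j) else if j = i then V.pd a (f j) else f j).prod := by
  induction N with
  | zero => simp [pd_one]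
  | succ N ih =>
    rw [List.ofFn_succ, List.prod_cons, pd_mul, ih, Fin.sum_univ_succ, Finset.mul_sum]
    congr 1
    · simp [List.ofFn_succ]
    · refine Finset.sum_congr rfl fun i _ => ?_
      simp [List.ofFn_succ]

theorem update_castAdd_castAdd {X : Type*} {N M : ℕ} (f : Fin (N + M) → X) (i : Fin N) (x : X) :
    (fun j => Function.update f (Fin.castAdd M i) x (Fin.castAdd M j)) =
      Function.update (fun j => f (Fin.castAdd M j)) i x :=
  Function.update_comp_eq_of_injective f (Fin.castAdd_injective N M) i x

theorem update_natAdd_natAdd {X : Type*} {N M : ℕ} (f : Fin (N + M) → X) (i : Fin M) (x : X) :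
    (fun j => Function.update f (Fin.natAdd N i) x (Fin.natAdd N j)) =
      Function.update (fun j => f (Fin.natAdd N j)) i x :=
  Function.update_comp_eq_of_injective f (Fin.natAdd_injective M N) i x

theorem castAdd_ne_natAdd {N M : ℕ} (i : Fin N) (j : Fin M) :
    Fin.castAdd M i ≠ Fin.natAdd N j := by
  rw [Ne, Fin.ext_iff]
  simp
  omega

theorem update_castAdd_natAdd {X : Type*} {N M : ℕ} (f : Fin (N + M) → X) (i : Fin N) (x : X) :
    (fun j => Function.update f (Fin.castAdd M i) x (Fin.natAdd N j)) =
      fun j => f (Fin.natAdd N j) :=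
  funext fun j => Function.update_of_ne (castAdd_ne_natAdd i j).symm _ _

theorem update_natAdd_castAdd {X : Type*} {N M : ℕ} (f : Fin (N + M) → X) (i : Fin M) (x : X) :
    (fun j => Function.update f (Fin.natAdd N i) x (Fin.castAdd M j)) =
      fun j => f (Fin.castAdd M j) :=
  funext fun j => Function.update_of_ne (castAdd_ne_natAdd j i) _ _

theorem append_update_left {X : Type*} {N M : ℕ} (f : Fin N → X) (f' : Fin M → X) (i : Fin N)
    (x : X) : (Fin.append (Function.update f i x) f' : Fin (N + M) → X) =
      Function.update (Fin.append f f') (Fin.castAdd M i) x := by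
  funext j
  refine Fin.addCases (fun j => ?_) (fun j => ?_) j
  · have := congrFun (update_castAdd_castAdd (Fin.append f f') i x) j
    refine Eq.trans ?_ this.symm
    simp
  · rw [Function.update_of_ne (castAdd_ne_natAdd i j).symm]
    simp

/-- Multiplication of the first `N` tensor factors. -/
def merge (N M : ℕ) : (⨂[ℝ] _ : Fin (N + M), V.Fun) →ₗ[ℝ] ⨂[ℝ] _ : Fin (M + 1), V.Fun :=
  PiTensorProduct.lift
    { toFun := fun f => PiTensorProduct.tprod ℝ (Fin.cons
        (MultilinearMap.mkPiAlgebraFin ℝ N V.Fun fun i => f (Fin.castAdd M i))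
        (fun j => f (Fin.natAdd N j)) : Fin (M + 1) → V.Fun)
      map_update_add' := by
        intro inst f i x y
        rw [Subsingleton.elim inst (instDecidableEqFin _)]
        refine Fin.addCases (fun i => ?_) (fun i => ?_) i
        · simp only [update_castAdd_castAdd, update_castAdd_natAdd, MultilinearMap.map_update_add,
            MultilinearMap.cons_add]
        · simp only [update_natAdd_castAdd, update_natAdd_natAdd, Fin.cons_update,
            MultilinearMap.map_update_add]
      map_update_smul' := by
        intro inst f i c x
        rw [Subsingleton.elim inst (instDecidableEqFin _)]
        refine Fin.addCases (fun i => ?_) (fun i => ?_) i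
        · simp only [update_castAdd_castAdd, update_castAdd_natAdd, MultilinearMap.map_update_smul,
            MultilinearMap.cons_smul]
        · simp only [update_natAdd_castAdd, update_natAdd_natAdd, Fin.cons_update,
            MultilinearMap.map_update_smul] }

theorem merge_tprod {N M : ℕ} (f : Fin (N + M) → V.Fun) :
    V.merge N M (PiTensorProduct.tprod ℝ f) = PiTensorProduct.tprod ℝ (Fin.cons
        (List.ofFn fun i => f (Fin.castAdd M i)).prod (fun j => f (Fin.natAdd N j))) := by
  rw [merge, PiTensorProduct.lift.tprod]
  rfl

theorem mulAll_merge {N M : ℕ} : V.mulAll (M + 1) ∘ₗ V.merge N M = V.mulAll (N + M) := by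
  refine PiTensorProduct.ext (MultilinearMap.ext fun f => ?_)
  simp only [LinearMap.compMultilinearMap_apply, LinearMap.comp_apply, merge_tprod, mulAll_tprod]
  rw [List.ofFn_succ, List.prod_cons, List.ofFn_add, List.prod_append]
  rfl

/-- Tensoring a function with fixed functions on the right. -/
def tensorCons {M : ℕ} (f' : Fin M → V.Fun) : V.Fun →ₗ[ℝ] ⨂[ℝ] _ : Fin (M + 1), V.Fun where
  toFun x := PiTensorProduct.tprod ℝ (Fin.cons x f' : Fin (M + 1) → V.Fun)
  map_add' _ _ := MultilinearMap.cons_add _ _ _ _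
  map_smul' _ _ := MultilinearMap.cons_smul _ _ _ _

theorem collapse_castAdd {M N : ℕ} (i : Fin N) : Gra.collapse M N (Fin.castAdd M i) = 0 :=
  Fin.addCases_left _

theorem collapse_natAdd {M N : ℕ} (j : Fin M) : Gra.collapse M N (Fin.natAdd N j) = j.succ :=
  Fin.addCases_right _

-- For the collapsed vertex this is the Leibniz rule for a product of several factors. For any other
-- vertex the merged product is only passed over by a power of the parity operator, which is
-- multiplicative.
open Classical in
theorem merge_comp_sum_pdAt {N M : ℕ} (v : Fin (M + 1)) (a : Fin V.r) :
    V.merge N M ∘ₗ (∑ u with Gra.collapse M N u = v, V.pdAt u a) =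
      V.pdAt v a ∘ₗ V.merge N M := by
  refine PiTensorProduct.ext (MultilinearMap.ext fun f => ?_)
  simp only [LinearMap.compMultilinearMap_apply, LinearMap.comp_apply, merge_tprod, pdAt_tprod,
    LinearMap.sum_apply, map_sum]
  rw [Finset.sum_filter, Fin.sum_univ_add]
  simp only [collapse_castAdd, collapse_natAdd]
  refine Fin.cases ?_ (fun j => ?_) v
  · have h1 : ∀ i j, ¬ Fin.natAdd N j < Fin.castAdd M i := fun i j => by
      rw [Fin.lt_def]; simp; omega
    have h2 : ∀ i j, Fin.natAdd N j ≠ Fin.castAdd M i := fun i j => (castAdd_ne_natAdd i j).symm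
    have h3 : ∀ i j : Fin N, Fin.castAdd M j < Fin.castAdd M i ↔ j < i := fun _ _ => Iff.rfl
    simp only [Fin.succ_ne_zero, if_true, if_false, Finset.sum_const_zero, add_zero, h1, h2, h3,
      Fin.castAdd_inj]
    have h4 : (fun i : Fin (M + 1) => if i < 0 then (V.parity ^ V.deg a) ((Fin.cons
        (List.ofFn fun i => f (Fin.castAdd M i)).prod (fun j => f (Fin.natAdd N j)) :
          Fin (M + 1) → V.Fun) i) else if i = 0 then V.pd a ((Fin.cons
        (List.ofFn fun i => f (Fin.castAdd M i)).prod (fun j => f (Fin.natAdd N j)) :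
          Fin (M + 1) → V.Fun) i) else (Fin.cons
        (List.ofFn fun i => f (Fin.castAdd M i)).prod (fun j => f (Fin.natAdd N j)) :
          Fin (M + 1) → V.Fun) i) = Fin.cons (V.pd a (List.ofFn fun i => f (Fin.castAdd M i)).prod)
          (fun j => f (Fin.natAdd N j)) := by
      funext i
      refine Fin.cases ?_ (fun i => ?_) i
      · simp
      · simp
    rw [h4, pd_prod]
    exact (map_sum (V.tensorCons _) _ _).symm
  · have h1 : ∀ i j, Fin.castAdd M i < Fin.natAdd N j := fun i j => by
      rw [Fin.lt_def]; simp; omega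
    have h3 : ∀ i j : Fin M, Fin.natAdd N j < Fin.natAdd N i ↔ j < i := fun i j => by
      rw [Fin.lt_def, Fin.val_natAdd, Fin.val_natAdd, Nat.add_lt_add_iff_left, Fin.lt_def]
    simp only [(Fin.succ_ne_zero _).symm, if_false, Finset.sum_const_zero, zero_add, h1, h3,
      Fin.succ_inj, Finset.sum_ite_eq', Finset.mem_univ, if_true, Fin.natAdd_inj]
    congr 1
    funext i
    refine Fin.cases ?_ (fun i => ?_) i
    · simp [parity_pow_prod]
    · simp

/-- The sum over the reconnections of an edge. -/
theorem merge_comp_sum_edgeOp {N M : ℕ} (p : Fin (M + 1) × Fin (M + 1)) :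
    V.merge N M ∘ₗ (∑ q ∈ Gra.fiber (Gra.collapse M N) p, V.edgeOp q.1 q.2) =
      V.edgeOp p.1 p.2 ∘ₗ V.merge N M := by
  classical
  have h : (∑ q ∈ Gra.fiber (Gra.collapse M N) p, V.edgeOp q.1 q.2) =
      ∑ a, ∑ b, V.pairing a b • ((∑ u with Gra.collapse M N u = p.1, V.pdAt u a) *
        ∑ u with Gra.collapse M N u = p.2, V.pdAt u b) := by
    have hf : Gra.fiber (Gra.collapse M N) p =
        (Finset.univ.filter fun u => Gra.collapse M N u = p.1) ×ˢ
          (Finset.univ.filter fun u => Gra.collapse M N u = p.2) := by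
      ext q
      simp [Gra.fiber, Prod.ext_iff]
    unfold edgeOp
    rw [hf, Finset.sum_comm]
    refine Finset.sum_congr rfl fun a _ => ?_
    rw [Finset.sum_comm]
    refine Finset.sum_congr rfl fun b _ => ?_
    rw [← Finset.smul_sum, Finset.sum_mul_sum, Finset.sum_product]
  rw [h]
  unfold edgeOp
  refine LinearMap.ext fun x => ?_
  simp only [LinearMap.comp_apply, LinearMap.sum_apply, map_sum, LinearMap.smul_apply, map_smul]
  refine Finset.sum_congr rfl fun a _ => Finset.sum_congr rfl fun b _ => ?_
  have h1 := LinearMap.congr_fun (V.merge_comp_sum_pdAt (N := N) p.1 a)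
  have h2 := LinearMap.congr_fun (V.merge_comp_sum_pdAt (N := N) p.2 b)
  simp only [LinearMap.comp_apply] at h1 h2
  rw [Module.End.mul_apply, h1, h2]
  rfl

/-- Intertwining single edge operators suffices to intertwine graph operators; this is applied to
merging factors, to adding factors on the right and to exchanging neighbours. -/
theorem comp_prod_ofFn {X Y : Type*} [AddCommGroup X] [Module ℝ X] [AddCommGroup Y] [Module ℝ Y]
    (m : X →ₗ[ℝ] Y) {k : ℕ} (A : Fin k → Module.End ℝ X) (B : Fin k → Module.End ℝ Y)
    (h : ∀ e, m ∘ₗ A e = B e ∘ₗ m) :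
    m ∘ₗ (List.ofFn A).prod = (List.ofFn B).prod ∘ₗ m := by
  induction k with
  | zero => rfl
  | succ k ih =>
    rw [List.ofFn_succ, List.prod_cons, List.ofFn_succ, List.prod_cons, Module.End.mul_eq_comp,
      Module.End.mul_eq_comp, ← LinearMap.comp_assoc, h, LinearMap.comp_assoc,
      ih _ _ fun e => h e.succ, LinearMap.comp_assoc]

/-- Expanding the ordered product of the sums over reconnections, one sum for each edge, gives the
sum over all reconnected graphs; multilinearity of the product is enough, so the edge operators need
not commute. -/
theorem merge_comp_sum_graphOp {N M j : ℕ} (g : LGraph (M + 1) j) :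
    V.merge N M ∘ₗ (∑ g' ∈ Fintype.piFinset fun e => Gra.fiber (Gra.collapse M N) (g e),
      V.graphOp g') = V.graphOp g ∘ₗ V.merge N M := by
  have h := MultilinearMap.map_sum_finset
    (MultilinearMap.mkPiAlgebraFin ℝ j (Module.End ℝ (⨂[ℝ] _ : Fin (N + M), V.Fun)))
    (fun _ (q : Fin (N + M) × Fin (N + M)) => V.edgeOp q.1 q.2)
    (fun e => Gra.fiber (Gra.collapse M N) (g e))
  simp only [MultilinearMap.mkPiAlgebraFin_apply] at h
  unfold graphOp
  rw [← h]
  exact comp_prod_ofFn _ _ _ fun e => V.merge_comp_sum_edgeOp (g e)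

/-- Tensoring with fixed functions on the right. -/
def tensorRight (N : ℕ) {M : ℕ} (f' : Fin M → V.Fun) :
    (⨂[ℝ] _ : Fin N, V.Fun) →ₗ[ℝ] ⨂[ℝ] _ : Fin (N + M), V.Fun :=
  PiTensorProduct.lift
    { toFun := fun f => PiTensorProduct.tprod ℝ (Fin.append f f')
      map_update_add' := by
        intro inst f i x y
        rw [Subsingleton.elim inst (instDecidableEqFin _)]
        simp only [append_update_left, MultilinearMap.map_update_add]
      map_update_smul' := by
        intro inst f i c x
        rw [Subsingleton.elim inst (instDecidableEqFin _)]
        simp only [append_update_left, MultilinearMap.map_update_smul] }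

theorem tensorRight_tprod {N M : ℕ} (f : Fin N → V.Fun) (f' : Fin M → V.Fun) :
    V.tensorRight N f' (PiTensorProduct.tprod ℝ f) =
      PiTensorProduct.tprod ℝ (Fin.append f f') := by
  rw [tensorRight, PiTensorProduct.lift.tprod]
  rfl

/-- No sign appears because the new factors stand to the right of the differentiated one. This is
where it matters that the vertices of the inserted graph are numbered first. -/
theorem tensorRight_comp_pdAt {N M : ℕ} (f' : Fin M → V.Fun) (i : Fin N) (a : Fin V.r) :
    V.tensorRight N f' ∘ₗ V.pdAt i a = V.pdAt (Fin.castAdd M i) a ∘ₗ V.tensorRight N f' := by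
  refine PiTensorProduct.ext (MultilinearMap.ext fun f => ?_)
  simp only [LinearMap.compMultilinearMap_apply, LinearMap.comp_apply, pdAt_tprod,
    tensorRight_tprod]
  congr 1
  funext j
  refine Fin.addCases (fun j => ?_) (fun j => ?_) j
  · have h3 : Fin.castAdd M j < Fin.castAdd M i ↔ j < i := Iff.rfl
    simp [h3]
  · have h1 : ¬ Fin.natAdd N j < Fin.castAdd M i := by
      rw [Fin.lt_def]; simp; omega
    have h2 : Fin.natAdd N j ≠ Fin.castAdd M i := by
      rw [Ne, Fin.ext_iff]; simp; omega
    simp [h1, h2]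

theorem tensorRight_comp_edgeOp {N M : ℕ} (f' : Fin M → V.Fun) (i j : Fin N) :
    V.tensorRight N f' ∘ₗ V.edgeOp i j =
      V.edgeOp (Fin.castAdd M i) (Fin.castAdd M j) ∘ₗ V.tensorRight N f' := by
  unfold edgeOp
  refine LinearMap.ext fun x => ?_
  simp only [LinearMap.comp_apply, LinearMap.sum_apply, map_sum, LinearMap.smul_apply, map_smul]
  refine Finset.sum_congr rfl fun a _ => Finset.sum_congr rfl fun b _ => ?_
  have h1 := LinearMap.congr_fun (V.tensorRight_comp_pdAt f' i a)
  have h2 := LinearMap.congr_fun (V.tensorRight_comp_pdAt f' j b)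
  simp only [LinearMap.comp_apply] at h1 h2
  rw [Module.End.mul_apply, h1, h2]
  rfl

theorem tensorRight_comp_graphOp {N M k : ℕ} (f' : Fin M → V.Fun) (h : LGraph N k) :
    V.tensorRight N f' ∘ₗ V.graphOp h =
      V.graphOp (h.mapVertices (Fin.castAdd M)) ∘ₗ V.tensorRight N f' :=
  comp_prod_ofFn _ _ _ fun _ => V.tensorRight_comp_edgeOp f' _ _

theorem merge_comp_tensorRight {N M : ℕ} (f' : Fin M → V.Fun) :
    V.merge N M ∘ₗ V.tensorRight N f' = V.tensorCons f' ∘ₗ V.mulAll N := by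
  refine PiTensorProduct.ext (MultilinearMap.ext fun f => ?_)
  simp only [LinearMap.compMultilinearMap_apply, LinearMap.comp_apply, tensorRight_tprod,
    merge_tprod, mulAll_tprod, Fin.append_left, Fin.append_right]
  rfl

theorem graphOp_append {N j k : ℕ} (g : LGraph N j) (h : LGraph N k) :
    V.graphOp (Fin.append g h) = V.graphOp g * V.graphOp h := by
  unfold graphOp
  rw [List.ofFn_add, List.prod_append]
  simp

/-- The edges of the inserted graph come last in the edge order, so their operators act first and
act on the first factors only. Merging these factors then produces the value of the inserted graph,
and the reconnected edges of the outer graph act on that value. -/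
theorem mulAll_sum_graphOp_append {M N j k : ℕ} (g : LGraph (M + 1) j) (h : LGraph N k)
    (f : Fin N → V.Fun) (f' : Fin M → V.Fun) :
    ∑ g' ∈ Fintype.piFinset fun e => Gra.fiber (Gra.collapse M N) (g e),
      V.repGraph (Fin.append g' (h.mapVertices (Fin.castAdd M))) (Fin.append f f') =
        V.repGraph g (Fin.cons (V.repGraph h f) f') := by
  simp only [repGraph_apply, graphOp_append, Module.End.mul_apply]
  rw [← tensorRight_tprod]
  have h1 := LinearMap.congr_fun (V.tensorRight_comp_graphOp f' h)
  have h2 := LinearMap.congr_fun (V.merge_comp_sum_graphOp (N := N) g)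
  have h3 := LinearMap.congr_fun (V.merge_comp_tensorRight (N := N) f')
  have h4 := LinearMap.congr_fun (V.mulAll_merge (N := N) (M := M))
  simp only [LinearMap.comp_apply] at h1 h2 h3 h4
  simp only [← h1, ← h4]
  rw [← map_sum, ← map_sum, ← LinearMap.sum_apply, h2, h3]
  rfl

/-- The representation is compatible with the partial composition. -/
theorem rep_comp₁ {M N j k : ℕ} (x : Gra (n + 1) (M + 1) j) (y : Gra (n + 1) N k)
    (f : Fin N → V.Fun) (f' : Fin M → V.Fun) :
    V.rep (Gra.comp₁ (n + 1) x y) (Fin.append f f') =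
      V.rep x (Fin.cons (V.rep y f) f') := by
  induction x using Gra.mk_induction with
  | zero => simp
  | add x x' h h' => simp only [map_add, LinearMap.add_apply, _root_.add_apply, h, h']
  | smul c x h => simp only [map_smul, LinearMap.smul_apply, _root_.smul_apply, h]
  | mk g =>
    induction y using Gra.mk_induction with
    | zero =>
      rw [map_zero, map_zero]
      refine (MultilinearMap.map_coord_zero _ 0 ?_).symm
      simp
    | add y y' h h' =>
      simp only [map_add, _root_.add_apply, h, h', MultilinearMap.cons_add]
    | smul c y h => simp only [map_smul, _root_.smul_apply, h, MultilinearMap.cons_smul]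
    | mk h =>
      rw [Gra.comp₁, Gra.lift_mk, Gra.lift_mk, Gra.insertGraph_eq_sum_piFinset, map_sum,
        _root_.sum_apply]
      simp only [rep_mk]
      exact V.mulAll_sum_graphOp_append g h f f'

end DarbouxChart
end GraphFlow
end

/-! ### Koszul signs and permutations of the vertices -/

noncomputable section

namespace GraphFlow

namespace DarbouxChart

variable {n : ℕ} (V : DarbouxChart n)

/-- The parity operator of one tensor factor. -/
def parityAt {N : ℕ} (i : Fin N) : Module.End ℝ (⨂[ℝ] _ : Fin N, V.Fun) :=
  PiTensorProduct.map (Function.update (fun _ => 1) i V.parity)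

theorem parityAt_tprod {N : ℕ} (i : Fin N) (f : Fin N → V.Fun) :
    V.parityAt i (PiTensorProduct.tprod ℝ f) =
      PiTensorProduct.tprod ℝ (Function.update f i (V.parity (f i))) := by
  rw [parityAt, PiTensorProduct.map_tprod]
  congr 1
  funext j
  by_cases h : j = i
  · subst h; simp
  · simp [h]

theorem parityAt_mul_map {N : ℕ} (i : Fin N) (G : Fin N → Module.End ℝ V.Fun) (c : ℝ)
    (h : V.parity * G i = c • (G i * V.parity)) :
    V.parityAt i * PiTensorProduct.map G = c • (PiTensorProduct.map G * V.parityAt i) := by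
  unfold parityAt
  rw [← PiTensorProduct.map_mul, ← PiTensorProduct.map_mul]
  set F : Fin N → Module.End ℝ V.Fun := fun k =>
    G k * (Function.update (fun _ => 1) i V.parity : Fin N → Module.End ℝ V.Fun) k with hF
  have key : (fun k => (Function.update (fun _ => 1) i V.parity : Fin N → Module.End ℝ V.Fun) k *
      G k) = Function.update F i (c • F i) := by
    funext k
    by_cases hk : k = i
    · subst hk; simp [hF, h]
    · simp [hF, hk]
  rw [key, PiTensorProduct.map_update_smul, Function.update_eq_self]

theorem parityAt_sq {N : ℕ} (i : Fin N) : V.parityAt i * V.parityAt i = 1 := by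
  refine PiTensorProduct.ext (MultilinearMap.ext fun f => ?_)
  simp [parityAt_tprod, parity_parity]

/-- The operator `(1 + P_i + P_j - P_i P_j) / 2`, which is the sign `(-1)^(|f_i| |f_j|)`. -/
def koszulSign {N : ℕ} (i j : Fin N) : Module.End ℝ (⨂[ℝ] _ : Fin N, V.Fun) :=
  (1 / 2 : ℝ) • (1 + V.parityAt i + V.parityAt j - V.parityAt i * V.parityAt j)

/-- The permutation of the tensor factors without signs. -/
def permFactors {N : ℕ} (s : Equiv.Perm (Fin N)) : Module.End ℝ (⨂[ℝ] _ : Fin N, V.Fun) :=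
  (PiTensorProduct.reindex ℝ (fun _ : Fin N => V.Fun) s).toLinearMap

theorem permFactors_tprod {N : ℕ} (s : Equiv.Perm (Fin N)) (f : Fin N → V.Fun) :
    V.permFactors s (PiTensorProduct.tprod ℝ f) =
      PiTensorProduct.tprod ℝ fun j => f (s.symm j) :=
  PiTensorProduct.reindex_tprod s f

theorem permFactors_mul_map {N : ℕ} (s : Equiv.Perm (Fin N)) (F : Fin N → Module.End ℝ V.Fun) :
    V.permFactors s * PiTensorProduct.map F =
      PiTensorProduct.map (fun j => F (s.symm j)) * V.permFactors s := by
  refine PiTensorProduct.ext (MultilinearMap.ext fun f => ?_)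
  simp [permFactors_tprod, PiTensorProduct.map_tprod]

/-- The exchange of two neighbouring tensor factors with the Koszul sign. -/
def koszulSwap {N : ℕ} (i : Fin N) : Module.End ℝ (⨂[ℝ] _ : Fin (N + 1), V.Fun) :=
  V.koszulSign i.castSucc i.succ * V.permFactors (Equiv.swap i.castSucc i.succ)

theorem koszulSign_mul_of_even {N : ℕ} {i j : Fin N} {X : Module.End ℝ (⨂[ℝ] _ : Fin N, V.Fun)}
    (hi : V.parityAt i * X = (1 : ℝ) • (X * V.parityAt i))
    (hj : V.parityAt j * X = (1 : ℝ) • (X * V.parityAt j)) :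
    V.koszulSign i j * X = X * V.koszulSign i j := by
  rw [one_smul] at hi hj
  simp only [koszulSign, mul_smul_comm, smul_mul_assoc, mul_add, add_mul, mul_sub, sub_mul,
    mul_one, one_mul]
  rw [mul_assoc, hj, ← mul_assoc, hi, mul_assoc X]

/-- An operator that changes the parity of the second factor multiplies the Koszul sign by the
parity of the first one, whence the additional P. The next lemma is the mirror image. -/
theorem sign_mul_of_odd_right {R : Type*} [Ring R] [Algebra ℝ R] {P Q X : R} (hPP : P * P = 1)
    (hP : P * X = (1 : ℝ) • (X * P)) (hQ : Q * X = (-1 : ℝ) • (X * Q)) :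
    ((1 / 2 : ℝ) • (1 + P + Q - P * Q)) * X =
      P * X * ((1 / 2 : ℝ) • (1 + P + Q - P * Q)) := by
  rw [one_smul] at hP
  rw [neg_one_smul] at hQ
  have h : X * P * P = X := by rw [mul_assoc, hPP, mul_one]
  simp only [mul_smul_comm, smul_mul_assoc, mul_add, add_mul, mul_sub, sub_mul,
    mul_one, one_mul]
  rw [mul_assoc, hQ, mul_neg, ← mul_assoc, hP, ← mul_assoc, h]
  congr 1
  abel

theorem sign_mul_of_odd_left {R : Type*} [Ring R] [Algebra ℝ R] {P Q X : R} (hQQ : Q * Q = 1)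
    (hP : P * X = (-1 : ℝ) • (X * P)) (hQ : Q * X = (1 : ℝ) • (X * Q)) :
    ((1 / 2 : ℝ) • (1 + P + Q - P * Q)) * (Q * X) =
      X * ((1 / 2 : ℝ) • (1 + P + Q - P * Q)) := by
  rw [one_smul] at hQ
  rw [neg_one_smul] at hP
  have h : Q * (Q * X) = X := by rw [← mul_assoc, hQQ, one_mul]
  simp only [mul_smul_comm, smul_mul_assoc, mul_add, add_mul, mul_sub, sub_mul,
    mul_one, one_mul]
  rw [mul_assoc P Q (Q * X), h, hQ, ← mul_assoc, hP, neg_mul, mul_assoc X]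
  congr 1
  abel

theorem koszulSign_mul_of_odd_right {N : ℕ} {i j : Fin N}
    {X : Module.End ℝ (⨂[ℝ] _ : Fin N, V.Fun)}
    (hi : V.parityAt i * X = (1 : ℝ) • (X * V.parityAt i))
    (hj : V.parityAt j * X = (-1 : ℝ) • (X * V.parityAt j)) :
    V.koszulSign i j * X = V.parityAt i * X * V.koszulSign i j :=
  sign_mul_of_odd_right (V.parityAt_sq i) hi hj

theorem koszulSign_mul_of_odd_left {N : ℕ} {i j : Fin N}
    {X : Module.End ℝ (⨂[ℝ] _ : Fin N, V.Fun)}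
    (hi : V.parityAt i * X = (-1 : ℝ) • (X * V.parityAt i))
    (hj : V.parityAt j * X = (1 : ℝ) • (X * V.parityAt j)) :
    V.koszulSign i j * (V.parityAt j * X) = X * V.koszulSign i j :=
  sign_mul_of_odd_left (V.parityAt_sq j) hi hj

theorem swap_cases {N : ℕ} (i : Fin N) (j : Fin (N + 1)) :
    j < i.castSucc ∨ j = i.castSucc ∨ j = i.succ ∨ i.succ < j := by
  rw [Fin.lt_def, Fin.lt_def, Fin.ext_iff, Fin.ext_iff, Fin.val_castSucc, Fin.val_succ]
  omega

/-- The operators on the tensor factors whose tensor product is `pdAt j a`. -/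
def pdFactors {N : ℕ} (j : Fin N) (a : Fin V.r) (k : Fin N) : Module.End ℝ V.Fun :=
  if k < j then V.parity ^ V.deg a else if k = j then V.pd a else 1

theorem pdFactors_lt {N : ℕ} {j k : Fin N} (a : Fin V.r) (h : k < j) :
    V.pdFactors j a k = V.parity ^ V.deg a := if_pos h

theorem pdFactors_self {N : ℕ} (j : Fin N) (a : Fin V.r) : V.pdFactors j a j = V.pd a := by
  simp [pdFactors]

theorem pdFactors_gt {N : ℕ} {j k : Fin N} (a : Fin V.r) (h : j < k) :
    V.pdFactors j a k = 1 := by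
  simp [pdFactors, h.not_gt, h.ne']

theorem parity_mul_parity_pow (k : ℕ) :
    V.parity * V.parity ^ k = (1 : ℝ) • (V.parity ^ k * V.parity) := by
  rw [one_smul, ← pow_succ, ← pow_succ']

theorem parity_mul_one : V.parity * (1 : Module.End ℝ V.Fun) = (1 : ℝ) • (1 * V.parity) := by
  simp

theorem koszulSwap_mul_pdAt_of_ne {N : ℕ} (i : Fin N) {j : Fin (N + 1)} (a : Fin V.r)
    (h1 : j ≠ i.castSucc) (h2 : j ≠ i.succ) :
    V.koszulSwap i * V.pdAt j a = V.pdAt j a * V.koszulSwap i := by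
  have hG : (fun k => V.pdFactors j a ((Equiv.swap i.castSucc i.succ).symm k)) =
      V.pdFactors j a := by
    funext k
    rw [Equiv.symm_swap, Equiv.swap_apply_def]
    have hlt : i.castSucc < i.succ := Fin.castSucc_lt_succ
    rcases swap_cases i j with h | h | h | h
    · split_ifs with h3 h4
      · rw [h3, V.pdFactors_gt a h, V.pdFactors_gt a (h.trans hlt)]
      · rw [h4, V.pdFactors_gt a h, V.pdFactors_gt a (h.trans hlt)]
      · rfl
    · exact absurd h h1
    · exact absurd h h2
    · split_ifs with h3 h4
      · rw [h3, V.pdFactors_lt a h, V.pdFactors_lt a (hlt.trans h)]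
      · rw [h4, V.pdFactors_lt a h, V.pdFactors_lt a (hlt.trans h)]
      · rfl
  change _ * PiTensorProduct.map (V.pdFactors j a) = PiTensorProduct.map (V.pdFactors j a) * _
  rw [koszulSwap, mul_assoc, permFactors_mul_map, hG, ← mul_assoc, ← mul_assoc]
  congr 1
  have hP : ∀ k, k ≠ j → V.parity * V.pdFactors j a k =
      (1 : ℝ) • (V.pdFactors j a k * V.parity) := fun k hk => by
    rcases lt_or_gt_of_ne hk with h | h
    · rw [V.pdFactors_lt a h, parity_mul_parity_pow]
    · rw [V.pdFactors_gt a h, parity_mul_one]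
  exact V.koszulSign_mul_of_even (V.parityAt_mul_map _ _ 1 (hP _ h1.symm))
    (V.parityAt_mul_map _ _ 1 (hP _ h2.symm))

theorem parity_mul_pd_of_even {a : Fin V.r} (ha : Even (V.deg a)) :
    V.parity * V.pd a = (1 : ℝ) • (V.pd a * V.parity) := by
  rw [parity_mul_pd, ha.neg_one_pow]

theorem parity_mul_pd_of_odd {a : Fin V.r} (ha : Odd (V.deg a)) :
    V.parity * V.pd a = (-1 : ℝ) • (V.pd a * V.parity) := by
  rw [parity_mul_pd, ha.neg_one_pow]

theorem parityAt_mul_map_eq {N : ℕ} (i : Fin N) (G G' : Fin N → Module.End ℝ V.Fun)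
    (h : G' i = V.parity * G i) (h' : ∀ k, k ≠ i → G' k = G k) :
    PiTensorProduct.map G' = V.parityAt i * PiTensorProduct.map G := by
  rw [parityAt, ← PiTensorProduct.map_mul]
  congr 1
  funext k
  by_cases hk : k = i
  · subst hk; simp [h]
  · simp [hk, h' k hk]

/-- The derivative moves along with the factor on which it acts. When it passes from one neighbour
to the other, `pdAt` gains or loses a parity operator on the factor passed, and for an odd
coordinate this is exactly the change of the Koszul sign. -/
theorem koszulSwap_mul_pdAt {N : ℕ} (i : Fin N) (j : Fin (N + 1)) (a : Fin V.r) :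
    V.koszulSwap i * V.pdAt j a =
      V.pdAt (Equiv.swap i.castSucc i.succ j) a * V.koszulSwap i := by
  have hlt : i.castSucc < i.succ := Fin.castSucc_lt_succ
  have hother : ∀ k, k ≠ i.castSucc → k ≠ i.succ →
      (Equiv.swap i.castSucc i.succ).symm k = k ∧
        V.pdFactors i.castSucc a k = V.pdFactors i.succ a k := fun k h1 h2 => by
    refine ⟨by rw [Equiv.symm_swap, Equiv.swap_apply_of_ne_of_ne h1 h2], ?_⟩
    rcases swap_cases i k with h | h | h | h
    · rw [V.pdFactors_lt a h, V.pdFactors_lt a (h.trans hlt)]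
    · exact absurd h h1
    · exact absurd h h2
    · rw [V.pdFactors_gt a h, V.pdFactors_gt a (hlt.trans h)]
  by_cases h0 : j = i.castSucc
  · subst h0
    rw [Equiv.swap_apply_left]
    change _ * PiTensorProduct.map (V.pdFactors _ a) =
      PiTensorProduct.map (V.pdFactors _ a) * _
    rw [koszulSwap, mul_assoc, permFactors_mul_map, ← mul_assoc, ← mul_assoc]
    congr 1
    set G := fun k => V.pdFactors i.castSucc a ((Equiv.swap i.castSucc i.succ).symm k) with hG
    have hG0 : G i.castSucc = 1 := by
      simp only [hG, Equiv.symm_swap, Equiv.swap_apply_left]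
      exact V.pdFactors_gt a hlt
    have hG1 : G i.succ = V.pd a := by
      simp only [hG, Equiv.symm_swap, Equiv.swap_apply_right]
      exact V.pdFactors_self _ a
    have hGk : ∀ k, k ≠ i.castSucc → V.pdFactors i.succ a k = G k := fun k hk => by
      by_cases hk1 : k = i.succ
      · rw [hk1, hG1, pdFactors_self]
      · rw [← (hother k hk hk1).2]
        exact congrArg (V.pdFactors i.castSucc a) (hother k hk hk1).1.symm
    rcases Nat.even_or_odd (V.deg a) with ha | ha
    · have : V.pdFactors i.succ a = G := funext fun k => by
        by_cases hk : k = i.castSucc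
        · rw [hk, hG0, V.pdFactors_lt a hlt, V.parity_pow_of_even ha]
        · exact hGk k hk
      rw [this]
      exact V.koszulSign_mul_of_even
        (V.parityAt_mul_map _ _ 1 (by rw [hG0, parity_mul_one]))
        (V.parityAt_mul_map _ _ 1 (by rw [hG1, V.parity_mul_pd_of_even ha]))
    -- For odd `a` the target operator differs from the permuted one by a parity operator on the
    -- left neighbour, which the sign rule supplies.
    · rw [V.parityAt_mul_map_eq i.castSucc G (V.pdFactors i.succ a)
        (by rw [hG0, V.pdFactors_lt a hlt, V.parity_pow_of_odd ha, mul_one]) hGk]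
      exact V.koszulSign_mul_of_odd_right
        (V.parityAt_mul_map _ _ 1 (by rw [hG0, parity_mul_one]))
        (V.parityAt_mul_map _ _ _ (by rw [hG1, V.parity_mul_pd_of_odd ha]))
  by_cases h1 : j = i.succ
  · subst h1
    rw [Equiv.swap_apply_right]
    change _ * PiTensorProduct.map (V.pdFactors _ a) =
      PiTensorProduct.map (V.pdFactors _ a) * _
    rw [koszulSwap, mul_assoc, permFactors_mul_map, ← mul_assoc, ← mul_assoc]
    congr 1
    set G := fun k => V.pdFactors i.succ a ((Equiv.swap i.castSucc i.succ).symm k) with hG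
    have hG0 : G i.castSucc = V.pd a := by
      simp only [hG, Equiv.symm_swap, Equiv.swap_apply_left]
      exact V.pdFactors_self _ a
    have hG1 : G i.succ = V.parity ^ V.deg a := by
      simp only [hG, Equiv.symm_swap, Equiv.swap_apply_right]
      exact V.pdFactors_lt a hlt
    have hX1 : V.pdFactors i.castSucc a i.succ = 1 := V.pdFactors_gt a hlt
    have hX0 : V.pdFactors i.castSucc a i.castSucc = V.pd a := V.pdFactors_self _ a
    have hGk : ∀ k, k ≠ i.succ → G k = V.pdFactors i.castSucc a k := fun k hk => by
      by_cases hk1 : k = i.castSucc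
      · rw [hk1, hG0, pdFactors_self]
      · rw [(hother k hk1 hk).2]
        exact congrArg (V.pdFactors i.succ a) (hother k hk1 hk).1
    rcases Nat.even_or_odd (V.deg a) with ha | ha
    · have : G = V.pdFactors i.castSucc a := funext fun k => by
        by_cases hk : k = i.succ
        · rw [hk, hG1, hX1, V.parity_pow_of_even ha]
        · exact hGk k hk
      rw [this]
      exact V.koszulSign_mul_of_even
        (V.parityAt_mul_map _ _ 1 (by rw [hX0, V.parity_mul_pd_of_even ha]))
        (V.parityAt_mul_map _ _ 1 (by rw [hX1, parity_mul_one]))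
    · rw [V.parityAt_mul_map_eq i.succ (V.pdFactors i.castSucc a) G
        (by rw [hG1, hX1, V.parity_pow_of_odd ha, mul_one]) hGk]
      exact V.koszulSign_mul_of_odd_left
        (V.parityAt_mul_map _ _ _ (by rw [hX0, V.parity_mul_pd_of_odd ha]))
        (V.parityAt_mul_map _ _ 1 (by rw [hX1, parity_mul_one]))
  rw [Equiv.swap_apply_of_ne_of_ne h0 h1]
  exact V.koszulSwap_mul_pdAt_of_ne i a h0 h1

theorem koszulSwap_tprod {N : ℕ} (i : Fin N) (f : Fin (N + 1) → V.Fun) :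
    V.koszulSwap i (PiTensorProduct.tprod ℝ f) = (1 / 2 : ℝ) •
      (PiTensorProduct.tprod ℝ (Function.update (Function.update f i.castSucc (f i.succ))
          i.succ (f i.castSucc)) +
        PiTensorProduct.tprod ℝ (Function.update (Function.update f i.castSucc
          (V.parity (f i.succ))) i.succ (f i.castSucc)) +
        PiTensorProduct.tprod ℝ (Function.update (Function.update f i.castSucc (f i.succ))
          i.succ (V.parity (f i.castSucc))) -
        PiTensorProduct.tprod ℝ (Function.update (Function.update f i.castSucc
          (V.parity (f i.succ))) i.succ (V.parity (f i.castSucc)))) := by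
  have hne : i.castSucc ≠ i.succ := (Fin.castSucc_lt_succ).ne
  have hs : (fun j => f ((Equiv.swap i.castSucc i.succ).symm j)) =
      Function.update (Function.update f i.castSucc (f i.succ)) i.succ (f i.castSucc) := by
    funext j
    rw [Equiv.symm_swap, Equiv.swap_apply_def]
    by_cases h1 : j = i.castSucc
    · subst h1; simp [hne]
    · by_cases h2 : j = i.succ
      · subst h2; simp [hne.symm]
      · simp [h1, h2]
  rw [koszulSwap, Module.End.mul_apply, permFactors_tprod, hs, koszulSign]
  simp only [LinearMap.smul_apply, LinearMap.sub_apply, LinearMap.add_apply,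
    Module.End.mul_apply, parityAt_tprod, Module.End.one_apply, Function.update_self,
    Function.update_of_ne hne, Function.update_idem]
  simp only [Function.update_comm hne, Function.update_idem]

/-- Isolates two neighbouring factors: `A` and `B` do not depend on them, so an identity for the
product of two elements can be used inside a longer product. -/
theorem prod_ofFn_update_update {R : Type*} [Ring R] : ∀ {N : ℕ} (i : Fin N)
    (f : Fin (N + 1) → R), ∃ A B : R, ∀ x y, (List.ofFn (Function.update
      (Function.update f i.castSucc x) i.succ y)).prod = A * (x * y) * B
  | 0, i, _ => i.elim0
  | N + 1, i, f => by
    refine Fin.cases ?_ (fun i => ?_) i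
    · refine ⟨1, (List.ofFn fun j : Fin N => f j.succ.succ).prod, fun x y => ?_⟩
      rw [List.ofFn_succ, List.ofFn_succ, List.prod_cons, List.prod_cons, one_mul, mul_assoc]
      simp [Function.update_of_ne, Fin.ext_iff]
    · obtain ⟨A, B, h⟩ := prod_ofFn_update_update i fun j => f j.succ
      refine ⟨f 0 * A, B, fun x y => ?_⟩
      rw [List.ofFn_succ, List.prod_cons, mul_assoc, mul_assoc, ← mul_assoc A, ← h]
      have h1 : (fun j : Fin (N + 1) => Function.update (Function.update f
          (Fin.castSucc i.succ) x) (Fin.succ i.succ) y j.succ) =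
          Function.update (Function.update (fun j => f j.succ) i.castSucc x) i.succ y := by
        rw [← Fin.succ_castSucc]
        have h2 := Function.update_comp_eq_of_injective (Function.update f i.castSucc.succ x)
          (Fin.succ_injective (N + 1)) i.succ y
        have h3 := Function.update_comp_eq_of_injective f (Fin.succ_injective (N + 1))
          i.castSucc x
        exact h2.trans (congrArg (fun F => Function.update F i.succ y) h3)
      rw [h1]
      simp [Function.update_of_ne, Fin.ext_iff]

theorem mulAll_comp_koszulSwap {N : ℕ} (i : Fin N) :
    V.mulAll (N + 1) ∘ₗ V.koszulSwap i = V.mulAll (N + 1) := by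
  refine PiTensorProduct.ext (MultilinearMap.ext fun f => ?_)
  obtain ⟨A, B, h⟩ := prod_ofFn_update_update i f
  have hf := h (f i.castSucc) (f i.succ)
  rw [Function.update_eq_self, Function.update_eq_self] at hf
  simp only [LinearMap.compMultilinearMap_apply, LinearMap.comp_apply, koszulSwap_tprod,
    map_smul, map_add, map_sub, mulAll_tprod, h]
  rw [hf, ← add_mul, ← add_mul, ← sub_mul, ← mul_add, ← mul_add, ← mul_sub,
    ← V.mul_add_mul_eq, mul_add, add_mul, ← two_smul ℝ, smul_smul]
  norm_num

theorem koszulSwap_tprod_of_parity {N : ℕ} (i : Fin N) (f : Fin (N + 1) → V.Fun) (ε δ : ℝ)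
    (h0 : V.parity (f i.castSucc) = ε • f i.castSucc) (h1 : V.parity (f i.succ) = δ • f i.succ) :
    V.koszulSwap i (PiTensorProduct.tprod ℝ f) = ((1 + ε + δ - ε * δ) / 2) •
      PiTensorProduct.tprod ℝ fun j => f (Equiv.swap i.castSucc i.succ j) := by
  have hne : i.castSucc ≠ i.succ := (Fin.castSucc_lt_succ).ne
  have hs : (fun j => f (Equiv.swap i.castSucc i.succ j)) =
      Function.update (Function.update f i.castSucc (f i.succ)) i.succ (f i.castSucc) := by
    funext j
    rw [Equiv.swap_apply_def]
    by_cases h1 : j = i.castSucc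
    · subst h1; simp [hne]
    · by_cases h2 : j = i.succ
      · subst h2; simp [hne.symm]
      · simp [h1, h2]
  have hsmul : ∀ x y : V.Fun, ∀ c d : ℝ, PiTensorProduct.tprod ℝ (Function.update
      (Function.update f i.castSucc (c • x)) i.succ (d • y)) = (c * d) •
        PiTensorProduct.tprod ℝ (Function.update (Function.update f i.castSucc x) i.succ y) := by
    intro x y c d
    rw [MultilinearMap.map_update_smul, Function.update_comm hne, MultilinearMap.map_update_smul,
      Function.update_comm hne.symm, smul_smul, mul_comm]
  have h2 := hsmul (f i.succ) (f i.castSucc) δ 1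
  have h3 := hsmul (f i.succ) (f i.castSucc) 1 ε
  rw [one_smul] at h2 h3
  rw [koszulSwap_tprod, h0, h1, hs, hsmul, h2, h3]
  module

theorem koszulSwap_mul_edgeOp {N : ℕ} (i : Fin N) (j k : Fin (N + 1)) :
    V.koszulSwap i ∘ₗ V.edgeOp j k = V.edgeOp (Equiv.swap i.castSucc i.succ j)
      (Equiv.swap i.castSucc i.succ k) ∘ₗ V.koszulSwap i := by
  rw [← Module.End.mul_eq_comp, ← Module.End.mul_eq_comp]
  unfold edgeOp
  simp only [Finset.mul_sum, Finset.sum_mul, mul_smul_comm, smul_mul_assoc]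
  refine Finset.sum_congr rfl fun a _ => Finset.sum_congr rfl fun b _ => ?_
  rw [← mul_assoc, koszulSwap_mul_pdAt, mul_assoc, koszulSwap_mul_pdAt, ← mul_assoc]

theorem koszulSwap_mul_graphOp {N k : ℕ} (i : Fin N) (g : LGraph (N + 1) k) :
    V.koszulSwap i ∘ₗ V.graphOp g =
      V.graphOp (g.mapVertices (Equiv.swap i.castSucc i.succ)) ∘ₗ V.koszulSwap i :=
  comp_prod_ofFn _ _ _ fun _ => V.koszulSwap_mul_edgeOp _ _ _

theorem repGraph_swap {N k : ℕ} (i : Fin N) (g : LGraph (N + 1) k) (f : Fin (N + 1) → V.Fun)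
    (ε δ : ℝ) (h0 : V.parity (f i.castSucc) = ε • f i.castSucc)
    (h1 : V.parity (f i.succ) = δ • f i.succ) :
    V.repGraph g f = ((1 + ε + δ - ε * δ) / 2) •
      V.repGraph (g.mapVertices (Equiv.swap i.castSucc i.succ))
        fun j => f (Equiv.swap i.castSucc i.succ j) := by
  have h2 := LinearMap.congr_fun (V.koszulSwap_mul_graphOp i g) (PiTensorProduct.tprod ℝ f)
  have h3 := LinearMap.congr_fun (V.mulAll_comp_koszulSwap i)
    (V.graphOp g (PiTensorProduct.tprod ℝ f))
  simp only [LinearMap.comp_apply] at h2 h3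
  rw [repGraph_apply, ← h3, h2, V.koszulSwap_tprod_of_parity i f ε δ h0 h1, map_smul, map_smul]
  rfl

/-- Neighbouring transpositions generate the symmetric group, and exchanging two equal arguments
leaves the tensor unchanged up to its Koszul sign. -/
theorem repGraph_mapVertices {N k : ℕ} (d : ℕ) (g : LGraph N k) (H : V.Fun)
    (hH : V.parity H = (-1 : ℝ) ^ d • H) (σ : Equiv.Perm (Fin N)) :
    (V.repGraph (g.mapVertices σ) fun _ => H) =
      ((Equiv.Perm.sign σ : ℤ) : ℝ) ^ d • V.repGraph g fun _ => H := by
  rcases N with _ | N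
  · have : σ = 1 := Subsingleton.elim _ _
    subst this
    simp only [Equiv.Perm.sign_one, Units.val_one, Int.cast_one, one_pow, one_smul]
    rfl
  have hσ : σ ∈ Submonoid.closure
      (Set.range fun i : Fin N => Equiv.swap i.castSucc i.succ) := by
    rw [Equiv.Perm.mclosure_swap_castSucc_succ]
    trivial
  induction hσ using Submonoid.closure_induction generalizing g with
  | mem x hx =>
    obtain ⟨i, rfl⟩ := hx
    have hne : i.castSucc ≠ i.succ := (Fin.castSucc_lt_succ).ne
    rw [V.repGraph_swap i g (fun _ => H) _ _ hH hH, smul_smul, Equiv.Perm.sign_swap hne]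
    -- With both parities equal to ε = `(-1) ^ d` the Koszul coefficient (1 + 2ε - ε²)/2 equals ε,
    -- since ε² = 1.
    rcases neg_one_pow_eq_or ℝ d with h | h <;> norm_num [h]
  | one =>
    simp only [Equiv.Perm.sign_one, Units.val_one, Int.cast_one, one_pow, one_smul]
    rfl
  | mul x y _ _ hx hy =>
    have : g.mapVertices ⇑(x * y) = (g.mapVertices ⇑y).mapVertices ⇑x := rfl
    rw [this, hx, hy, smul_smul, map_mul, ← mul_pow]
    push_cast
    rfl

theorem rep_permVertices {N k : ℕ} (x : Gra (n + 1) N k) (H : V.Fun)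
    (hH : V.parity H = (-1 : ℝ) ^ (n + 1) • H) (σ : Equiv.Perm (Fin N)) :
    (V.rep (Gra.permVertices (n + 1) σ x) fun _ => H) =
      ((Equiv.Perm.sign σ : ℤ) : ℝ) ^ (n + 1) • V.rep x fun _ => H := by
  induction x using Gra.mk_induction with
  | zero => simp
  | add x y hx hy => simp only [map_add, _root_.add_apply, hx, hy, smul_add]
  | smul c x hx => simp only [map_smul, _root_.smul_apply, hx, smul_comm c]
  | mk g =>
    rw [Gra.permVertices, Gra.lift_mk, rep_mk, rep_mk, V.repGraph_mapVertices _ _ _ hH,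
      Equiv.Perm.sign_inv]

end DarbouxChart
end GraphFlow
end

/-! ### Evaluation of the differential at a Hamiltonian function -/

noncomputable section

namespace GraphFlow

namespace DarbouxChart

variable {n : ℕ} (V : DarbouxChart n)

/-! ### Degrees of graph operators -/

/-- The tensors of degree `s`. -/
def tensorHomogeneous (N : ℕ) (s : ℤ) : Submodule ℝ (⨂[ℝ] _ : Fin N, V.Fun) :=
  Submodule.span ℝ {x | ∃ (f : Fin N → V.Fun) (κ : Fin N → ℤ),
    (∀ i, f i ∈ V.homogeneous (κ i)) ∧ ∑ i, κ i = s ∧ x = PiTensorProduct.tprod ℝ f}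

theorem tprod_mem {N : ℕ} {f : Fin N → V.Fun} {κ : Fin N → ℤ}
    (h : ∀ i, f i ∈ V.homogeneous (κ i)) {s : ℤ} (hs : ∑ i, κ i = s) :
    PiTensorProduct.tprod ℝ f ∈ V.tensorHomogeneous N s :=
  Submodule.subset_span ⟨f, κ, h, hs, rfl⟩

theorem pdAt_mem {N : ℕ} (i : Fin N) (a : Fin V.r) {s : ℤ} {x : ⨂[ℝ] _ : Fin N, V.Fun}
    (hx : x ∈ V.tensorHomogeneous N s) :
    V.pdAt i a x ∈ V.tensorHomogeneous N (s - V.deg a) := by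
  induction hx using Submodule.span_induction with
  | zero => rw [map_zero]; exact zero_mem _
  | add x y _ _ hx hy => rw [map_add]; exact add_mem hx hy
  | smul c x _ hx => rw [map_smul]; exact Submodule.smul_mem _ c hx
  | mem x h =>
    obtain ⟨f, κ, hκ, rfl, rfl⟩ := h
    rw [pdAt_tprod]
    refine V.tprod_mem (κ := fun j => κ j - if j = i then (V.deg a : ℤ) else 0) (fun j => ?_) ?_
    · rcases lt_trichotomy j i with h | h | h
      · simpa [h, h.ne] using V.parity_pow_mem _ (hκ j)
      · subst h
        simpa using V.pd_mem a (hκ j)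
      · simpa [h.not_gt, h.ne'] using hκ j
    · rw [Finset.sum_sub_distrib]
      simp

theorem edgeOp_mem {N : ℕ} (i j : Fin N) {s : ℤ} {x : ⨂[ℝ] _ : Fin N, V.Fun}
    (hx : x ∈ V.tensorHomogeneous N s) :
    V.edgeOp i j x ∈ V.tensorHomogeneous N (s - n) := by
  unfold edgeOp
  simp only [LinearMap.sum_apply, LinearMap.smul_apply, Module.End.mul_apply]
  refine Submodule.sum_mem _ fun a _ => Submodule.sum_mem _ fun b _ => ?_
  by_cases h : V.pairing a b = 0
  · rw [h, zero_smul]; exact zero_mem _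
  · refine Submodule.smul_mem _ _ ?_
    convert V.pdAt_mem i a (V.pdAt_mem j b hx) using 2
    have := V.pairing_degree a b h
    omega

theorem graphOp_mem {N k : ℕ} (g : LGraph N k) {s : ℤ} {x : ⨂[ℝ] _ : Fin N, V.Fun}
    (hx : x ∈ V.tensorHomogeneous N s) :
    V.graphOp g x ∈ V.tensorHomogeneous N (s - k * n) := by
  unfold graphOp
  induction k with
  | zero => simpa using hx
  | succ k ih =>
    rw [List.ofFn_succ, List.prod_cons, Module.End.mul_apply]
    convert V.edgeOp_mem (g 0).1 (g 0).2 (ih fun e => g e.succ) using 2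
    push_cast
    ring

theorem list_prod_mem_homogeneous {N : ℕ} {f : Fin N → V.Fun} {κ : Fin N → ℤ}
    (h : ∀ i, f i ∈ V.homogeneous (κ i)) : (List.ofFn f).prod ∈ V.homogeneous (∑ i, κ i) := by
  induction N with
  | zero => simpa using V.one_mem_homogeneous
  | succ N ih =>
    rw [List.ofFn_succ, List.prod_cons, Fin.sum_univ_succ]
    exact V.mul_mem_homogeneous (h 0) (ih fun i => h i.succ)

theorem mulAll_mem {N : ℕ} {s : ℤ} {x : ⨂[ℝ] _ : Fin N, V.Fun}
    (hx : x ∈ V.tensorHomogeneous N s) : V.mulAll N x ∈ V.homogeneous s := by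
  induction hx using Submodule.span_induction with
  | zero => rw [map_zero]; exact zero_mem _
  | add x y _ _ hx hy => rw [map_add]; exact add_mem hx hy
  | smul c x _ hx => rw [map_smul]; exact Submodule.smul_mem _ c hx
  | mem x h =>
    obtain ⟨f, κ, hκ, rfl, rfl⟩ := h
    rw [mulAll_tprod]
    exact V.list_prod_mem_homogeneous hκ

theorem rep_mem {N k : ℕ} (x : Gra (n + 1) N k) {f : Fin N → V.Fun} {κ : Fin N → ℤ}
    (h : ∀ i, f i ∈ V.homogeneous (κ i)) {s : ℤ} (hs : ∑ i, κ i - k * n = s) :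
    V.rep x f ∈ V.homogeneous s := by
  induction x using Gra.mk_induction with
  | zero => rw [map_zero]; exact zero_mem _
  | add x y hx hy => rw [map_add]; exact add_mem hx hy
  | smul c x hx => rw [map_smul]; exact Submodule.smul_mem _ c hx
  | mk g =>
    rw [rep_mk, repGraph_apply, ← hs]
    exact V.mulAll_mem (V.graphOp_mem g (V.tprod_mem h rfl))

/-- The N + 1 arguments have total degree (N + 1)(n + 1) and each edge lowers it by n. The degree in
the graph complex is normalized so that the result is shifted by d = n + 1. -/
theorem rep_const_mem {N k : ℕ} (x : Gra (n + 1) (N + 1) k) {H : V.Fun}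
    (hH : H ∈ V.homogeneous (n + 1)) :
    (V.rep x fun _ => H) ∈ V.homogeneous (fgcDegree (n + 1) N k + (n + 1)) := by
  refine V.rep_mem x (fun _ => hH) ?_
  simp [fgcDegree]
  ring

theorem parity_of_mem_homogeneous_succ {H : V.Fun} (hH : H ∈ V.homogeneous (n + 1)) :
    V.parity H = (-1 : ℝ) ^ (n + 1) • H := by
  rw [V.parity_of_mem hH, ← zpow_natCast]
  push_cast
  rfl

/-! ### The bracket -/

theorem bracket_apply (f g : V.Fun) : V.bracket f g =
    ∑ a, ∑ b, V.pairing a b • (V.pd a ((V.parity ^ V.deg b) f) * V.pd b g) := by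
  simp [bracket, LinearMap.sum_apply]

theorem repGraph_edge (f g : V.Fun) :
    V.repGraph (fun _ : Fin 1 => ((0, 1) : Fin (1 + 1) × Fin (1 + 1))) ![f, g] =
      V.bracket f g := by
  rw [repGraph_apply, graphOp, List.ofFn_succ, List.ofFn_zero, List.prod_cons, List.prod_nil,
    mul_one, bracket_apply]
  unfold edgeOp
  simp only [LinearMap.sum_apply, LinearMap.smul_apply, Module.End.mul_apply, map_sum, map_smul,
    pdAt_tprod, mulAll_tprod]
  refine Finset.sum_congr rfl fun a _ => Finset.sum_congr rfl fun b _ => ?_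
  simp [List.ofFn_succ]

/-- Exchanging the vertices of the one-edge graph reverses its edge, and the Koszul coefficient is
±1. Only the nonvanishing of the factor is used later, so its value is not recorded. -/
theorem bracket_swap {f g : V.Fun} {k l : ℤ} (hf : f ∈ V.homogeneous k)
    (hg : g ∈ V.homogeneous l) : ∃ c : ℝ, c ≠ 0 ∧ V.bracket f g = c • V.bracket g f := by
  have h1 := V.repGraph_swap 0 (fun _ : Fin 1 => ((0, 1) : Fin (1 + 1) × Fin (1 + 1))) ![f, g]
    ((-1) ^ k) ((-1) ^ l) (V.parity_of_mem hf) (V.parity_of_mem hg)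
  have h2 : LGraph.mapVertices (Equiv.swap (Fin.castSucc 0) (Fin.succ 0))
      (fun _ : Fin 1 => ((0, 1) : Fin (1 + 1) × Fin (1 + 1))) =
      LGraph.flip (fun _ : Fin 1 => ((0, 1) : Fin (1 + 1) × Fin (1 + 1))) 0 := by
    funext e
    fin_cases e
    rfl
  have h3 : (fun j => (![f, g] : Fin (1 + 1) → V.Fun)
      (Equiv.swap (Fin.castSucc (0 : Fin 1)) (Fin.succ 0) j)) = ![g, f] := by
    funext j
    fin_cases j <;> rfl
  rw [h2, h3, V.repGraph_congr _ _ _ (V.graphOp_flip _ 0), _root_.smul_apply, repGraph_edge,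
    repGraph_edge, smul_smul] at h1
  refine ⟨_, ?_, h1⟩
  refine mul_ne_zero ?_ (by simp)
  have hsign : ∀ k : ℤ, (-1 : ℝ) ^ k = 1 ∨ (-1 : ℝ) ^ k = -1 := fun k => by
    rcases Int.even_or_odd k with h | h
    · exact Or.inl h.neg_one_zpow
    · exact Or.inr h.neg_one_zpow
  rcases hsign k with h | h <;> rcases hsign l with h' | h' <;> rw [h, h'] <;> norm_num

/-! ### The pre-Lie product and the differential -/

theorem rep_cast {N N' k k' : ℕ} (hN : N = N') (hk : k = k') (x : Gra (n + 1) N k) (H : V.Fun) :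
    (V.rep (Gra.cast (n + 1) hN hk x) fun _ => H) = V.rep x fun _ => H := by
  subst hN hk
  rfl

-- The signature in the pre-Lie product and the one from renumbering vertices with equal arguments
-- cancel, since `sgn ^ d * sgn ^ d = 1`. All unshuffles give the same term, and only their number
-- remains.
open Classical in
theorem rep_preLie {M N j k : ℕ} (x : Gra (n + 1) (M + 1) j) (y : Gra (n + 1) N k) {H : V.Fun}
    (hH : H ∈ V.homogeneous (n + 1)) : (V.rep (Gra.preLie (n + 1) x y) fun _ => H) =
      ((Finset.univ.filter fun σ : Equiv.Perm (Fin (N + M)) => Gra.IsUnshuffle σ).card : ℝ) •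
        V.rep x (Fin.cons (V.rep y fun _ => H) fun _ => H) := by
  have h1 : (V.rep (Gra.comp₁ (n + 1) x y) fun _ => H) =
      V.rep x (Fin.cons (V.rep y fun _ => H) fun _ => H) := by
    rw [← rep_comp₁]
    congr 1
    funext i
    refine Fin.addCases (fun i => ?_) (fun i => ?_) i <;> simp
  rw [Gra.preLie, LinearMap.sum_apply, LinearMap.sum_apply, map_sum, _root_.sum_apply,
    ← h1, Nat.cast_smul_eq_nsmul, ← Finset.sum_const]
  refine Finset.sum_congr rfl fun σ _ => ?_
  rw [LinearMap.smul_apply, LinearMap.smul_apply, map_smul, _root_.smul_apply,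
    LinearMap.compr₂_apply, V.rep_permVertices _ _ (V.parity_of_mem_homogeneous_succ hH),
    smul_smul, ← mul_pow]
  rcases Int.units_eq_one_or (Equiv.Perm.sign σ) with h | h <;> simp [h]

theorem rep_edge_cons (f g : V.Fun) :
    V.rep (Gra.edge (n + 1)) (Fin.cons f fun _ => g) = V.bracket f g := by
  rw [Gra.edge, rep_mk, ← repGraph_edge]
  congr 1
  funext i
  fin_cases i <;> rfl

theorem card_unshuffles_ne_zero (N M : ℕ) [DecidablePred fun σ : Equiv.Perm (Fin (N + M)) =>
    Gra.IsUnshuffle σ] :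
    (Finset.univ.filter fun σ : Equiv.Perm (Fin (N + M)) => Gra.IsUnshuffle σ).card ≠ 0 := by
  refine Finset.card_ne_zero.2 ⟨1, Finset.mem_filter.2 ⟨Finset.mem_univ _, ?_, ?_⟩⟩
  · intro i j h
    exact h
  · intro i j h
    exact Nat.add_lt_add_left h N

/-- Of the two halves of the commutator, the one inserting `c` in the edge gives the bracket of the
value of `c` with H, and the one inserting the edge in `c` has {H, H} = 0 among its arguments. The
factor is the number of unshuffles times a sign. -/
theorem rep_diff (c : GraFamily (n + 1)) (N k : ℕ) {H : V.Fun} (hH : H ∈ V.homogeneous (n + 1))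
    (hHH : V.bracket H H = 0) : ∃ r : ℝ, r ≠ 0 ∧
    (V.rep (diff (n + 1) c (N + 1) (k + 1)) fun _ => H) =
      r • V.bracket H (V.rep (c N k) fun _ => H) := by
  classical
  obtain ⟨s, hs0, hs⟩ := V.bracket_swap (V.rep_const_mem (c N k) hH) hH
  refine ⟨_, mul_ne_zero (Nat.cast_ne_zero.2 (card_unshuffles_ne_zero (N + 1) 1)) hs0, ?_⟩
  have h0 : (V.rep (Gra.edge (n + 1)) fun _ => H) = 0 := by
    rw [← hHH, ← rep_edge_cons]
    congr 1
    funext i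
    refine Fin.cases ?_ (fun i => ?_) i <;> rfl
  have h1 : V.rep (c N k) (Fin.cons 0 fun _ => H) = 0 :=
    (V.rep (c N k)).map_coord_zero 0 (Fin.cons_zero _ _)
  change (V.rep (Gra.cast (n + 1) _ _ (Gra.bracket (n + 1) (Gra.edge (n + 1)) (c N k)))
    fun _ => H) = _
  rw [rep_cast, Gra.bracket, LinearMap.sub_apply, LinearMap.smul_apply, LinearMap.comp_apply,
    LinearMap.comp_apply, LinearMap.flip_apply, map_sub, map_smul, _root_.sub_apply,
    _root_.smul_apply, rep_cast, rep_cast, V.rep_preLie _ _ hH, V.rep_preLie _ _ hH,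
    rep_edge_cons, hs, h0, h1, smul_zero, smul_zero, sub_zero, smul_smul]

/-- The component of the differential with one more vertex and one more edge depends on the single
component `γ N k`. Closedness therefore holds for each pair of numbers of vertices and edges
separately. -/
theorem bracket_rep_of_mem_cocycles {j : ℤ} {γ : GraFamily (n + 1)}
    (hγ : γ ∈ fgcCocycles (n + 1) j) (N k : ℕ) (H : V.Ham) :
    V.bracket H.1 (V.rep (γ N k) fun _ => H.1) = 0 := by
  obtain ⟨r, hr, h⟩ := V.rep_diff γ N k H.2.1 H.2.2
  have h0 : diff (n + 1) γ = 0 := hγ.2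
  rw [h0] at h
  have h1 : (V.rep ((0 : GraFamily (n + 1)) (N + 1) (k + 1)) fun _ => H.1) = 0 := by
    change (V.rep 0 fun _ => H.1) = 0
    rw [map_zero]
    rfl
  rw [h1] at h
  exact (smul_eq_zero.1 h.symm).resolve_left hr

theorem rep_mem_of_mem_cochains {j : ℤ} {γ : GraFamily (n + 1)}
    (hγ : γ ∈ fgcCochains (n + 1) j) (N k : ℕ) {H : V.Fun} (hH : H ∈ V.homogeneous (n + 1)) :
    (V.rep (γ N k) fun _ => H) ∈ V.homogeneous (j + (n + 1)) := by
  by_cases h : fgcDegree (n + 1) N k = j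
  · rw [← h]
    exact V.rep_const_mem _ hH
  · rw [hγ.2 N k h, map_zero]
    exact zero_mem _

theorem evalAt_mem_of_forall {γ : GraFamily (n + 1)} (hfin : γ ∈ finiteFamilies (n + 1))
    {H : V.Fun} {S : Submodule ℝ V.Fun} (h : ∀ N k, (V.rep (γ N k) fun _ => H) ∈ S) :
    V.evalAt γ H ∈ S := by
  rw [evalAt, finsum_eq_sum _ (V.evalAt_support γ hfin H)]
  exact Submodule.sum_mem _ fun p _ => h p.1 p.2

/-- Exactness is also proved one component at a time, so `η` may have infinitely many components. -/
theorem rep_diff_mem_coboundaries {j : ℤ} {η : GraFamily (n + 1)}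
    (hη : η ∈ fgcCochains (n + 1) (j - 1)) (N k : ℕ) (H : V.Ham) :
    (V.rep (diff (n + 1) η N k) fun _ => H.1) ∈ V.qCoboundaries H (j + (n + 1)) := by
  rcases N with _ | N
  · change (V.rep 0 fun _ => H.1) ∈ _
    rw [map_zero]
    exact zero_mem _
  rcases k with _ | k
  · change (V.rep 0 fun _ => H.1) ∈ _
    rw [map_zero]
    exact zero_mem _
  obtain ⟨r, -, h⟩ := V.rep_diff η N k H.2.1 H.2.2
  rw [h]
  refine Submodule.smul_mem _ r (Submodule.mem_map_of_mem ?_)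
  have := V.rep_mem_of_mem_cochains hη N k H.2.1
  rwa [show j - 1 + ((n : ℤ) + 1) = j + (n + 1) - 1 by ring] at this

end DarbouxChart
end GraphFlow
end

noncomputable section

namespace GraphFlow

/-! ### Maps out of the finite cohomology -/

/-- The cocycles with finitely many components. -/
abbrev finiteCocycles (d : ℕ) (j : ℤ) : Submodule ℝ (fgcCocycles d j) :=
  (finiteFamilies d).comap (fgcCocycles d j).subtype

theorem exists_cocycleClass {d : ℕ} {j : ℤ} (c : finiteCohomology d j) :
    ∃ (γ : fgcCocycles d j) (hγ : (γ : GraFamily d) ∈ finiteFamilies d),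
      cocycleClass γ hγ = c := by
  obtain ⟨c, γ, hγ, rfl⟩ := c
  exact ⟨γ, hγ, rfl⟩

theorem cocycleClass_eq_iff {d : ℕ} {j : ℤ} {γ γ' : fgcCocycles d j}
    {hγ : (γ : GraFamily d) ∈ finiteFamilies d} {hγ' : (γ' : GraFamily d) ∈ finiteFamilies d} :
    cocycleClass γ hγ = cocycleClass γ' hγ' ↔
      ((γ - γ' : fgcCocycles d j) : GraFamily d) ∈ fgcCoboundaries d j :=
  Subtype.ext_iff.trans
    (Submodule.Quotient.eq ((fgcCoboundaries d j).comap (fgcCocycles d j).subtype))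

/-- The finite cohomology is defined as an image inside the full cohomology. A map on finite
cocycles descends to it if it kills every finite cocycle that bounds in the full complex, even when
it bounds no finite cochain. -/
theorem exists_linearMap_of_finiteCocycles {d : ℕ} {j : ℤ} {W : Type*} [AddCommMonoid W]
    [Module ℝ W] (F : finiteCocycles d j →ₗ[ℝ] W)
    (hF : ∀ γ : finiteCocycles d j, (γ.1 : GraFamily d) ∈ fgcCoboundaries d j → F γ = 0) :
    ∃ Φ : finiteCohomology d j →ₗ[ℝ] W, ∀ γ hγ, Φ (cocycleClass γ hγ) = F ⟨γ, hγ⟩ := by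
  -- The value on a class is defined by a chosen finite representative; `key` shows independence of
  -- the choice, and linearity follows from it.
  choose γ hγ hc using exists_cocycleClass (d := d) (j := j)
  have key : ∀ (c : finiteCohomology d j) (γ' : finiteCocycles d j),
      cocycleClass γ'.1 γ'.2 = c → F ⟨γ c, hγ c⟩ = F γ' := fun c γ' h => by
    have h1 := cocycleClass_eq_iff.1 ((hc c).trans h.symm)
    have h2 := hF (⟨γ c, hγ c⟩ - γ') h1
    rw [← sub_add_cancel (⟨γ c, hγ c⟩ : finiteCocycles d j) γ', map_add, h2, zero_add]
  refine ⟨{ toFun := fun c => F ⟨γ c, hγ c⟩, map_add' := fun c c' => ?_,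
            map_smul' := fun r c => ?_ }, fun γ' hγ' => key _ ⟨γ', hγ'⟩ rfl⟩
  · rw [← map_add]
    refine key _ _ ?_
    conv_rhs => rw [← hc c, ← hc c']
    rfl
  · rw [← map_smul]
    refine key _ _ ?_
    conv_rhs => rw [← hc c]
    rfl

/-- The family of graphs with one more, isolated, vertex. -/
def addVertex {d : ℕ} (c : GraFamily d) : GraFamily d
  | 0, _ => 0
  | N + 1, k => Gra.cast d rfl (Nat.zero_add k)
      (Gra.comp₁ d (Gra.mk d (Fin.elim0 : LGraph (1 + 1) 0)) (c N k))

/-! ### The flow maps Φ and Φ₀ -/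

namespace DarbouxChart

variable {n : ℕ} (V : DarbouxChart n)

theorem rep_isolated (f g : V.Fun) :
    V.rep (Gra.mk (n + 1) (Fin.elim0 : LGraph (1 + 1) 0)) (Fin.cons f fun _ => g) = f * g := by
  rw [rep_mk, repGraph_apply, graphOp, List.ofFn_zero, List.prod_nil, Module.End.one_apply,
    mulAll_tprod]
  simp [List.ofFn_succ]

/-- The graph is inserted in one of two isolated vertices and the other one contributes a factor H.
No symmetrization is needed, because universal flows allow arbitrary elements of the graph operad.
-/
theorem rep_addVertex (c : GraFamily (n + 1)) (N k : ℕ) (H : V.Fun) :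
    (V.rep (addVertex c (N + 1) k) fun _ => H) = (V.rep (c N k) fun _ => H) * H := by
  change (V.rep (Gra.cast (n + 1) _ _ _) fun _ => H) = _
  rw [rep_cast, ← rep_isolated, ← rep_comp₁]
  congr 1
  funext i
  refine Fin.addCases (fun i => ?_) (fun i => ?_) i <;> simp

theorem addVertex_mem {d : ℕ} {c : GraFamily d} (hc : c ∈ finiteFamilies d) :
    addVertex c ∈ finiteFamilies d := by
  refine (Set.Finite.image (fun p : ℕ × ℕ => (p.1 + 1, p.2)) hc).subset ?_
  rintro ⟨N, k⟩ h
  rcases N with _ | N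
  · exact absurd rfl h
  · refine ⟨(N, k), fun h0 => h ?_, rfl⟩
    change Gra.cast d _ _ (Gra.comp₁ d _ (c N k)) = 0
    change c N k = 0 at h0
    rw [h0, map_zero, map_zero]

theorem evalAt_addVertex {c : GraFamily (n + 1)} (hc : c ∈ finiteFamilies (n + 1)) (H : V.Fun) :
    V.evalAt (addVertex c) H = V.evalAt c H * H := by
  let e : ℕ × ℕ ↪ ℕ × ℕ := ⟨fun p => (p.1 + 1, p.2), fun p q h => by
    simpa [Prod.ext_iff] using h⟩
  have h1 := V.evalAt_support c hc H
  rw [evalAt, finsum_eq_sum_of_support_subset (s := h1.toFinset.map e), evalAt,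
    finsum_eq_sum _ h1, Finset.sum_map, Finset.sum_mul]
  · exact Finset.sum_congr rfl fun p _ => V.rep_addVertex c p.1 p.2 H
  · rintro ⟨N, k⟩ h
    rw [Function.mem_support] at h
    rcases N with _ | N
    · refine absurd ?_ h
      change (V.rep 0 fun _ => H) = 0
      rw [map_zero]
      rfl
    · rw [Finset.coe_map]
      refine ⟨(N, k), ?_, rfl⟩
      rw [Set.Finite.coe_toFinset, Function.mem_support]
      intro h0
      refine h ((V.rep_addVertex c N k H).trans ?_)
      change (V.rep (c N k) fun _ => H) = 0 at h0
      rw [h0, zero_mul]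

theorem mul_comm_of_mem_zero {x : V.Fun} (hx : x ∈ V.homogeneous 0) (y : V.Fun) :
    x * y = y * x := by
  have h := V.mul_add_mul_eq x y
  have h' : y * x + V.parity y * x + y * x - V.parity y * x = y * x + y * x := by abel
  rw [V.parity_of_mem hx, zpow_zero, one_smul, h', ← two_smul ℝ, ← two_smul ℝ] at h
  exact smul_right_injective _ two_ne_zero h

theorem bracket_mul {x : V.Fun} (hx : x ∈ V.homogeneous 0) (f g : V.Fun) :
    V.bracket f (x * g) = V.bracket f x * g + x * V.bracket f g := by
  have hp : ∀ k, (V.parity ^ k) x = x := fun k => by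
    induction k with
    | zero => rfl
    | succ k ih => rw [pow_succ', Module.End.mul_apply, ih, V.parity_of_mem hx, zpow_zero,
        one_smul]
  simp only [bracket_apply, Finset.sum_mul, Finset.mul_sum, ← Finset.sum_add_distrib]
  refine Finset.sum_congr rfl fun a _ => Finset.sum_congr rfl fun b _ => ?_
  rw [pd_mul, hp, mul_add, smul_add, ← mul_assoc, ← mul_assoc, ← V.mul_comm_of_mem_zero hx,
    smul_mul_assoc, mul_smul_comm, mul_assoc x]

theorem mul_mem_qCocycles (H : V.Ham) {x : V.Fun} (hx : x ∈ V.homogeneous 0)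
    (hHx : V.bracket H.1 x = 0) : x * H.1 ∈ V.qCocycles H (n + 1) := by
  refine ⟨?_, ?_⟩
  · have := V.mul_mem_homogeneous hx H.2.1
    rwa [zero_add] at this
  · change V.bracket H.1 (x * H.1) = 0
    rw [V.bracket_mul hx, hHx, H.2.2, zero_mul, mul_zero, add_zero]

theorem rep_mem_zero {γ : GraFamily (n + 1)}
    (hγ : γ ∈ fgcCocycles (n + 1) (-((n : ℤ) + 1))) (N k : ℕ) (H : V.Ham) :
    (V.rep (γ N k) fun _ => H.1) ∈ V.homogeneous 0 := by
  have := V.rep_mem_of_mem_cochains hγ.1 N k H.2.1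
  rwa [neg_add_cancel] at this

theorem evalAt_conformal {γ : GraFamily (n + 1)}
    (hγ : γ ∈ fgcCocycles (n + 1) (-((n : ℤ) + 1))) (hfin : γ ∈ finiteFamilies (n + 1))
    (H : V.Ham) : V.evalAt γ H.1 ∈ V.homogeneous 0 ∧ V.bracket H.1 (V.evalAt γ H.1) = 0 :=
  V.evalAt_mem_of_forall (S := V.homogeneous 0 ⊓ LinearMap.ker (V.bracket H.1)) hfin fun N k =>
    ⟨V.rep_mem_zero hγ N k H, V.bracket_rep_of_mem_cocycles hγ N k H⟩

theorem evalAt_mem_qCocycles {γ : GraFamily (n + 1)} (hγ : γ ∈ fgcCocycles (n + 1) 0)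
    (hfin : γ ∈ finiteFamilies (n + 1)) (H : V.Ham) :
    V.evalAt γ H.1 ∈ V.qCocycles H (n + 1) :=
  V.evalAt_mem_of_forall hfin fun N k =>
    ⟨by simpa using V.rep_mem_of_mem_cochains hγ.1 N k H.2.1,
      V.bracket_rep_of_mem_cocycles hγ N k H⟩

theorem evalAt_coboundary_conformal {γ : GraFamily (n + 1)}
    (hγ : γ ∈ fgcCoboundaries (n + 1) (-((n : ℤ) + 1))) (H : V.Ham) :
    V.evalAt γ H.1 = 0 := by
  obtain ⟨η, hη, rfl⟩ := hγ
  refine finsum_eq_zero_of_forall_eq_zero fun p => ?_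
  -- The exact functions of degree 0 are images of functions of degree -1, which are zero.
  have hbot : V.qCoboundaries H (-((n : ℤ) + 1) + (n + 1)) = ⊥ :=
    (congrArg (Submodule.map (V.bracket H.1)) (V.homogeneous_of_neg (by omega))).trans
      (Submodule.map_bot _)
  exact (Submodule.mem_bot ℝ).1 (hbot ▸ V.rep_diff_mem_coboundaries hη p.1 p.2 H)

theorem evalAt_coboundary {γ : GraFamily (n + 1)} (hγ : γ ∈ fgcCoboundaries (n + 1) 0)
    (hfin : γ ∈ finiteFamilies (n + 1)) (H : V.Ham) :
    V.evalAt γ H.1 ∈ V.qCoboundaries H (n + 1) := by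
  obtain ⟨η, hη, rfl⟩ := hγ
  refine V.evalAt_mem_of_forall hfin fun N k => ?_
  simpa using V.rep_diff_mem_coboundaries hη N k H

theorem evalAt_addVertex_mem {γ : GraFamily (n + 1)}
    (hγ : γ ∈ fgcCocycles (n + 1) (-((n : ℤ) + 1))) (hfin : γ ∈ finiteFamilies (n + 1))
    (H : V.Ham) : V.evalAt (addVertex γ) H.1 ∈ V.qCocycles H (n + 1) := by
  rw [V.evalAt_addVertex hfin]
  exact V.mul_mem_qCocycles H (V.evalAt_conformal hγ hfin H).1 (V.evalAt_conformal hγ hfin H).2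

/-- The flow of a cocycle of degree zero. -/
def hamiltonianFlow : finiteCocycles (n + 1) 0 →ₗ[ℝ] V.HFlow where
  toFun γ := ⟨fun H => Submodule.Quotient.mk
      ⟨V.evalAt γ.1 H.1, V.evalAt_mem_qCocycles γ.1.2 γ.2 H⟩,
    ⟨γ.1, γ.2, fun W H => W.evalAt_mem_qCocycles γ.1.2 γ.2 H, fun _ => ⟨_, rfl⟩⟩⟩
  map_add' γ γ' := Subtype.ext <| funext fun H =>
    congrArg Submodule.Quotient.mk (Subtype.ext (V.evalAt_add _ _ γ.2 γ'.2 H.1))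
  map_smul' r γ := Subtype.ext <| funext fun H =>
    congrArg Submodule.Quotient.mk (Subtype.ext (V.evalAt_smul r _ γ.2 H.1))

/-- The conformal flow of a cocycle of degree `-d`. -/
def conformalFlow : finiteCocycles (n + 1) (-((n : ℤ) + 1)) →ₗ[ℝ] V.cHFlow where
  toFun γ := ⟨⟨fun H => Submodule.Quotient.mk ⟨V.evalAt γ.1 H.1 * H.1,
      V.mul_mem_qCocycles H (V.evalAt_conformal γ.1.2 γ.2 H).1 (V.evalAt_conformal γ.1.2 γ.2 H).2⟩,
    ⟨addVertex γ.1, addVertex_mem γ.2, fun W H => W.evalAt_addVertex_mem γ.1.2 γ.2 H,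
      fun H => ⟨V.evalAt_addVertex_mem γ.1.2 γ.2 H, congrArg Submodule.Quotient.mk
        (Subtype.ext (V.evalAt_addVertex γ.2 H.1).symm)⟩⟩⟩,
    ⟨fun H => V.evalAt γ.1 H.1, fun H => ⟨(V.evalAt_conformal γ.1.2 γ.2 H).1,
      (V.evalAt_conformal γ.1.2 γ.2 H).2, _, rfl⟩⟩⟩
  map_add' γ γ' := Subtype.ext <| Subtype.ext <| funext fun H =>
    congrArg Submodule.Quotient.mk (Subtype.ext (by
      have := V.evalAt_add _ _ γ.2 γ'.2 H.1
      exact (congrArg (· * H.1) this).trans (add_mul _ _ _)))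
  map_smul' r γ := Subtype.ext <| Subtype.ext <| funext fun H =>
    congrArg Submodule.Quotient.mk (Subtype.ext (by
      have := V.evalAt_smul r _ γ.2 H.1
      exact (congrArg (· * H.1) this).trans (smul_mul_assoc _ _ _)))

theorem IsClassOf.unique {H : V.Ham} {k : ℤ} {f : V.Fun} {c c' : V.QCohomology H k}
    (h : V.IsClassOf f c) (h' : V.IsClassOf f c') : c = c' := by
  obtain ⟨_, rfl⟩ := h
  obtain ⟨_, rfl⟩ := h'
  rfl

theorem existsUnique_hamiltonianFlowMap :
    ∃! Φ : finiteCohomology (n + 1) 0 →ₗ[ℝ] V.HFlow, V.IsHamiltonianFlowMap Φ := by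
  have hF : ∀ γ : finiteCocycles (n + 1) 0, (γ.1 : GraFamily (n + 1)) ∈
      fgcCoboundaries (n + 1) 0 → V.hamiltonianFlow γ = 0 := fun γ hγ =>
    Subtype.ext <| funext fun H => (Submodule.Quotient.mk_eq_zero _).2
      (V.evalAt_coboundary hγ γ.2 H)
  obtain ⟨Φ, hΦ⟩ := exists_linearMap_of_finiteCocycles (d := n + 1) (j := 0)
    (W := V.HFlow) V.hamiltonianFlow hF
  refine ⟨Φ, fun γ hγ H => ?_, fun Φ' hΦ' => LinearMap.ext fun c => ?_⟩
  · rw [hΦ]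
    exact ⟨_, rfl⟩
  · obtain ⟨γ, hγ, rfl⟩ := exists_cocycleClass c
    refine Subtype.ext <| funext fun H => IsClassOf.unique V (hΦ' γ hγ H) ?_
    rw [hΦ]
    exact ⟨_, rfl⟩

theorem existsUnique_conformalFlowMap :
    ∃! Φ : finiteCohomology (n + 1) (-((n : ℤ) + 1)) →ₗ[ℝ] V.cHFlow,
      V.IsConformalFlowMap Φ := by
  have hF : ∀ γ : finiteCocycles (n + 1) (-((n : ℤ) + 1)), (γ.1 : GraFamily (n + 1)) ∈
      fgcCoboundaries (n + 1) (-((n : ℤ) + 1)) → V.conformalFlow γ = 0 := fun γ hγ =>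
    Subtype.ext <| Subtype.ext <| funext fun H => (Submodule.Quotient.mk_eq_zero _).2 (by
      change V.evalAt γ.1 H.1 * H.1 ∈ V.qCoboundaries H (n + 1)
      rw [V.evalAt_coboundary_conformal hγ H, zero_mul]
      exact zero_mem _)
  obtain ⟨Φ, hΦ⟩ := exists_linearMap_of_finiteCocycles (d := n + 1)
    (j := -((n : ℤ) + 1)) (W := V.cHFlow) V.conformalFlow hF
  refine ⟨Φ, fun γ hγ H => ?_, fun Φ' hΦ' => LinearMap.ext fun c => ?_⟩
  · rw [hΦ]
    exact ⟨_, rfl⟩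
  · obtain ⟨γ, hγ, rfl⟩ := exists_cocycleClass c
    refine Subtype.ext <| Subtype.ext <| funext fun H => IsClassOf.unique V (hΦ' γ hγ H) ?_
    rw [hΦ]
    exact ⟨_, rfl⟩

end DarbouxChart
end GraphFlow
end

/-! ### The cocycle condition for three vertices and three edges, d = 3 -/

noncomputable section

namespace GraphFlow

namespace Gra

instance decidableIsUnshuffle {p q : ℕ} (σ : Equiv.Perm (Fin (p + q))) :
    Decidable (IsUnshuffle σ) :=
  inferInstanceAs (Decidable ((∀ i j : Fin p, i < j →
    σ⁻¹ (Fin.castAdd q i) < σ⁻¹ (Fin.castAdd q j)) ∧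
      ∀ i j : Fin q, i < j → σ⁻¹ (Fin.natAdd p i) < σ⁻¹ (Fin.natAdd p j)))

/-- Replaces the classical decision procedure for unshuffles by a computable one, so that sums over
unshuffles can be handled by `decide`. -/
theorem preLie_apply (d : ℕ) {M N j k : ℕ} (x : Gra d (M + 1) j) (y : Gra d N k) :
    preLie d x y = ∑ σ : Equiv.Perm (Fin (N + M)) with IsUnshuffle σ,
      ((Equiv.Perm.sign σ : ℤ) : ℝ) ^ d • permVertices d σ (comp₁ d x y) := by
  classical
  rw [preLie, LinearMap.sum_apply, LinearMap.sum_apply]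
  refine Finset.sum_congr ?_ fun _ _ => rfl
  ext σ
  simp

/-- The product over the edges of a graph of the values of the antisymmetrization of a weight. -/
def weightGraph {N k : ℕ} (w : Fin N → Fin N → ℤ) (g : LGraph N k) : ℤ :=
  ∏ e, (w (g e).1 (g e).2 - w (g e).2 (g e).1)

theorem weightGraph_flip {N k : ℕ} (w : Fin N → Fin N → ℤ) (g : LGraph N k) (e : Fin k) :
    weightGraph w (g.flip e) = -weightGraph w g := by
  unfold weightGraph
  rw [← Finset.mul_prod_erase _ _ (Finset.mem_univ e),
    ← Finset.mul_prod_erase _ (fun e => w (g e).1 (g e).2 - w (g e).2 (g e).1)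
      (Finset.mem_univ e), ← neg_mul]
  congr 1
  · simp [LGraph.flip]
  · refine Finset.prod_congr rfl fun e' he' => ?_
    simp [LGraph.flip, Function.update_of_ne (Finset.ne_of_mem_erase he')]

/-- The linear map on `Gra 3` given by an antisymmetric weight of the edges. -/
def weight {N k : ℕ} (w : Fin N → Fin N → ℤ) : Gra 3 N k →ₗ[ℝ] ℝ :=
  lift (fun g => (weightGraph w g : ℝ))
    (fun g e => by rw [weightGraph_flip]; norm_num)
    (fun g σ => by
      have h : weightGraph w (g.permEdges σ) = weightGraph w g :=
        Equiv.prod_comp σ fun e => w (g e).1 (g e).2 - w (g e).2 (g e).1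
      rw [h]
      rcases Int.units_eq_one_or (Equiv.Perm.sign σ) with h | h <;> norm_num [h])

theorem weight_mk {N k : ℕ} (w : Fin N → Fin N → ℤ) (g : LGraph N k) :
    weight w (mk 3 g) = weightGraph w g := lift_mk _ _ _ _

theorem weight_congr {N k : ℕ} {w w' : Fin N → Fin N → ℤ}
    (h : ∀ i j, w i j - w j i = w' i j - w' j i) (x : Gra 3 N k) : weight w x = weight w' x := by
  have : weight (k := k) w = weight w' := ext_mk fun g => by
    rw [weight_mk, weight_mk, weightGraph, weightGraph]
    simp only [h]
  rw [this]

theorem weight_permVertices {N k : ℕ} (w : Fin N → Fin N → ℤ) (σ : Equiv.Perm (Fin N))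
    (x : Gra 3 N k) :
    weight w (permVertices 3 σ x) = weight (fun i j => w (σ⁻¹ i) (σ⁻¹ j)) x := by
  have : weight (k := k) w ∘ₗ permVertices 3 σ = weight (fun i j => w (σ⁻¹ i) (σ⁻¹ j)) :=
    ext_mk fun g => by
      rw [LinearMap.comp_apply, permVertices, lift_mk, weight_mk, weight_mk]
      rfl
  exact LinearMap.congr_fun this x

/-- The weight induced on the quotient by a map of vertices. -/
def pushWeight {N N' : ℕ} (φ : Fin N → Fin N') (w : Fin N → Fin N → ℤ) (u v : Fin N') : ℤ :=
  ∑ i with φ i = u, ∑ j with φ j = v, w i j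

/-- A weight is a product over the edges, so summing over reconnections edge by edge replaces the
weight of each outer edge by a sum over the fibres of the collapse. Weights thus evaluate insertions
without listing the resulting graphs. -/
theorem weight_comp₁ {M N j k : ℕ} (w : Fin (N + M) → Fin (N + M) → ℤ) (x : Gra 3 (M + 1) j)
    (y : Gra 3 N k) : weight w (comp₁ 3 x y) =
      weight (pushWeight (collapse M N) w) x *
        weight (fun i j => w (Fin.castAdd M i) (Fin.castAdd M j)) y := by
  induction x using mk_induction with
  | zero => simp
  | add x x' h h' => simp only [map_add, LinearMap.add_apply, h, h', add_mul]
  | smul c x h => simp only [map_smul, LinearMap.smul_apply, h, smul_mul_assoc]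
  | mk g =>
    induction y using mk_induction with
    | zero => simp
    | add y y' h h' => simp only [map_add, h, h', mul_add]
    | smul c y h => simp only [map_smul, h, mul_smul_comm]
    | mk h =>
      rw [comp₁, lift_mk, lift_mk, insertGraph_eq_sum_piFinset, map_sum, weight_mk, weight_mk]
      simp only [weight_mk]
      rw [← Int.cast_sum, ← Int.cast_mul]
      congr 1
      have h1 : ∀ p, pushWeight (collapse M N) w p.1 p.2 - pushWeight (collapse M N) w p.2 p.1 =
          ∑ q ∈ fiber (collapse M N) p, (w q.1 q.2 - w q.2 q.1) := fun p => by
        have hf : fiber (collapse M N) p =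
            (Finset.univ.filter fun u => collapse M N u = p.1) ×ˢ
              (Finset.univ.filter fun u => collapse M N u = p.2) := by
          ext q
          simp [fiber, Prod.ext_iff]
        rw [hf, Finset.sum_sub_distrib, Finset.sum_product, Finset.sum_product_right]
        rfl
      have h2 : weightGraph (pushWeight (collapse M N) w) g =
          ∑ g' ∈ Fintype.piFinset fun e => fiber (collapse M N) (g e), weightGraph w g' := by
        unfold weightGraph
        simp only [h1]
        exact Finset.prod_univ_sum _ _
      rw [h2, Finset.sum_mul]
      refine Finset.sum_congr rfl fun g' _ => ?_
      unfold weightGraph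
      rw [Fin.prod_univ_add]
      simp [LGraph.mapVertices]

theorem weight_edge (w : Fin (1 + 1) → Fin (1 + 1) → ℤ) :
    weight w (edge 3) = (w 0 1 - w 1 0 : ℤ) := by
  rw [edge, weight_mk, weightGraph]
  simp

/-- The weight of a single edge. -/
def edgeWeight {N : ℕ} (p q : Fin N) (i j : Fin N) : ℤ := if i = p ∧ j = q then 1 else 0

/-- The weight of two disjoint edges on four vertices. -/
def twoEdgeWeight (i j : Fin 4) : ℤ := edgeWeight 0 1 i j + edgeWeight 2 3 i j

theorem edgeWeight_perm {N : ℕ} (σ : Equiv.Perm (Fin N)) (p q i j : Fin N) :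
    edgeWeight p q (σ⁻¹ i) (σ⁻¹ j) = edgeWeight (σ p) (σ q) i j := by
  simp only [edgeWeight, Equiv.Perm.inv_eq_iff_eq]

section Antisymmetric

variable {x : Gra 3 3 3}

theorem weight_edgeWeight_perm
    (hx : ∀ σ : Equiv.Perm (Fin 3), permVertices 3 σ x = ((Equiv.Perm.sign σ : ℤ) : ℝ) ^ 3 • x)
    (σ : Equiv.Perm (Fin 3)) (p q : Fin 3) :
    weight (edgeWeight (σ p) (σ q)) x =
      ((Equiv.Perm.sign σ : ℤ) : ℝ) ^ 3 * weight (edgeWeight p q) x := by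
  have h := weight_permVertices (edgeWeight p q) σ x
  rw [hx, map_smul, smul_eq_mul] at h
  rw [h]
  simp only [edgeWeight_perm]

theorem exists_perm_of_ne : ∀ p q : Fin 3, p ≠ q →
    ∃ σ : Equiv.Perm (Fin 3), σ 0 = p ∧ σ 1 = q := by
  decide

/-- `twoEdgeWeight` sees only graphs whose edges all lie over the pairs {0, 1} and {2, 3}. The
inserted graph occupies three of the four vertices, hence one whole pair and an isolated vertex, and
the outer edge must join the latter to the fourth vertex. Each of the four unshuffles contributes
the weight of three parallel edges. -/
theorem weight_twoEdgeWeight_edge_preLie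
    (hx : ∀ σ : Equiv.Perm (Fin 3), permVertices 3 σ x = ((Equiv.Perm.sign σ : ℤ) : ℝ) ^ 3 • x) :
    weight twoEdgeWeight (preLie 3 (edge 3) x) = 4 * weight (edgeWeight 0 1) x := by
  -- The signature of the unshuffle cancels the orientation sign of the outer edge.
  have h1 : ∀ σ : Equiv.Perm (Fin (3 + 1)), IsUnshuffle (p := 3) (q := 1) σ →
      (Equiv.Perm.sign σ : ℤ) ^ 3 *
        (pushWeight (collapse 1 3) (fun i j => twoEdgeWeight (σ⁻¹ i) (σ⁻¹ j)) 0 1 -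
          pushWeight (collapse 1 3) (fun i j => twoEdgeWeight (σ⁻¹ i) (σ⁻¹ j)) 1 0) = 1 := by
    decide +kernel
  have h2 : ∀ σ : Equiv.Perm (Fin (3 + 1)), IsUnshuffle (p := 3) (q := 1) σ →
      (∀ i j : Fin 3, twoEdgeWeight (σ⁻¹ (Fin.castAdd 1 i)) (σ⁻¹ (Fin.castAdd 1 j)) =
        edgeWeight 0 1 i j) ∨
      ∀ i j : Fin 3, twoEdgeWeight (σ⁻¹ (Fin.castAdd 1 i)) (σ⁻¹ (Fin.castAdd 1 j)) =
        edgeWeight 1 2 i j := by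
    decide +kernel
  have h3 : (Finset.univ.filter fun σ : Equiv.Perm (Fin (3 + 1)) =>
      IsUnshuffle (p := 3) (q := 1) σ).card = 4 := by
    decide +kernel
  have h4 := weight_edgeWeight_perm hx (finRotate 3) 0 1
  rw [show Equiv.Perm.sign (finRotate 3) = 1 by decide] at h4
  have h5 : weight (edgeWeight 1 2) x = weight (edgeWeight 0 1) x := by
    refine Eq.trans ?_ (h4.trans (by simp))
    rfl
  rw [preLie_apply, map_sum]
  refine (Finset.sum_congr rfl fun σ hσ => ?_).trans
    (((Finset.sum_const (weight (edgeWeight 0 1) x)).trans (congrArg (· • _) h3)).trans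
      (nsmul_eq_mul 4 _))
  rw [Finset.mem_filter] at hσ
  have h6 := h1 σ hσ.2
  have h7 : weight (fun i j : Fin 3 => twoEdgeWeight (σ⁻¹ (Fin.castAdd 1 i))
      (σ⁻¹ (Fin.castAdd 1 j))) x = weight (edgeWeight 0 1) x := by
    rcases h2 σ hσ.2 with h | h
    · simp only [h]
    · simp only [h]
      exact h5
  have h8 := congrArg (Int.cast : ℤ → ℝ) h6
  rw [Int.cast_mul, Int.cast_pow, Int.cast_one] at h8
  have h9 := (weight_permVertices twoEdgeWeight σ (comp₁ 3 (edge 3) x)).trans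
    (weight_comp₁ (M := 1) (N := 3) (fun i j => twoEdgeWeight (σ⁻¹ i) (σ⁻¹ j)) (edge 3) x)
  rw [weight_edge, h7] at h9
  rw [map_smul]
  refine (congrArg (_ • ·) h9).trans ?_
  simp only [smul_eq_mul]
  rw [← mul_assoc, h8, one_mul]

/-- Here the inserted edge must itself occupy one of the two pairs, which happens for two of the six
unshuffles, both even; the three edges of `x` then lie over the other pair. -/
theorem weight_twoEdgeWeight_preLie_edge
    (hx : ∀ σ : Equiv.Perm (Fin 3), permVertices 3 σ x = ((Equiv.Perm.sign σ : ℤ) : ℝ) ^ 3 • x) :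
    weight twoEdgeWeight (preLie (M := 2) 3 x (edge 3)) = 2 * weight (edgeWeight 0 1) x := by
  -- If the inserted edge has nonzero weight, its pair collapses to vertex 0, where the weight
  -- antisymmetrizes to zero, and the other pair becomes the vertices 1 and 2.
  have h1 : ∀ σ : Equiv.Perm (Fin (1 + 1 + 2)), IsUnshuffle (p := 1 + 1) (q := 2) σ →
      twoEdgeWeight (σ⁻¹ 0) (σ⁻¹ 1) - twoEdgeWeight (σ⁻¹ 1) (σ⁻¹ 0) = 0 ∨
      ∀ i j : Fin 3,
        pushWeight (collapse 2 (1 + 1)) (fun i j => twoEdgeWeight (σ⁻¹ i) (σ⁻¹ j)) i j -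
        pushWeight (collapse 2 (1 + 1)) (fun i j => twoEdgeWeight (σ⁻¹ i) (σ⁻¹ j)) j i =
          edgeWeight 1 2 i j - edgeWeight 1 2 j i := by
    decide +kernel
  have h2 : ∑ σ : Equiv.Perm (Fin (1 + 1 + 2)) with IsUnshuffle (p := 1 + 1) (q := 2) σ,
      (Equiv.Perm.sign σ : ℤ) ^ 3 *
        (twoEdgeWeight (σ⁻¹ 0) (σ⁻¹ 1) - twoEdgeWeight (σ⁻¹ 1) (σ⁻¹ 0)) = 2 := by
    decide +kernel
  have h4 := weight_edgeWeight_perm hx (finRotate 3) 0 1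
  rw [show Equiv.Perm.sign (finRotate 3) = 1 by decide] at h4
  have h5 : weight (edgeWeight 1 2) x = weight (edgeWeight 0 1) x := by
    refine Eq.trans ?_ (h4.trans (by simp))
    rfl
  have h3 := congrArg (Int.cast : ℤ → ℝ) h2
  rw [Int.cast_sum] at h3
  rw [preLie_apply, map_sum, show (2 : ℝ) = ((2 : ℤ) : ℝ) by norm_num, ← h3, Finset.sum_mul]
  refine Finset.sum_congr rfl fun σ hσ => ?_
  rw [Finset.mem_filter] at hσ
  have h9 := (weight_permVertices twoEdgeWeight σ (comp₁ 3 x (edge 3))).trans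
    (weight_comp₁ (M := 2) (N := 1 + 1) (fun i j => twoEdgeWeight (σ⁻¹ i) (σ⁻¹ j)) x (edge 3))
  rw [weight_edge] at h9
  rw [map_smul]
  refine (congrArg (_ • ·) h9).trans ?_
  simp only [smul_eq_mul]
  rw [Int.cast_mul, Int.cast_pow, mul_assoc]
  congr 1
  have h10 : (twoEdgeWeight (σ⁻¹ (Fin.castAdd 2 (0 : Fin (1 + 1))))
        (σ⁻¹ (Fin.castAdd 2 (1 : Fin (1 + 1)))) - twoEdgeWeight
        (σ⁻¹ (Fin.castAdd 2 (1 : Fin (1 + 1)))) (σ⁻¹ (Fin.castAdd 2 (0 : Fin (1 + 1))))) =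
      twoEdgeWeight (σ⁻¹ 0) (σ⁻¹ 1) - twoEdgeWeight (σ⁻¹ 1) (σ⁻¹ 0) := rfl
  rw [h10, mul_comm]
  rcases h1 σ hσ.2 with h | h
  · rw [h, Int.cast_zero, zero_mul, zero_mul]
  · rw [weight_congr h, h5]

end Antisymmetric

/-- The two halves of the commutator have weights 4w and 2w, which do not cancel. A cocycle of
degree 0 therefore contains no graph with three parallel edges and an isolated vertex. -/
theorem weight_eq_zero_of_mem_cocycles {c : GraFamily 3} (hc : c ∈ fgcCocycles 3 0) {p q : Fin 3}
    (hpq : p ≠ q) : weight (edgeWeight p q) (c 2 3) = 0 := by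
  have hx : ∀ σ : Equiv.Perm (Fin 3),
      permVertices 3 σ (c 2 3) = ((Equiv.Perm.sign σ : ℤ) : ℝ) ^ 3 • c 2 3 := fun σ =>
    hc.1.1 2 3 σ
  obtain ⟨σ, rfl, rfl⟩ := exists_perm_of_ne p q hpq
  rw [weight_edgeWeight_perm hx]
  have h0 : diff 3 c 3 4 = 0 := by
    rw [show diff 3 c = 0 from hc.2]
    rfl
  have h1 : weight (N := 4) (k := 4) twoEdgeWeight (bracket 3 (edge 3) (c 2 3)) = 0 :=
    (congrArg (weight twoEdgeWeight) h0).trans (map_zero _)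
  have h2 : (bracket 3 (edge 3) (c 2 3) : Gra 3 4 4) = preLie 3 (edge 3) (c 2 3) -
      (-1 : ℝ) ^ (fgcDegree 3 1 1 * fgcDegree 3 2 3) •
        (preLie (M := 2) 3 (c 2 3) (edge 3) : Gra 3 4 4) := rfl
  rw [h2, map_sub, map_smul, smul_eq_mul, weight_twoEdgeWeight_edge_preLie hx,
    weight_twoEdgeWeight_preLie_edge hx] at h1
  -- The degrees are 1 and 0, so the commutator is a difference and the equation reads 4w - 2w = 0.
  norm_num [fgcDegree] at h1
  have h3 : weight (edgeWeight 0 1) (c 2 3) = 0 := by linarith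
  rw [h3, mul_zero]

end Gra
end GraphFlow
end

/-! ### The theta graph is a cocycle of degree -3 -/

noncomputable section

namespace GraphFlow

namespace Gra

/-- The graph with two vertices and three parallel edges. -/
def theta : Gra 3 (1 + 1) 3 := mk 3 fun _ => (0, 1)

/-- The graph on three vertices with the given four edges. -/
def fourEdges (p q r s : Fin 3 × Fin 3) : Gra 3 3 4 := mk 3 (![p, q, r, s] : LGraph 3 4)

theorem mk_flip_three {N k : ℕ} (g : LGraph N k) (e : Fin k) :
    mk 3 (g.flip e) = -mk 3 g := by
  rw [mk_flip]
  norm_num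

theorem mk_permEdges_three {N k : ℕ} (g : LGraph N k) (σ : Equiv.Perm (Fin k)) :
    mk 3 (g.permEdges σ) = mk 3 g := by
  rw [mk_permEdges]
  rcases Int.units_eq_one_or (Equiv.Perm.sign σ) with h | h <;> norm_num [h]

theorem fourEdges_flip₀ (p q r s) : fourEdges p.swap q r s = -fourEdges p q r s := by
  rw [fourEdges, fourEdges, ← mk_flip_three _ 0]
  congr 1
  funext e
  fin_cases e <;> rfl

theorem fourEdges_flip₁ (p q r s) : fourEdges p q.swap r s = -fourEdges p q r s := by
  rw [fourEdges, fourEdges, ← mk_flip_three _ 1]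
  congr 1
  funext e
  fin_cases e <;> rfl

theorem fourEdges_flip₂ (p q r s) : fourEdges p q r.swap s = -fourEdges p q r s := by
  rw [fourEdges, fourEdges, ← mk_flip_three _ 2]
  congr 1
  funext e
  fin_cases e <;> rfl

theorem fourEdges_swap₀ (p q r s) : fourEdges p q r s = fourEdges q p r s := by
  rw [fourEdges, fourEdges, ← mk_permEdges_three _ (Equiv.swap 0 1)]
  congr 1
  funext e
  fin_cases e <;> rfl

theorem fourEdges_swap₁ (p q r s) : fourEdges p q r s = fourEdges p r q s := by
  rw [fourEdges, fourEdges, ← mk_permEdges_three _ (Equiv.swap 1 2)]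
  congr 1
  funext e
  fin_cases e <;> rfl

theorem fourEdges_swap₂ (p q r s) : fourEdges p q r s = fourEdges p q s r := by
  rw [fourEdges, fourEdges, ← mk_permEdges_three _ (Equiv.swap 2 3)]
  congr 1
  funext e
  fin_cases e <;> rfl

theorem permVertices_fourEdges (σ : Equiv.Perm (Fin 3)) (p q r s) :
    permVertices 3 σ (fourEdges p q r s) = fourEdges (σ⁻¹ p.1, σ⁻¹ p.2) (σ⁻¹ q.1, σ⁻¹ q.2)
      (σ⁻¹ r.1, σ⁻¹ r.2) (σ⁻¹ s.1, σ⁻¹ s.2) := by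
  rw [fourEdges, permVertices, lift_mk, fourEdges]
  congr 1
  funext e
  fin_cases e <;> rfl

theorem fiber_collapse_zero_one :
    (fiber (collapse 1 (1 + 1)) (0, 1) : Finset (Fin 3 × Fin 3)) = {(0, 2), (1, 2)} := by
  ext p
  revert p
  simp only [fiber, Finset.mem_filter, Finset.mem_univ, true_and]
  decide

theorem comp₁_edge_theta : (comp₁ 3 (edge 3) theta : Gra 3 3 4) =
    fourEdges (0, 2) (0, 1) (0, 1) (0, 1) + fourEdges (1, 2) (0, 1) (0, 1) (0, 1) := by
  have h2 : comp₁ (M := 1) 3 (edge 3) theta = insertGraph 3 (fun _ : Fin 1 => (0, 1))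
    (fun _ : Fin 3 => ((0, 1) : Fin (1 + 1) × Fin (1 + 1))) := by
    rw [comp₁, edge, theta, lift_mk, lift_mk]
  have h3 : Fintype.piFinset (fun _ : Fin 1 => ({(0, 2), (1, 2)} : Finset (Fin 3 × Fin 3))) =
      {fun _ => (0, 2), fun _ => (1, 2)} := by decide
  refine h2.trans ?_
  rw [insertGraph_eq_sum_piFinset]
  simp only [fiber_collapse_zero_one]
  refine (Finset.sum_congr h3 fun _ _ => rfl).trans ?_
  rw [Finset.sum_insert (by decide), Finset.sum_singleton]
  refine congrArg₂ (· + ·) (congrArg (mk 3) ?_) (congrArg (mk 3) ?_) <;>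
  · funext e
    fin_cases e <;> rfl

/-- For d = 3 the order of the edges is irrelevant, so the reconnections of the three parallel edges
are counted by the binomial coefficients 1, 3, 3, 1. -/
theorem comp₁_theta_edge : (comp₁ 3 theta (edge 3) : Gra 3 3 4) =
    fourEdges (0, 2) (0, 2) (0, 2) (0, 1) + (3 : ℝ) • fourEdges (0, 2) (0, 2) (1, 2) (0, 1) +
    (3 : ℝ) • fourEdges (0, 2) (1, 2) (1, 2) (0, 1) + fourEdges (1, 2) (1, 2) (1, 2) (0, 1) := by
  have h2 : comp₁ (M := 1) 3 theta (edge 3) = insertGraph 3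
      (fun _ : Fin 3 => ((0, 1) : Fin (1 + 1) × Fin (1 + 1))) (fun _ : Fin 1 => (0, 1)) := by
    rw [comp₁, edge, theta, lift_mk, lift_mk]
  have h3 : Fintype.piFinset (fun _ : Fin 3 => ({(0, 2), (1, 2)} : Finset (Fin 3 × Fin 3))) =
      {![(0, 2), (0, 2), (0, 2)], ![(0, 2), (0, 2), (1, 2)], ![(0, 2), (1, 2), (0, 2)],
        ![(1, 2), (0, 2), (0, 2)], ![(0, 2), (1, 2), (1, 2)], ![(1, 2), (0, 2), (1, 2)],
        ![(1, 2), (1, 2), (0, 2)], ![(1, 2), (1, 2), (1, 2)]} := by decide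
  have h4 : ∀ p q r : Fin 3 × Fin 3, mk 3 (Fin.append (![p, q, r] : LGraph 3 3)
      (LGraph.mapVertices (Fin.castAdd 1) fun _ : Fin 1 => ((0, 1) : Fin (1 + 1) × Fin (1 + 1)))) =
        fourEdges p q r (0, 1) := fun p q r => by
    refine congrArg (mk 3) ?_
    funext e
    fin_cases e <;> rfl
  refine h2.trans ?_
  rw [insertGraph_eq_sum_piFinset]
  simp only [fiber_collapse_zero_one]
  refine (Finset.sum_congr h3 fun _ _ => rfl).trans ?_
  rw [Finset.sum_insert (by decide), Finset.sum_insert (by decide), Finset.sum_insert (by decide),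
    Finset.sum_insert (by decide), Finset.sum_insert (by decide), Finset.sum_insert (by decide),
    Finset.sum_insert (by decide), Finset.sum_singleton]
  simp only [h4]
  rw [fourEdges_swap₁ (0, 2) (1, 2) (0, 2), fourEdges_swap₀ (1, 2) (0, 2) (0, 2),
    fourEdges_swap₁ (0, 2) (1, 2) (0, 2), fourEdges_swap₀ (1, 2) (0, 2) (1, 2),
    fourEdges_swap₁ (1, 2) (1, 2) (0, 2), fourEdges_swap₀ (1, 2) (0, 2) (1, 2)]
  module

theorem unshuffles_two_one : (Finset.univ.filter fun σ : Equiv.Perm (Fin (2 + 1)) =>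
    IsUnshuffle (p := 2) (q := 1) σ) = {1, Equiv.swap 1 2, Equiv.swap 1 2 * Equiv.swap 0 1} := by
  decide

theorem preLie_two_one {j k : ℕ} (x : Gra 3 (1 + 1) j) (y : Gra 3 (1 + 1) k) :
    (preLie (M := 1) 3 x y : Gra 3 3 (j + k)) = (comp₁ (M := 1) 3 x y : Gra 3 3 (j + k)) -
      permVertices 3 (Equiv.swap (1 : Fin 3) 2) (comp₁ (M := 1) 3 x y : Gra 3 3 (j + k)) +
      permVertices 3 (Equiv.swap (1 : Fin 3) 2 * Equiv.swap 0 1)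
        (comp₁ (M := 1) 3 x y : Gra 3 3 (j + k)) := by
  have h1 : permVertices 3 (1 : Equiv.Perm (Fin 3)) = (LinearMap.id : Gra 3 3 (j + k) →ₗ[ℝ] _) :=
    ext_mk fun g => by
      rw [permVertices, lift_mk]
      rfl
  refine (preLie_apply (M := 1) (N := 1 + 1) 3 x y).trans ?_
  refine (Finset.sum_congr unshuffles_two_one fun _ _ => rfl).trans ?_
  rw [Finset.sum_insert (by decide), Finset.sum_insert (by decide), Finset.sum_singleton,
    show Equiv.Perm.sign (Equiv.swap (1 : Fin (2 + 1)) 2 * Equiv.swap 0 1) = 1 by decide,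
    show Equiv.Perm.sign (Equiv.swap (1 : Fin (2 + 1)) 2) = -1 by decide]
  have h2 : permVertices 3 1 (comp₁ (M := 1) 3 x y) =
    (comp₁ (M := 1) 3 x y : Gra 3 3 (j + k)) := LinearMap.congr_fun h1 _
  rw [h2]
  norm_num
  rw [sub_eq_add_neg]
  module

/-- Written as quartic monomials in the edges 01, 02 and 12, the terms of theta ∘ edge involving all
three edges cancel among the three unshuffles. The other ones are monomials of type (3, 1) and
cancel against edge ∘ theta. -/
theorem bracket_edge_theta : (bracket 3 (edge 3) theta : Gra 3 3 4) = 0 := by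
  have h : (bracket 3 (edge 3) theta : Gra 3 3 4) = preLie (M := 1) 3 (edge 3) theta -
      (-1 : ℝ) ^ (fgcDegree 3 1 1 * fgcDegree 3 1 3) •
        (preLie (M := 1) 3 theta (edge 3) : Gra 3 3 4) := rfl
  have e1 : ((Equiv.swap (1 : Fin 3) 2 * Equiv.swap 0 1)⁻¹ : Equiv.Perm (Fin 3)) 0 = 1 := by decide
  have e2 : ((Equiv.swap (1 : Fin 3) 2 * Equiv.swap 0 1)⁻¹ : Equiv.Perm (Fin 3)) 1 = 2 := by decide
  have e3 : ((Equiv.swap (1 : Fin 3) 2 * Equiv.swap 0 1)⁻¹ : Equiv.Perm (Fin 3)) 2 = 0 := by decide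
  have s1 : ((Equiv.swap (1 : Fin 3) 2)⁻¹ : Equiv.Perm (Fin 3)) 0 = 0 := by decide
  have s2 : ((Equiv.swap (1 : Fin 3) 2)⁻¹ : Equiv.Perm (Fin 3)) 1 = 2 := by decide
  have s3 : ((Equiv.swap (1 : Fin 3) 2)⁻¹ : Equiv.Perm (Fin 3)) 2 = 1 := by decide
  have h1 : (preLie (M := 1) 3 (edge 3) theta : Gra 3 3 4) = _ := preLie_two_one _ _
  have h2 : (preLie (M := 1) 3 theta (edge 3) : Gra 3 3 4) = _ := preLie_two_one _ _
  rw [h, h1, h2]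
  suffices key : ∀ x y : Gra 3 3 4,
      x = fourEdges (0, 2) (0, 1) (0, 1) (0, 1) + fourEdges (1, 2) (0, 1) (0, 1) (0, 1) →
      y = fourEdges (0, 2) (0, 2) (0, 2) (0, 1) +
        (3 : ℝ) • fourEdges (0, 2) (0, 2) (1, 2) (0, 1) +
        (3 : ℝ) • fourEdges (0, 2) (1, 2) (1, 2) (0, 1) +
        fourEdges (1, 2) (1, 2) (1, 2) (0, 1) →
      x - permVertices 3 (Equiv.swap 1 2) x +
          permVertices 3 (Equiv.swap 1 2 * Equiv.swap 0 1) x -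
        (-1 : ℝ) ^ (fgcDegree 3 1 1 * fgcDegree 3 1 3) • (y - permVertices 3 (Equiv.swap 1 2) y +
          permVertices 3 (Equiv.swap 1 2 * Equiv.swap 0 1) y) = 0 from
    key _ _ comp₁_edge_theta comp₁_theta_edge
  rintro _ _ rfl rfl
  simp only [map_add, map_smul, permVertices_fourEdges, e1, e2, e3, s1, s2, s3]
  have f0 : ∀ (i j : Fin 3) (q r s), fourEdges (j, i) q r s = -fourEdges (i, j) q r s :=
    fun i j => fourEdges_flip₀ (i, j)
  have f1 : ∀ (i j : Fin 3) (p r s), fourEdges p (j, i) r s = -fourEdges p (i, j) r s :=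
    fun i j p => fourEdges_flip₁ p (i, j)
  have f2 : ∀ (i j : Fin 3) (p q s), fourEdges p q (j, i) s = -fourEdges p q (i, j) s :=
    fun i j p q => fourEdges_flip₂ p q (i, j)
  -- The degrees 1 and -3 are odd, so the graded commutator is a sum of the two products.
  norm_num [fgcDegree]
  simp only [f0 0 1, f0 0 2, f0 1 2, f1 0 1, f1 0 2, f1 1 2, f2 0 1, f2 0 2, f2 1 2,
    fourEdges_swap₀ (0, 2) (0, 1), fourEdges_swap₀ (1, 2) (0, 1),
    fourEdges_swap₀ (1, 2) (0, 2), fun p => fourEdges_swap₁ p (0, 2) (0, 1),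
    fun p => fourEdges_swap₁ p (1, 2) (0, 1), fun p => fourEdges_swap₁ p (1, 2) (0, 2),
    fun p q => fourEdges_swap₂ p q (0, 2) (0, 1), fun p q => fourEdges_swap₂ p q (1, 2) (0, 1),
    fun p q => fourEdges_swap₂ p q (1, 2) (0, 2)]
  module

/-- Exchanging the two vertices reverses three edges, at the cost of -1 each. -/
theorem permVertices_theta (σ : Equiv.Perm (Fin (1 + 1))) :
    permVertices 3 σ theta = ((Equiv.Perm.sign σ : ℤ) : ℝ) ^ 3 • theta := by
  have h : ∀ σ : Equiv.Perm (Fin (1 + 1)), σ = 1 ∨ σ = Equiv.swap 0 1 := by decide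
  rcases h σ with rfl | rfl
  · rw [theta, permVertices, lift_mk]
    simp
    rfl
  · have h1 : LGraph.mapVertices ((Equiv.swap 0 1)⁻¹ : Equiv.Perm (Fin (1 + 1)))
        (fun _ : Fin 3 => ((0, 1) : Fin (1 + 1) × Fin (1 + 1))) =
          LGraph.flip (LGraph.flip (LGraph.flip (fun _ => (0, 1)) 0) 1) 2 := by
      decide
    rw [theta, permVertices, lift_mk, h1, mk_flip_three, mk_flip_three, mk_flip_three,
      Equiv.Perm.sign_swap (by decide)]
    norm_num

/-- The family with the single component `theta`. -/
def thetaFamily : GraFamily 3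
  | 1, 3 => theta
  | _, _ => 0

theorem thetaFamily_eq_zero {N k : ℕ} (h : ¬(N = 1 ∧ k = 3)) : thetaFamily N k = 0 := by
  unfold thetaFamily
  split
  · exact absurd ⟨rfl, rfl⟩ h
  · rfl

theorem thetaFamily_mem_finiteFamilies : thetaFamily ∈ finiteFamilies 3 := by
  refine (Set.finite_singleton ((1, 3) : ℕ × ℕ)).subset fun p hp => ?_
  by_contra h
  exact hp (thetaFamily_eq_zero fun h' => h (Prod.ext h'.1 h'.2))

theorem thetaFamily_mem_fgcCocycles : thetaFamily ∈ fgcCocycles 3 (-((2 : ℕ) + 1 : ℤ)) := by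
  refine ⟨⟨fun N k σ => ?_, fun N k h => ?_⟩, ?_⟩
  · by_cases h : N = 1 ∧ k = 3
    · obtain ⟨rfl, rfl⟩ := h
      exact permVertices_theta σ
    · rw [thetaFamily_eq_zero h, map_zero, smul_zero]
  · refine thetaFamily_eq_zero ?_
    rintro ⟨rfl, rfl⟩
    exact h (by norm_num [fgcDegree])
  · refine LinearMap.mem_ker.2 ?_
    funext N k
    rcases N with _ | N
    · rfl
    rcases k with _ | k
    · rfl
    change Gra.cast 3 _ _ (Gra.bracket 3 (Gra.edge 3) (thetaFamily N k)) = 0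
    by_cases h : N = 1 ∧ k = 3
    · obtain ⟨rfl, rfl⟩ := h
      have := bracket_edge_theta
      exact (congrArg _ this).trans (map_zero _)
    · rw [thetaFamily_eq_zero h, map_zero, map_zero]

end Gra
end GraphFlow
end

/-! ### Graphs acting on functions of separated variables -/

noncomputable section

namespace GraphFlow

namespace DarbouxChart

section DegreeTwo

variable (V : DarbouxChart 2)

/-- If on one tensor every edge acts as a multiple of a single operator `E` that commutes with all
edge operators, then the multiples multiply up, edge by edge, to the weight of the graph. -/
theorem graphOp_eq_weightGraph_smul {N k : ℕ} (g : LGraph N k) (w : Fin N → Fin N → ℤ)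
    (E : Module.End ℝ (⨂[ℝ] _ : Fin N, V.Fun)) (v : ⨂[ℝ] _ : Fin N, V.Fun)
    (hE : ∀ i j, V.edgeOp i j * E = E * V.edgeOp i j)
    (hv : ∀ i j, V.edgeOp i j v = ((w i j - w j i : ℤ) : ℝ) • E v) :
    V.graphOp g v = (Gra.weightGraph w g : ℝ) • (E ^ k) v := by
  induction k with
  | zero => simp [graphOp, Gra.weightGraph]
  | succ k ih =>
    have h1 : V.graphOp g = V.edgeOp (g 0).1 (g 0).2 * V.graphOp (fun e => g e.succ) := by
      unfold graphOp
      rw [List.ofFn_succ, List.prod_cons]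
    have h2 : V.edgeOp (g 0).1 (g 0).2 * E ^ k = E ^ k * V.edgeOp (g 0).1 (g 0).2 :=
      (Commute.pow_right (hE _ _) k).eq
    have h3 : Gra.weightGraph w g = (w (g 0).1 (g 0).2 - w (g 0).2 (g 0).1) *
        Gra.weightGraph w (fun e => g e.succ) := Fin.prod_univ_succ _
    have h4 : V.edgeOp (g 0).1 (g 0).2 ((E ^ k) v) = (E ^ k) (V.edgeOp (g 0).1 (g 0).2 v) :=
      LinearMap.congr_fun h2 v
    rw [h1, Module.End.mul_apply, ih, map_smul, h4, hv, map_smul, smul_smul, h3, pow_succ,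
      Module.End.mul_apply]
    congr 1
    push_cast
    ring

/-- Reversing a tadpole gives the same tadpole, and for d = 3 it also changes the sign. -/
theorem edgeOp_self {N : ℕ} (i : Fin N) : V.edgeOp i i = 0 := by
  have key : ∀ {M : Type} [AddCommGroup M] [Module ℝ M] (x : M), x = (-1 : ℝ) ^ (2 + 1) • x →
      x = 0 := fun x h => by
    have h2 : (2 : ℝ) • x = 0 := by
      rw [two_smul]
      nth_rewrite 1 [h]
      norm_num
    exact (smul_eq_zero.1 h2).resolve_left two_ne_zero
  exact key _ (V.edgeOp_swap i i)

/-- When only edges between `p` and `q` act nontrivially, only graphs with all edges parallel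
between these two vertices survive, and the weight adds up their coefficients. -/
theorem rep_eq_weight_smul {N k : ℕ} {p q : Fin N} (hpq : p ≠ q) (f : Fin N → V.Fun)
    (hf : ∀ i j, i ≠ j → ¬(i = p ∧ j = q) → ¬(i = q ∧ j = p) →
      V.edgeOp i j (PiTensorProduct.tprod ℝ f) = 0) (x : Gra 3 N k) :
    V.rep x f = Gra.weight (Gra.edgeWeight p q) x •
      V.mulAll N ((V.edgeOp p q ^ k) (PiTensorProduct.tprod ℝ f)) := by
  induction x using Gra.mk_induction with
  | zero => simp
  | add x y hx hy => rw [map_add, _root_.add_apply, hx, hy, map_add, add_smul]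
  | smul c x hx => rw [map_smul, _root_.smul_apply, hx, map_smul, smul_assoc]
  | mk g =>
    rw [Gra.weight_mk]
    refine (congrArg (fun m => m f) (V.rep_mk g)).trans ?_
    rw [V.repGraph_apply, ← map_smul]
    congr 1
    refine V.graphOp_eq_weightGraph_smul g _ _ _ (fun i j => ?_) fun i j => ?_
    · rw [V.edgeOp_comm]
      norm_num
    · by_cases hij : i = j
      · subst hij
        rw [V.edgeOp_self, sub_self, Int.cast_zero, zero_smul]
        rfl
      by_cases h1 : i = p ∧ j = q
      · obtain ⟨rfl, rfl⟩ := h1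
        simp [Gra.edgeWeight, hij]
      by_cases h2 : i = q ∧ j = p
      · obtain ⟨rfl, rfl⟩ := h2
        rw [V.edgeOp_swap j i]
        simp [Gra.edgeWeight, hij]
        norm_num
      · rw [hf i j hij h1 h2]
        simp [Gra.edgeWeight, h1, h2, and_comm]

end DegreeTwo

variable {n : ℕ} (V : DarbouxChart n)

theorem pdAt_tprod_eq_zero {N : ℕ} {i : Fin N} {a : Fin V.r} {f : Fin N → V.Fun}
    (h : V.pd a (f i) = 0) : V.pdAt i a (PiTensorProduct.tprod ℝ f) = 0 := by
  rw [V.pdAt_tprod]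
  refine (PiTensorProduct.tprod ℝ).map_coord_zero i ?_
  simp [h]

theorem edgeOp_tprod_eq_zero {N : ℕ} {i j : Fin N} {f : Fin N → V.Fun}
    (h : ∀ a b, V.pairing a b ≠ 0 → V.pd a (f i) = 0 ∨ V.pd b (f j) = 0) :
    V.edgeOp i j (PiTensorProduct.tprod ℝ f) = 0 := by
  unfold edgeOp
  rw [LinearMap.sum_apply]
  refine Finset.sum_eq_zero fun a _ => ?_
  rw [LinearMap.sum_apply]
  refine Finset.sum_eq_zero fun b _ => ?_
  by_cases hab : V.pairing a b = 0
  · rw [hab, zero_smul]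
    rfl
  rw [LinearMap.smul_apply]
  rcases h a b hab with h | h
  -- The two derivatives commute up to sign, so the one that annihilates its argument can be applied
  -- first.
  · rw [V.pdAt_comm, LinearMap.smul_apply, Module.End.mul_apply, V.pdAt_tprod_eq_zero h, map_zero,
      smul_zero, smul_zero]
  · rw [Module.End.mul_apply, V.pdAt_tprod_eq_zero h, map_zero, smul_zero]

end DarbouxChart
end GraphFlow
end

/-! ### Six odd coordinates over a point -/

noncomputable section

namespace GraphFlow

/-- The NP-manifold of degree two over a point with six orthonormal coordinates of degree one. -/
def sixOdd : DarbouxChart 2 where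
  r := 6
  deg _ := 1
  dom := ⊤
  pairing a b := if a = b then 1 else 0
  pairing_degree _ _ _ := rfl
  pairing_symm a b := by
    simp only [eq_comm (a := a)]
    norm_num
  pairing_nondeg := by
    have h : (Matrix.of fun a b : Fin 6 => if a = b then (1 : ℝ) else 0) = 1 := by
      ext a b
      simp [Matrix.one_apply]
    rw [h]
    simp

namespace sixOdd

/-- The coordinate functions. -/
def coordFun (a : Fin 6) : sixOdd.Fun :=
  sixOdd.monom 1 1 (ExteriorAlgebra.ι ℝ (Pi.single (⟨a, odd_one⟩ : sixOdd.OddIdx) (1 : ℝ)))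

local notation "ξ" => coordFun

theorem pd_monom (a : Fin 6) (f p q) : sixOdd.pd a (sixOdd.monom f p q) =
    sixOdd.monom f p (CliffordAlgebra.contractLeft (Q := (0 : QuadraticForm ℝ (sixOdd.OddIdx → ℝ)))
      (LinearMap.proj (⟨a, odd_one⟩ : sixOdd.OddIdx)) q) := by
  have h : sixOdd.pd a = _ := dif_neg (one_ne_zero : sixOdd.deg a ≠ 0)
  exact LinearMap.congr_fun (h.trans (dif_neg (Nat.not_even_iff_odd.2 odd_one))) _

theorem pd_coordFun (a b : Fin 6) : sixOdd.pd a (ξ b) = if a = b then 1 else 0 := by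
  have h1 : CliffordAlgebra.contractLeft (Q := (0 : QuadraticForm ℝ (sixOdd.OddIdx → ℝ)))
      (LinearMap.proj (⟨a, odd_one⟩ : sixOdd.OddIdx))
      (ExteriorAlgebra.ι ℝ (Pi.single (⟨b, odd_one⟩ : sixOdd.OddIdx) (1 : ℝ))) =
        algebraMap ℝ _ (if a = b then 1 else 0) := by
    refine (CliffordAlgebra.contractLeft_ι _ _ _).trans (congrArg _ ?_)
    change (Pi.single (⟨b, odd_one⟩ : sixOdd.OddIdx) (1 : ℝ) : sixOdd.OddIdx → ℝ)
      ⟨a, odd_one⟩ = _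
    rw [Pi.single_apply]
    exact if_congr Subtype.mk_eq_mk rfl rfl
  rw [coordFun, pd_monom, h1]
  split_ifs
  · rw [map_one, sixOdd.one_eq_monom]
  · rw [map_zero, sixOdd.monom_zero_right]

theorem parity_coordFun (a : Fin 6) : sixOdd.parity (ξ a) = -ξ a := by
  rw [coordFun, sixOdd.parity_monom]
  refine (congrArg _ (CliffordAlgebra.involute_ι _)).trans ?_
  rw [← neg_one_smul ℝ, sixOdd.monom_smul_right, neg_one_smul]

theorem pd_mul_eq (a : Fin 6) (x y : sixOdd.Fun) :
    sixOdd.pd a (x * y) = sixOdd.pd a x * y + sixOdd.parity x * sixOdd.pd a y := by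
  have h := sixOdd.pd_mul a x y
  exact h.trans (by rw [show sixOdd.deg a = 1 from rfl, pow_one])

theorem coordFun_mul_self (a : Fin 6) : ξ a * ξ a = 0 := by
  rw [coordFun, sixOdd.monom_mul_monom, ExteriorAlgebra.ι_sq_zero, sixOdd.monom_zero_right]

theorem coordFun_mul_coordFun (a b : Fin 6) : ξ b * ξ a = -(ξ a * ξ b) := by
  have h : ∀ u v : sixOdd.OddIdx → ℝ, ExteriorAlgebra.ι ℝ u * ExteriorAlgebra.ι ℝ v =
      (-1 : ℝ) • (ExteriorAlgebra.ι ℝ v * ExteriorAlgebra.ι ℝ u) := fun u v => by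
    rw [neg_one_smul, eq_neg_iff_add_eq_zero]
    exact ExteriorAlgebra.ι_add_mul_swap _ _
  rw [coordFun, coordFun, sixOdd.monom_mul_monom, sixOdd.monom_mul_monom, h,
    sixOdd.monom_smul_right, neg_one_smul]

theorem bracket_eq (f g : sixOdd.Fun) : sixOdd.bracket f g =
    ∑ a : Fin 6, sixOdd.pd a (sixOdd.parity f) * sixOdd.pd a g := by
  rw [sixOdd.bracket_apply]
  refine Finset.sum_congr rfl fun a _ => ?_
  refine (Finset.sum_eq_single a (fun b _ hb => ?_) (by simp)).trans ?_
  · rw [show sixOdd.pairing a b = 0 from if_neg hb.symm, zero_smul]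
  · rw [show sixOdd.pairing a a = 1 from if_pos rfl, one_smul, show sixOdd.deg a = 1 from rfl,
      pow_one]

/-- The cubic functions `s ξ₀ξ₁ξ₂ + t ξ₃ξ₄ξ₅`. -/
def cubic (s t : ℝ) : sixOdd.Fun := s • (ξ 0 * ξ 1 * ξ 2) + t • (ξ 3 * ξ 4 * ξ 5)

/-- The coefficient of the derivative of a cubic function. -/
def cubicCoeff (s t : ℝ) : Fin 6 → ℝ := ![s, -s, s, t, -t, t]

/-- The first index of the derivative of a cubic function. -/
def cubicFst : Fin 6 → Fin 6 := ![1, 0, 0, 4, 3, 3]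

/-- The second index of the derivative of a cubic function. -/
def cubicSnd : Fin 6 → Fin 6 := ![2, 2, 1, 5, 5, 4]

theorem pd_cubic (s t : ℝ) (a : Fin 6) : sixOdd.pd a (cubic s t) =
    cubicCoeff s t a • (ξ (cubicFst a) * ξ (cubicSnd a)) := by
  fin_cases a <;>
  simp [cubic, cubicCoeff, cubicFst, cubicSnd, pd_mul_eq, sixOdd.parity_mul, parity_coordFun,
    pd_coordFun]

theorem parity_cubic (s t : ℝ) : sixOdd.parity (cubic s t) = -cubic s t := by
  simp [cubic, sixOdd.parity_mul, parity_coordFun, add_comm]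

theorem coordFun_mem (a : Fin 6) : ξ a ∈ sixOdd.homogeneous 1 :=
  Submodule.subset_span ⟨1, 0, [⟨a, odd_one⟩], rfl, by simp [coordFun]⟩

theorem mul_self_coordFun_mul (a b : Fin 6) : ξ a * ξ b * (ξ a * ξ b) = 0 := by
  rw [mul_assoc, ← mul_assoc (ξ b), coordFun_mul_coordFun a b, neg_mul, mul_assoc,
    coordFun_mul_self, mul_zero, neg_zero, mul_zero]

theorem cubic_mem (s t : ℝ) : cubic s t ∈ sixOdd.homogeneous 3 := by
  have h : ∀ a b c : Fin 6, ξ a * ξ b * ξ c ∈ sixOdd.homogeneous 3 := fun a b c => by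
    have := sixOdd.mul_mem_homogeneous (sixOdd.mul_mem_homogeneous (coordFun_mem a)
      (coordFun_mem b)) (coordFun_mem c)
    norm_num at this
    exact this
  exact add_mem (Submodule.smul_mem _ _ (h _ _ _)) (Submodule.smul_mem _ _ (h _ _ _))

/-- Up to sign the bracket is the sum of the squares of the partial derivatives. Each of these is a
multiple of a single monomial ξᵢξⱼ, whose square is zero. -/
theorem bracket_cubic (s t : ℝ) : sixOdd.bracket (cubic s t) (cubic s t) = 0 := by
  rw [bracket_eq]
  refine Finset.sum_eq_zero fun a _ => ?_
  rw [parity_cubic, map_neg, pd_cubic, neg_mul, smul_mul_smul_comm, mul_self_coordFun_mul,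
    smul_zero, neg_zero]

/-- The cubic functions are Hamiltonian functions. -/
def cubicHam (s t : ℝ) : sixOdd.Ham := ⟨cubic s t, by
  have h : ((2 : ℕ) + 1 : ℤ) = 3 := by norm_num
  rw [h]
  exact cubic_mem s t, bracket_cubic s t⟩

/-! ### The evaluation of the graph with three parallel edges -/

/-- The contraction of two functions along `k` parallel edges. -/
def contraction : ℕ → sixOdd.Fun → sixOdd.Fun → sixOdd.Fun
  | 0, f, g => f * g
  | k + 1, f, g => ∑ a : Fin 6, contraction k (sixOdd.pd a (sixOdd.parity f)) (sixOdd.pd a g)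

theorem contraction_smul (k : ℕ) (c c' : ℝ) (f g : sixOdd.Fun) :
    contraction k (c • f) (c' • g) = (c * c') • contraction k f g := by
  induction k generalizing f g with
  | zero => exact smul_mul_smul_comm _ _ _ _
  | succ k ih => simp only [contraction, map_smul, ih, Finset.smul_sum]

theorem contraction_neg_neg (k : ℕ) (f g : sixOdd.Fun) :
    contraction k (-f) (-g) = contraction k f g := by
  have h := contraction_smul k (-1) (-1) f g
  simpa using h

theorem contraction_one_coordFun (i : Fin 6) : contraction 1 (ξ i) (ξ i) = -1 := by
  simp [contraction, parity_coordFun, pd_coordFun]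

/-- The derivative at the second vertex acts first and leaves a parity operator on the first factor;
this is the recursion step of `contraction`. -/
theorem edgeOp_tprod_pair (f g : sixOdd.Fun) :
    sixOdd.edgeOp 0 1 (PiTensorProduct.tprod ℝ ![f, g]) = ∑ a : Fin 6,
      PiTensorProduct.tprod ℝ ![sixOdd.pd a (sixOdd.parity f), sixOdd.pd a g] := by
  unfold DarbouxChart.edgeOp
  rw [LinearMap.sum_apply]
  refine Finset.sum_congr rfl fun a _ => ?_
  rw [LinearMap.sum_apply]
  refine (Finset.sum_eq_single a (fun b _ hb => ?_) (by simp)).trans ?_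
  · rw [show sixOdd.pairing a b = 0 from if_neg hb.symm, zero_smul]
    rfl
  · rw [show sixOdd.pairing a a = 1 from if_pos rfl, one_smul, Module.End.mul_apply,
      sixOdd.pdAt_tprod, sixOdd.pdAt_tprod, show sixOdd.deg a = 1 from rfl, pow_one]
    congr 1
    funext j
    fin_cases j <;> simp

theorem mulAll_edgeOp_pow (k : ℕ) (f g : sixOdd.Fun) :
    sixOdd.mulAll 2 ((sixOdd.edgeOp 0 1 ^ k) (PiTensorProduct.tprod ℝ ![f, g])) =
      contraction k f g := by
  induction k generalizing f g with
  | zero =>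
    rw [pow_zero, Module.End.one_apply, sixOdd.mulAll_tprod]
    simp [contraction]
  | succ k ih =>
    rw [pow_succ, Module.End.mul_apply, edgeOp_tprod_pair, map_sum, map_sum]
    exact Finset.sum_congr rfl fun a _ => ih _ _

theorem rep_theta (f : sixOdd.Fun) : sixOdd.rep Gra.theta (fun _ => f) = contraction 3 f f := by
  have h : sixOdd.graphOp (fun _ : Fin 3 => ((0, 1) : Fin 2 × Fin 2)) = sixOdd.edgeOp 0 1 ^ 3 := by
    unfold DarbouxChart.graphOp
    rw [List.ofFn_const, List.prod_replicate]
  have h' : (fun _ : Fin 2 => f) = ![f, f] := by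
    funext j
    fin_cases j <;> rfl
  have h1 : sixOdd.rep Gra.theta =
    sixOdd.repGraph fun _ : Fin 3 => ((0, 1) : Fin 2 × Fin 2) := sixOdd.rep_mk _
  have h2 := sixOdd.repGraph_apply (fun _ : Fin 3 => ((0, 1) : Fin 2 × Fin 2)) fun _ => f
  rw [h1, h2, h, h', mulAll_edgeOp_pow]

theorem contraction_two_coordFun {i j : Fin 6} (h : i ≠ j) :
    contraction 2 (ξ i * ξ j) (ξ i * ξ j) = (-2 : ℝ) • (1 : sixOdd.Fun) := by
  have h1 : ∀ a : Fin 6, sixOdd.pd a (ξ i * ξ j) =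
      (if a = i then ξ j else 0) + (if a = j then -ξ i else 0) := fun a => by
    rw [pd_mul_eq, pd_coordFun, pd_coordFun, parity_coordFun]
    simp only [ite_mul, one_mul, zero_mul, mul_ite, mul_one, mul_zero]
  have h2 : sixOdd.parity (ξ i * ξ j) = ξ i * ξ j := by
    rw [sixOdd.parity_mul, parity_coordFun, parity_coordFun, neg_mul_neg]
  have h3 : ∀ a : Fin 6, contraction 1 (sixOdd.pd a (ξ i * ξ j)) (sixOdd.pd a (ξ i * ξ j)) =
      (if a = i then -1 else 0) + (if a = j then -1 else 0) := fun a => by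
    rw [h1]
    by_cases hi : a = i
    · subst hi
      rw [if_pos rfl, if_pos rfl, if_neg h, if_neg h, add_zero, add_zero,
        contraction_one_coordFun]
    by_cases hj : a = j
    · subst hj
      rw [if_pos rfl, if_pos rfl, if_neg hi, if_neg hi, zero_add, zero_add,
        contraction_neg_neg, contraction_one_coordFun]
    · rw [if_neg hi, if_neg hi, if_neg hj, if_neg hj]
      have := contraction_smul 1 0 0 0 0
      simpa using this
  rw [contraction, h2, Finset.sum_congr rfl fun a _ => h3 a, Finset.sum_add_distrib,
    Finset.sum_ite_eq' , Finset.sum_ite_eq', if_pos (Finset.mem_univ _),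
    if_pos (Finset.mem_univ _), neg_smul, two_smul]
  abel

theorem rep_theta_cubic (s t : ℝ) : sixOdd.rep Gra.theta (fun _ => cubic s t) =
    (6 * (s ^ 2 + t ^ 2)) • (1 : sixOdd.Fun) := by
  -- The sign from the parity of the cubic turns the value -2 of the double contraction into 2;
  -- summing over the six squared coefficients then gives 2(3s² + 3t²).
  have h : ∀ a : Fin 6, contraction 2 (sixOdd.pd a (sixOdd.parity (cubic s t)))
      (sixOdd.pd a (cubic s t)) = (2 * cubicCoeff s t a ^ 2) • (1 : sixOdd.Fun) := fun a => by
    have hne : cubicFst a ≠ cubicSnd a := by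
      revert a
      decide
    rw [parity_cubic, map_neg, pd_cubic, ← neg_smul, contraction_smul,
      contraction_two_coordFun hne, smul_smul]
    congr 1
    ring
  rw [rep_theta, contraction, Finset.sum_congr rfl fun a _ => h a, ← Finset.sum_smul]
  congr 1
  simp [Fin.sum_univ_six, cubicCoeff]
  ring

/-- A linear functional taking the value one at the constant function one. -/
theorem exists_functional : ∃ ε : sixOdd.Fun →ₗ[ℝ] ℝ, ε 1 = 1 := by
  let e₁ : SmoothFun sixOdd.dom →ₗ[ℝ] ℝ :=
    { toFun := fun f => f.1 ⟨0, trivial⟩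
      map_add' := fun _ _ => rfl
      map_smul' := fun _ _ => rfl }
  let e₂ : MvPolynomial sixOdd.EvenIdx ℝ →ₗ[ℝ] ℝ := (MvPolynomial.aeval 0).toLinearMap
  let e₃ : ExteriorAlgebra ℝ (sixOdd.OddIdx → ℝ) →ₗ[ℝ] ℝ :=
    ExteriorAlgebra.algebraMapInv.toLinearMap
  refine ⟨LinearMap.mul' ℝ ℝ ∘ₗ TensorProduct.map e₁ (LinearMap.mul' ℝ ℝ ∘ₗ
    TensorProduct.map e₂ e₃), ?_⟩
  rw [sixOdd.one_eq_monom]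
  have h : e₁ 1 * (e₂ 1 * e₃ 1) = 1 := by
    have h1 : e₁ 1 = 1 := rfl
    have h2 : e₂ 1 = 1 := map_one (MvPolynomial.aeval (R := ℝ) (0 : sixOdd.EvenIdx → ℝ))
    have h3 : e₃ 1 = 1 := map_one (ExteriorAlgebra.algebraMapInv (R := ℝ)
      (M := sixOdd.OddIdx → ℝ))
    rw [h1, h2, h3]
    norm_num
  exact h

end sixOdd
end GraphFlow
end

/-! ### Coboundaries and mixed terms -/

noncomputable section

namespace GraphFlow

namespace sixOdd

local notation "ξ" => coordFun

/-- The coefficient of the monomial `ξ₀ξ₁ξ₂`, as a differential operator. -/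
def tripleDeriv : Module.End ℝ sixOdd.Fun :=
  sixOdd.pd (2 : Fin 6) * sixOdd.pd (1 : Fin 6) * sixOdd.pd (0 : Fin 6)

theorem tripleDeriv_apply (x : sixOdd.Fun) : tripleDeriv x =
    sixOdd.pd (2 : Fin 6) (sixOdd.pd (1 : Fin 6) (sixOdd.pd (0 : Fin 6) x)) := rfl

theorem tripleDeriv_cubic (s t : ℝ) : tripleDeriv (cubic s t) = s • (1 : sixOdd.Fun) := by
  rw [tripleDeriv_apply, pd_cubic]
  simp [cubicCoeff, cubicFst, cubicSnd, pd_mul_eq, parity_coordFun, pd_coordFun]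

theorem tripleDeriv_pd_cubic_mul (s t : ℝ) {i j : Fin 6} (h : i ≠ j) :
    tripleDeriv (sixOdd.pd i (cubic s t) * ξ j) = 0 := by
  rw [tripleDeriv_apply, pd_cubic, smul_mul_assoc, map_smul, map_smul, map_smul]
  refine (congrArg (_ • ·) ?_).trans (smul_zero _)
  fin_cases i <;> fin_cases j <;> first
  | exact absurd rfl h
  | simp [cubicFst, cubicSnd, pd_mul_eq, sixOdd.parity_mul, parity_coordFun, pd_coordFun]

/-- Bracketing with ξᵢξⱼ replaces one coordinate of a monomial by a different one. This cannot
reproduce ξ₀ξ₁ξ₂, and from ξ₃ξ₄ξ₅ at least two of the factors remain. -/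
theorem tripleDeriv_bracket_coordFun_mul (s t : ℝ) (i j : Fin 6) :
    tripleDeriv (sixOdd.bracket (cubic s t) (ξ i * ξ j)) = 0 := by
  by_cases hij : i = j
  · rw [hij, coordFun_mul_self, map_zero, map_zero]
  have h : sixOdd.bracket (cubic s t) (ξ i * ξ j) =
      sixOdd.pd j (cubic s t) * ξ i - sixOdd.pd i (cubic s t) * ξ j := by
    rw [bracket_eq, parity_cubic]
    simp only [pd_mul_eq, pd_coordFun, parity_coordFun, map_neg, ite_mul, one_mul, zero_mul,
      mul_ite, mul_one, mul_zero, mul_add, Finset.sum_add_distrib, Finset.sum_ite_eq',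
      Finset.mem_univ, if_true, neg_mul_neg]
    rw [neg_mul]
    abel
  rw [h, map_sub, tripleDeriv_pd_cubic_mul s t hij,
    tripleDeriv_pd_cubic_mul s t (Ne.symm hij), sub_zero]

theorem pd_monom_mul (f : SmoothFun sixOdd.dom) (a : Fin 6) (x : sixOdd.Fun) :
    sixOdd.pd a (sixOdd.monom f 1 1 * x) = sixOdd.monom f 1 1 * sixOdd.pd a x := by
  have h : CliffordAlgebra.contractLeft (Q := (0 : QuadraticForm ℝ (sixOdd.OddIdx → ℝ)))
      (LinearMap.proj (⟨a, odd_one⟩ : sixOdd.OddIdx)) 1 = 0 :=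
    CliffordAlgebra.contractLeft_one _ _
  rw [pd_mul_eq, pd_monom, h, sixOdd.monom_zero_right, zero_mul, zero_add, sixOdd.parity_monom,
    map_one]

theorem bracket_monom_mul (f : SmoothFun sixOdd.dom) (x y : sixOdd.Fun) :
    sixOdd.bracket x (sixOdd.monom f 1 1 * y) = sixOdd.monom f 1 1 * sixOdd.bracket x y := by
  have h : sixOdd.monom f 1 1 ∈ sixOdd.homogeneous 0 :=
    Submodule.subset_span ⟨f, 0, [], by simp, by simp⟩
  rw [bracket_eq, bracket_eq, Finset.mul_sum]
  refine Finset.sum_congr rfl fun a _ => ?_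
  rw [pd_monom_mul, ← mul_assoc, ← mul_assoc, sixOdd.mul_comm_of_mem_zero h]

/-- Makes the coefficient of ξ₀ξ₁ξ₂ an invariant of the cohomology class. Functions of degree 2 are
combinations of the products ξᵢξⱼ with coefficients on the base, and these coefficients pass through
all derivatives. -/
theorem tripleDeriv_bracket (s t : ℝ) {x : sixOdd.Fun} (hx : x ∈ sixOdd.homogeneous 2) :
    tripleDeriv (sixOdd.bracket (cubic s t) x) = 0 := by
  have hodd : ¬ Even 1 := Nat.not_even_one
  induction hx using Submodule.span_induction with
  | mem x hx =>
    obtain ⟨f, m, l, hl, rfl⟩ := hx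
    -- There are only odd coordinates, all of degree 1, so a monomial of degree 2 is a product of
    -- two of them.
    have : IsEmpty sixOdd.EvenIdx := ⟨fun i => hodd i.2.2⟩
    obtain rfl : m = 0 := Subsingleton.elim _ _
    have h1 : sixOdd.oddDeg l = l.length := by
      clear hl
      induction l with
      | nil => rfl
      | cons i l ih => rw [sixOdd.oddDeg_cons, ih, List.length_cons, add_comm]; rfl
    have h2 : l.length = 2 := by
      have h : ((0 : ℕ) : ℤ) + (sixOdd.oddDeg l : ℕ) = 2 := hl
      rw [h1] at h
      omega
    obtain ⟨⟨i, hi⟩, ⟨j, hj⟩, rfl⟩ := List.length_eq_two.1 h2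
    have h3 : ∀ i j : Fin 6, sixOdd.monom f (MvPolynomial.monomial 0 1)
        (([⟨i, odd_one⟩, ⟨j, odd_one⟩] : List sixOdd.OddIdx).map fun i => ExteriorAlgebra.ι ℝ
          (Pi.single i (1 : ℝ) : sixOdd.OddIdx → ℝ)).prod =
        sixOdd.monom f 1 1 * (ξ i * ξ j) := fun i j => by
      rw [coordFun, coordFun, sixOdd.monom_mul_monom, sixOdd.monom_mul_monom]
      simp
    refine (congrArg (fun y => tripleDeriv (sixOdd.bracket (cubic s t) y)) (h3 i j)).trans ?_
    have h4 := tripleDeriv_bracket_coordFun_mul s t i j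
    rw [bracket_monom_mul, tripleDeriv_apply, pd_monom_mul, pd_monom_mul, pd_monom_mul,
      ← tripleDeriv_apply]
    exact (congrArg (_ * ·) h4).trans (mul_zero _)
  | zero => rw [map_zero, map_zero]
  | add x y _ _ hx hy => rw [map_add, map_add, hx, hy, add_zero]
  | smul c x _ hx => rw [map_smul, map_smul, hx, smul_zero]

theorem pairing_of_ne {a b : Fin 6} (h : a ≠ b) : sixOdd.pairing a b = 0 := if_neg h

theorem pd_cubic_eq_zero_or (a : Fin 6) :
    sixOdd.pd a (cubic 1 0) = 0 ∨ sixOdd.pd a (cubic 0 1) = 0 := by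
  rw [pd_cubic, pd_cubic]
  fin_cases a <;> simp [cubicCoeff]

/-- A division of three vertices into two nonempty classes has one class with two elements `p` and
`q`; every other pair of distinct vertices meets both classes. -/
theorem exists_mixed : ∀ s : Finset (Fin 3), s = Finset.univ ∨ s = ∅ ∨
    ∃ p q : Fin 3, p ≠ q ∧ ∀ i j : Fin 3, i ≠ j → ¬(i = p ∧ j = q) → ¬(i = q ∧ j = p) →
      (i ∈ s ∧ j ∉ s) ∨ (i ∉ s ∧ j ∈ s) := by
  decide

/-- The two summands depend on disjoint sets of coordinates that are orthogonal to each other, so an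
edge between vertices carrying different summands acts by zero. A mixed term then reduces to three
parallel edges with an isolated vertex, whose weight vanishes by assumption. -/
theorem rep_cubic_add {x : Gra 3 3 3}
    (hx : ∀ p q, p ≠ q → Gra.weight (Gra.edgeWeight p q) x = 0) :
    (sixOdd.rep x fun _ => cubic 1 1) =
      (sixOdd.rep x fun _ => cubic 1 0) + sixOdd.rep x fun _ => cubic 0 1 := by
  have h : (fun _ : Fin 3 => cubic 1 1) = (fun _ => cubic 1 0) + fun _ => cubic 0 1 := by
    funext _
    simp [cubic]
  have h0 : ∀ s : Finset (Fin 3), s ≠ Finset.univ → s ≠ ∅ →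
      sixOdd.rep x (s.piecewise (fun _ => cubic 1 0) fun _ => cubic 0 1) = 0 := by
    intro s hs1 hs2
    rcases exists_mixed s with h | h | ⟨p, q, hpq, h⟩
    · exact absurd h hs1
    · exact absurd h hs2
    have h3 := sixOdd.rep_eq_weight_smul hpq
      (s.piecewise (fun _ => cubic 1 0) fun _ => cubic 0 1) (fun i j hij h1 h2 => by
        refine sixOdd.edgeOp_tprod_eq_zero fun a b hab => ?_
        obtain rfl : a = b := by
          by_contra hne
          exact hab (pairing_of_ne hne)
        rcases h i j hij h1 h2 with ⟨hi, hj⟩ | ⟨hi, hj⟩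
        · rw [Finset.piecewise_eq_of_mem _ _ _ hi, Finset.piecewise_eq_of_notMem _ _ _ hj]
          exact pd_cubic_eq_zero_or a
        · rw [Finset.piecewise_eq_of_mem _ _ _ hj, Finset.piecewise_eq_of_notMem _ _ _ hi]
          exact (pd_cubic_eq_zero_or a).symm) x
    rw [h3, hx p q hpq, zero_smul]
  have h1 := (sixOdd.rep x).map_add_univ (fun _ : Fin 3 => cubic 1 0) fun _ => cubic 0 1
  rw [h]
  refine h1.trans ?_
  -- The full and the empty set of vertices give the two pure terms; all other subsets are mixed.
  rw [← Finset.add_sum_erase _ _ (Finset.mem_univ (Finset.univ : Finset (Fin 3))),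
    ← Finset.add_sum_erase _ _ (Finset.mem_erase.2
      ⟨(by decide : (∅ : Finset (Fin 3)) ≠ Finset.univ), Finset.mem_univ _⟩),
    Finset.sum_eq_zero fun s hs => ?_, Finset.piecewise_univ, Finset.piecewise_empty, add_zero]
  rw [Finset.mem_erase, Finset.mem_erase] at hs
  exact h0 s hs.2.1 hs.1

end sixOdd
end GraphFlow
end

/-! ### Isolating the cubic part and the contradiction -/

noncomputable section

namespace GraphFlow

namespace DarbouxChart

variable {n : ℕ} (V : DarbouxChart n)

theorem IsClassOf.sub_mem {H : V.Ham} {k : ℤ} {f g : V.Fun} {c : V.QCohomology H k}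
    (hf : V.IsClassOf f c) (hg : V.IsClassOf g c) : f - g ∈ V.qCoboundaries H k := by
  obtain ⟨hf, rfl⟩ := hf
  obtain ⟨hg, h⟩ := hg
  exact (Submodule.Quotient.eq ((V.qCoboundaries H k).comap (V.qCocycles H k).subtype)).1 h

theorem evalAt_eq_rep {γ : GraFamily (n + 1)} (N k : ℕ)
    (h : ∀ N' k', ¬(N' = N ∧ k' = k) → γ N' k' = 0) (f : V.Fun) :
    V.evalAt γ f = V.rep (γ N k) fun _ => f := by
  refine finsum_eq_single _ ((N, k) : ℕ × ℕ) fun p hp => ?_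
  rw [h _ _ fun h => hp (Prod.ext h.1 h.2), map_zero]
  rfl

/-- On `r • H` a graph with N + 1 vertices scales by `r ^ (N + 1)`. The evaluation is a polynomial
in `r`, and comparing coefficients isolates the part with a given number of vertices. -/
theorem rep_eq_of_evalAt_smul {γ : GraFamily (n + 1)} (hfin : γ ∈ finiteFamilies (n + 1))
    (ℓ : V.Fun →ₗ[ℝ] ℝ) (H : V.Fun) (c : ℝ) (N k : ℕ) (hk : ∀ k', k' ≠ k → γ N k' = 0)
    (h : ∀ r : ℝ, ℓ (V.evalAt γ (r • H)) = c * r ^ (N + 1)) :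
    ℓ (V.rep (γ N k) fun _ => H) = c := by
  classical
  obtain ⟨S, hS⟩ : ∃ S : Finset (ℕ × ℕ), ∀ p, p ∉ S → γ p.1 p.2 = 0 :=
    ⟨Set.Finite.toFinset hfin, fun p hp =>
      by_contra fun h => hp ((Set.Finite.mem_toFinset hfin).2 h)⟩
  let a : ℕ × ℕ → ℝ := fun p => ℓ (V.rep (γ p.1 p.2) fun _ => H)
  have h1 : ∀ r : ℝ, ℓ (V.evalAt γ (r • H)) = ∑ p ∈ S, a p * r ^ (p.1 + 1) := by
    intro r
    have hsub : (Function.support fun p : ℕ × ℕ => V.rep (γ p.1 p.2) fun _ => r • H) ⊆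
        S := fun p hp => by
      by_contra hpS
      refine hp ?_
      change V.rep (γ p.1 p.2) (fun _ => r • H) = 0
      rw [hS p hpS, map_zero]
      rfl
    rw [evalAt, finsum_eq_sum_of_support_subset _ hsub, map_sum]
    refine Finset.sum_congr rfl fun p _ => ?_
    have h2 := (V.rep (γ p.1 p.2)).map_smul_univ (fun _ => r) fun _ => H
    rw [Finset.prod_const, Finset.card_univ, Fintype.card_fin] at h2
    exact (congrArg ℓ h2).trans ((map_smul ℓ _ _).trans (mul_comm _ _))
  have h3 : ∑ p ∈ S, Polynomial.C (a p) * Polynomial.X ^ (p.1 + 1) =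
      Polynomial.C c * Polynomial.X ^ (N + 1) := by
    refine Polynomial.funext fun r => ?_
    rw [Polynomial.eval_finsetSum]
    simp only [Polynomial.eval_mul, Polynomial.eval_C, Polynomial.eval_pow, Polynomial.eval_X]
    rw [← h1, h]
  have h4 := congrArg (fun P => Polynomial.coeff P (N + 1)) h3
  simp only [Polynomial.finsetSum_coeff, Polynomial.coeff_C_mul_X_pow, if_true] at h4
  rw [← h4]
  have h5 : ∀ p : ℕ × ℕ, p ≠ (N, k) → (if N + 1 = p.1 + 1 then a p else 0) = 0 := by
    rintro ⟨N', k'⟩ hp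
    split_ifs with hN
    · obtain rfl : N = N' := Nat.succ_injective hN
      have h6 := hk k' fun h' => hp (h' ▸ rfl)
      change ℓ (V.rep (γ N k') fun _ => H) = 0
      rw [h6, map_zero]
      exact map_zero ℓ
    · rfl
  by_cases hmem : (N, k) ∈ S
  · rw [Finset.sum_eq_single_of_mem _ hmem fun p _ hp => h5 p hp, if_pos rfl]
  · rw [Finset.sum_eq_zero fun p hp => h5 p fun h' => hmem (h' ▸ hp)]
    have h6 : γ N k = 0 := hS _ hmem
    rw [h6, map_zero]
    exact map_zero ℓ

end DarbouxChart

namespace sixOdd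

theorem evalAt_thetaFamily (f : sixOdd.Fun) :
    sixOdd.evalAt Gra.thetaFamily f = sixOdd.rep Gra.theta fun _ => f :=
  sixOdd.evalAt_eq_rep 1 3 (fun _ _ h => Gra.thetaFamily_eq_zero h) f

/-- Up to coboundaries a degree-zero cocycle would have to reproduce 6(s² + t²)s as the coefficient
of ξ₀ξ₁ξ₂, but its part with three vertices is additive in the two summands of H. -/
theorem not_forall_sub_mem_qCoboundaries {γ : GraFamily 3} (hγ : γ ∈ fgcCocycles 3 0)
    (hfin : γ ∈ finiteFamilies 3) : ¬ ∀ s t : ℝ,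
      sixOdd.evalAt γ (cubic s t) - sixOdd.evalAt Gra.thetaFamily (cubic s t) * cubic s t ∈
        sixOdd.qCoboundaries (cubicHam s t) ((2 : ℕ) + 1) := by
  intro h
  obtain ⟨ε, hε⟩ := exists_functional
  have h1 : ∀ s t : ℝ, ε (tripleDeriv (sixOdd.evalAt γ (cubic s t))) =
      6 * (s ^ 2 + t ^ 2) * s := fun s t => by
    obtain ⟨x, hx, hx'⟩ := h s t
    have hx2 : x ∈ sixOdd.homogeneous 2 := by
      have : ((2 : ℕ) : ℤ) + 1 - 1 = 2 := by norm_num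
      rwa [this] at hx
    have h2 : tripleDeriv (sixOdd.evalAt γ (cubic s t) -
        sixOdd.evalAt Gra.thetaFamily (cubic s t) * cubic s t) = 0 := by
      rw [← hx']
      exact tripleDeriv_bracket s t hx2
    rw [map_sub, sub_eq_zero, evalAt_thetaFamily, rep_theta_cubic, smul_one_mul, map_smul,
      tripleDeriv_cubic] at h2
    rw [h2, map_smul, map_smul, hε, smul_eq_mul, smul_eq_mul, mul_one]
  -- Index 2 stands for three vertices, and degree 0 means 6 - 2k = 0.
  have h3 : ∀ k, k ≠ 3 → γ 2 k = 0 := fun k hk => hγ.1.2 2 k (by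
    simp only [fgcDegree]
    push_cast
    omega)
  have h4 : ∀ s t : ℝ, ε (tripleDeriv (sixOdd.rep (γ 2 3) fun _ => cubic s t)) =
      6 * (s ^ 2 + t ^ 2) * s := fun s t =>
    sixOdd.rep_eq_of_evalAt_smul hfin (ε ∘ₗ tripleDeriv) (cubic s t) _ 2 3 h3 fun r => by
      have h5 : r • cubic s t = cubic (r * s) (r * t) := by
        simp only [cubic, smul_add, smul_smul]
      rw [h5, LinearMap.comp_apply, h1]
      ring
  have h6 := congrArg (fun x => ε (tripleDeriv x)) (rep_cubic_add (x := γ 2 3) fun p q hpq =>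
    Gra.weight_eq_zero_of_mem_cocycles hγ hpq)
  simp only [map_add, h4] at h6
  -- Additivity at s = t = 1 would read 12 = 6 + 0.
  norm_num at h6

theorem conformalFlow_notMem_range
    {Φ : finiteCohomology (2 + 1) (-((2 : ℕ) + 1 : ℤ)) →ₗ[ℝ] sixOdd.cHFlow}
    {Φ₀ : finiteCohomology (2 + 1) 0 →ₗ[ℝ] sixOdd.HFlow} (hΦ : sixOdd.IsConformalFlowMap Φ)
    (hΦ₀ : sixOdd.IsHamiltonianFlowMap Φ₀) :
    (Φ (cocycleClass ⟨Gra.thetaFamily, Gra.thetaFamily_mem_fgcCocycles⟩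
      Gra.thetaFamily_mem_finiteFamilies) : sixOdd.HFlow) ∉ LinearMap.range Φ₀ := by
  rintro ⟨c, hc⟩
  obtain ⟨γ, hγ, rfl⟩ := exists_cocycleClass c
  refine not_forall_sub_mem_qCoboundaries γ.2 hγ fun s t => ?_
  have h1 := hΦ₀ γ hγ (cubicHam s t)
  have h2 := hΦ ⟨Gra.thetaFamily, Gra.thetaFamily_mem_fgcCocycles⟩
    Gra.thetaFamily_mem_finiteFamilies (cubicHam s t)
  rw [← hc] at h2
  exact DarbouxChart.IsClassOf.sub_mem sixOdd h1 h2

end sixOdd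

end GraphFlow
end

theorem mainTheorem10 :
    (∀ (n : ℕ) (V : GraphFlow.DarbouxChart n),
      (∀ γ ∈ GraphFlow.fgcCocycles (n + 1) (-((n : ℤ) + 1)), ∀ (N k : ℕ) (H : V.Ham),
        V.rep (γ N k) (fun _ => H.1) ∈ V.homogeneous 0 ∧
          V.bracket H.1 (V.rep (γ N k) (fun _ => H.1)) = 0) ∧
      (∀ γ ∈ GraphFlow.fgcCocycles (n + 1) (-((n : ℤ) + 1)),
        γ ∈ GraphFlow.finiteFamilies (n + 1) → ∀ H : V.Ham,
          V.evalAt γ H.1 ∈ V.homogeneous 0 ∧ V.bracket H.1 (V.evalAt γ H.1) = 0) ∧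
      (∃! Φ : GraphFlow.finiteCohomology (n + 1) (-((n : ℤ) + 1)) →ₗ[ℝ] V.cHFlow,
        V.IsConformalFlowMap Φ) ∧
      (∃! Φ₀ : GraphFlow.finiteCohomology (n + 1) 0 →ₗ[ℝ] V.HFlow,
        V.IsHamiltonianFlowMap Φ₀)) ∧
    (∃ (n : ℕ) (V : GraphFlow.DarbouxChart n)
      (Φ : GraphFlow.finiteCohomology (n + 1) (-((n : ℤ) + 1)) →ₗ[ℝ] V.cHFlow)
      (Φ₀ : GraphFlow.finiteCohomology (n + 1) 0 →ₗ[ℝ] V.HFlow),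
      V.IsConformalFlowMap Φ ∧ V.IsHamiltonianFlowMap Φ₀ ∧
        ¬ Function.Surjective Φ₀ ∧ ∃ c, (Φ c : V.HFlow) ∉ LinearMap.range Φ₀) := by
  refine ⟨fun n V => ⟨fun γ hγ N k H => ⟨V.rep_mem_zero hγ N k H,
    V.bracket_rep_of_mem_cocycles hγ N k H⟩, fun γ hγ hfin H => V.evalAt_conformal hγ hfin H,
    V.existsUnique_conformalFlowMap, V.existsUnique_hamiltonianFlowMap⟩, ?_⟩
  obtain ⟨Φ, hΦ, -⟩ := GraphFlow.sixOdd.existsUnique_conformalFlowMap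
  obtain ⟨Φ₀, hΦ₀, -⟩ := GraphFlow.sixOdd.existsUnique_hamiltonianFlowMap
  have h := GraphFlow.sixOdd.conformalFlow_notMem_range hΦ hΦ₀
  exact ⟨2, GraphFlow.sixOdd, Φ, Φ₀, hΦ, hΦ₀, fun hsurj => h (hsurj _), _, h⟩
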